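/- Let $N\ge 2$, $m>0$, $\mu>0$, $\alpha\in\mathbb R$. Let $\hat f(k)=(2\pi)^{-d/2}\int_{\mathbb R^d} e^{-ik\cdot x}f(x)\,dx$ be the unitary Fourier transform on $L^2(\mathbb R^d)$. Write $H^s_{\rm as}(\mathbb R^{3(M+1)})$ for the functions in $H^s(\mathbb R^{3(M+1)})$ of variables $(x_0,x_1,\dots,x_M)$, $x_i\in\mathbb R^3$, that are antisymmetric under permutations of $x_1,\dots,x_M$. Put $$\mathcal G(k_0,\dots,k_N)=\Big(\tfrac1{2m}k_0^2+\tfrac12\sum_{i=1}^N k_i^2+\mu\Big)^{-1},$$ $$\mathcal L(k_0,\dots,k_{N-1})=2\pi^2\Big(\tfrac{2m}{m+1}\Big)^{3/2}\Big(\tfrac{k_0^2}{2(m+1)}+\tfrac12\sum_{i=1}^{N-1}k_i^2+\mu\Big)^{1/2}.$$ For $\xi\in H^{1/2}_{\rm as}(\mathbb R^{3N})$ let $\mathcal G\xi$ and $\tilde\Gamma\xi$ be given by $$\widehat{\mathcal G\xi}(k_0,\dots,k_N)=\mathcal G(k_0,\dots,k_N)\sum_{i=1}^N(-1)^{i+1}\hat\xi(k_0+k_i,k_1,\dots,k_{i-1},k_{i+1},\dots,k_N),$$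 $$\widehat{\tilde\Gamma\xi}(k_0,\dots,k_{N-1})=\mathcal L(k_0,\dots,k_{N-1})\,\hat\xi(k_0,\dots,k_{N-1})+\sum_{j=1}^{N-1}(-1)^{j+1}\int_{\mathbb R^3}\mathcal G(k_0-s,s,k_1,\dots,k_{N-1})\,\hat\xi(k_0+k_j-s,s,k_1,\dots,k_{j-1},k_{j+1},\dots,k_{N-1})\,ds .$$ The domain $D(\mathcal H_\alpha)$ consists of the $\psi\in L^2(\mathbb R^{3(N+1)})$ of the form $\psi=\phi+\mathcal G\xi$ with $\phi\in H^2_{\rm as}(\mathbb R^{3(N+1)})$, $\xi\in H^{1/2}_{\rm as}(\mathbb R^{3N})$ (the charge of $\psi$), $\tilde\Gamma\xi\in L^2(\mathbb R^{3N})$ and $$\phi\!\restriction_{x_N=x_0}=\frac{(-1)^{N+1}}{(2\pi)^{3/2}}\Big(\frac{2m\alpha}{m+1}+\tilde\Gamma\Big)\xi ,$$ where the left side is the $L^2$-trace, as a function of $(x_0,\dots,x_{N-1})$; and $$(\mathcal H_\alpha+\mu)\psi=\Big(-\tfrac1{2m}\Delta_{x_0}-\tfrac12\sum_{i=1}^N\Delta_{x_i}+\mu\Big)\phi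 .$$ Let $\psi\in D(\mathcal H_\alpha)$ with charge $\xi\in H^1(\mathbb R^{3N})$. Let $$n_\uparrow(k)=\int|\hat\psi(k,k_1,\dots,k_N)|^2\,dk_1\cdots dk_N,\qquad n_\downarrow(k)=N\int|\hat\psi(k_0,k,k_2,\dots,k_N)|^2\,dk_0\,dk_2\cdots dk_N,$$ $$C=\Big(\frac{2m}{m+1}\Big)^2N\,\|\xi\|_{L^2}^2,\qquad p_\uparrow=\frac{2m}{m+1}\,\|\xi\|_{L^2}^{-2}\int_{\mathbb R^{3N}} k_1\,|\hat\xi(k_1,\dots,k_N)|^2\,dk_1\cdots dk_N,\qquad p_\downarrow=\tfrac1m\,p_\uparrow$$ (with $p_\uparrow=p_\downarrow=0$ if $\xi=0$). Then $$k\mapsto k^2n_\uparrow(k)-\frac{C}{|k-p_\uparrow|^2}\in L^1(\mathbb R^3)\quad\text{and}\quad k\mapsto k^2n_\downarrow(k)-\frac{C}{|k-p_\downarrow|^2}\in L^1(\mathbb R^3),$$ and $$\langle\psi|\mathcal H_\alpha\psi\rangle=\int_{\mathbb R^3}\Big[\frac1{2m}\Big(k^2n_\uparrow(k)-\frac{C}{|k-p_\uparrow|^2}\Big)+\frac12\Big(k^2n_\downarrow(k)-\frac{C}{|k-p_\downarrow|^2}\Big)\Big]dk-\frac{m+1}{2m}\,C\,\alpha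 .$$ -/

import Mathlib

open MeasureTheory Filter Topology FourierTransform TemperedDistribution LineDeriv
open scoped SchwartzMap ENNReal

noncomputable section

namespace PointInteraction

/-- The one-particle space `ℝ³`. -/
abbrev E3 : Type := EuclideanSpace ℝ (Fin 3)

/-- Configurations (or momenta) `(x₀, x₁, …, x_M) ∈ ℝ^{3(M+1)}` of one distinguished particle,
with index `0`, and `M` further particles, with the Euclidean norm. -/
abbrev Conf (M : ℕ) : Type := PiLp 2 (fun _ : Fin (M + 1) => E3)

/-- The Hilbert space `L²(ℝ^{3(M+1)})`, with respect to Lebesgue measure. -/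
abbrev L2 (M : ℕ) : Type := Lp ℂ 2 (volume : Measure (Conf M))

/-- The point `(x₀, x₁, …, x_M)`. -/
def pt {M : ℕ} (x₀ : E3) (x : Fin M → E3) : Conf M :=
  WithLp.toLp 2 (Fin.cons x₀ x)

/-- The tuple `(x₁, …, x_M)` of a point `(x₀, x₁, …, x_M)`. -/
def rest {M : ℕ} (x : Conf M) : Fin M → E3 := fun i => x i.succ

/-- The unitary Fourier transform
`û(k) = (2π)^{-3(M+1)/2} ∫ e^{-i k·x} u(x) dx` on `L²`; Mathlib's `𝓕` has `e^{-2π i k·x}` and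
no prefactor. -/
def hat {M : ℕ} (u : L2 M) (k : Conf M) : ℂ :=
  (((2 * Real.pi) ^ (-(3 * ((M : ℝ) + 1)) / 2) : ℝ) : ℂ) *
    (𝓕 u : L2 M) ((2 * Real.pi)⁻¹ • k)

/-- Antisymmetry under permutations of the `M` particles with indices `1, …, M`. -/
def IsAntisymm {M : ℕ} (u : L2 M) : Prop :=
  ∀ σ : Equiv.Perm (Fin M), ∀ᵐ x : Conf M,
    u (pt (x 0) (fun i => rest x (σ i))) = ((Equiv.Perm.sign σ : ℤ) : ℂ) * u x

/-- `u ∈ H^s(ℝ^{3(M+1)})`, for `u ∈ L²`. -/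
def InSobolev {M : ℕ} (s : ℝ) (u : L2 M) : Prop :=
  MemSobolev s 2 (u : 𝓢'(Conf M, ℂ))

/-- The norm of `H^s`, `‖(1 + |k|²)^{s/2} û‖_{L²}`, with values in `[0, ∞]`. -/
def sobolevENorm {M : ℕ} (s : ℝ) (u : L2 M) : ℝ≥0∞ :=
  eLpNorm (fun k : Conf M => (((1 + ‖k‖ ^ 2) ^ (s / 2) : ℝ) : ℂ) * hat u k) 2 volume

/-- The point `(R, x₁, …, x_M, R)` of the plane on which the last particle sits at the position
of the distinguished one. -/
def coincidence {M : ℕ} (x : Conf M) : Conf (M + 1) :=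
  pt (x 0) (Fin.snoc (α := fun _ => E3) (rest x) (x 0))

/-- `g` is the `L²` trace of the `H²` function `φ` on the plane where the last particle meets the
distinguished one: the continuous extension of the restriction of Schwartz functions. -/
def IsTrace {M : ℕ} (φ : L2 (M + 1)) (g : L2 M) : Prop :=
  ∃ f : ℕ → 𝓢(Conf (M + 1), ℂ),
    Tendsto (fun j => sobolevENorm 2 ((f j).toLp 2 volume - φ)) atTop (𝓝 0) ∧
    Tendsto (fun j => eLpNorm (fun x : Conf M => f j (coincidence x) - g x) 2 volume)
      atTop (𝓝 0)

/-- The symbol `𝒢(k₀, …, k_M) = (k₀²/(2m) + ½ ∑ᵢ kᵢ² + μ)⁻¹`. -/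
def greenSymbol {M : ℕ} (m μ : ℝ) (k : Conf M) : ℝ :=
  (1 / (2 * m) * ‖k 0‖ ^ 2 + 1 / 2 * ∑ i, ‖rest k i‖ ^ 2 + μ)⁻¹

/-- The Fourier transform of `𝒢ξ`, where the `i`-th summand is
`± ξ̂(k₀ + kᵢ, k₁, …, kᵢ₋₁, kᵢ₊₁, …)`. The index `i` starts at `0` here. -/
def greenHat {M : ℕ} (m μ : ℝ) (ξ : L2 M) (k : Conf (M + 1)) : ℂ :=
  (greenSymbol m μ k : ℂ) *
    ∑ i : Fin (M + 1), (-1) ^ (i : ℕ) * hat ξ (pt (k 0 + rest k i) (i.removeNth (rest k)))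

/-- The symbol `ℒ(k₀, …, k_M) = 2π² (2m/(m+1))^{3/2} (k₀²/(2(m+1)) + ½ ∑ᵢ kᵢ² + μ)^{1/2}`. -/
def diagSymbol {M : ℕ} (m μ : ℝ) (k : Conf M) : ℝ :=
  2 * Real.pi ^ 2 * (2 * m / (m + 1)) ^ (3 / 2 : ℝ) *
    √(‖k 0‖ ^ 2 / (2 * (m + 1)) + 1 / 2 * ∑ i, ‖rest k i‖ ^ 2 + μ)

/-- The Fourier transform of `Γ ξ`, where `Γ` is the operator of the form
`𝒯_diag + 𝒯_off`. The index `j` starts at `0` here. -/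
def gammaHat {n : ℕ} (m μ : ℝ) (ξ : L2 (n + 1)) (k : Conf (n + 1)) : ℂ :=
  (diagSymbol m μ k : ℂ) * hat ξ k +
    ∑ j : Fin (n + 1), (-1) ^ (j : ℕ) *
      ∫ s : E3, (greenSymbol m μ (pt (k 0 - s) (Fin.cons s (rest k) : Fin (n + 2) → E3)) : ℂ) *
        hat ξ (pt (k 0 + rest k j - s)
          (Fin.cons s (j.removeNth (rest k)) : Fin (n + 1) → E3))

/-- `ψ` is in the domain of the Hamiltonian with parameter `α` for `N = n + 2` fermions of mass
`1` and one particle of mass `m`, with regular part `φ` and charge `ξ`: `ψ = φ + 𝒢ξ`, the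
function `Γξ` is in `L²`, and
`φ↾_{x_N = x₀} = (-1)^{N+1} (2π)^{-3/2} (2mα/(m+1) + Γ) ξ`. -/
structure IsDomainDecomposition {n : ℕ} (m α μ : ℝ) (ψ φ : L2 (n + 2)) (ξ : L2 (n + 1)) :
    Prop where
  regular_sobolev : InSobolev 2 φ
  regular_antisymm : IsAntisymm φ
  charge_sobolev : InSobolev (1 / 2) ξ
  charge_antisymm : IsAntisymm ξ
  decomposition : hat ψ =ᵐ[volume] fun k => hat φ k + greenHat m μ ξ k
  boundary : ∃ η : L2 (n + 1), hat η =ᵐ[volume] gammaHat m μ ξ ∧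
    IsTrace φ
      (((-1) ^ (n + 2 + 1) / (((2 * Real.pi) ^ (3 / 2 : ℝ) : ℝ) : ℂ)) •
        (((2 * m * α / (m + 1) : ℝ) : ℂ) • ξ + η))

/-- The `a`-th coordinate direction of particle `i`. -/
def dir {M : ℕ} (i : Fin (M + 1)) (a : Fin 3) : Conf M :=
  WithLp.toLp 2 (Pi.single i (EuclideanSpace.single a (1 : ℝ)))

/-- The Laplacian with respect to the position of particle `i`. -/
def particleLaplacian {M : ℕ} (i : Fin (M + 1)) (u : 𝓢'(Conf M, ℂ)) : 𝓢'(Conf M, ℂ) :=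
  ∑ a : Fin 3, ∂_{dir i a} (∂_{dir i a} u)

/-- The operator `-(2m)⁻¹ Δ_{x₀} - ½ ∑ᵢ Δ_{xᵢ}`, on tempered distributions. -/
def freeHamiltonian {M : ℕ} (m : ℝ) (u : 𝓢'(Conf M, ℂ)) : 𝓢'(Conf M, ℂ) :=
  -(((1 / (2 * m) : ℝ) : ℂ) • particleLaplacian 0 u)
    - ((1 / 2 : ℝ) : ℂ) • ∑ i : Fin M, particleLaplacian i.succ u

theorem memSobolev_sum {M : ℕ} {ι : Type*} (s : Finset ι) (f : ι → 𝓢'(Conf M, ℂ))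
    (h : ∀ i ∈ s, MemSobolev 0 2 (f i)) : MemSobolev 0 2 (∑ i ∈ s, f i) := by
  classical
  induction s using Finset.induction_on with
  | empty => exact memSobolev_fun_zero (E := Conf M) (F := ℂ) 0 2
  | insert a s ha ih =>
    rw [Finset.sum_insert ha]
    exact (h a (by simp)).add (ih fun i hi => h i (by simp [hi]))

theorem memSobolev_particleLaplacian {M : ℕ} (i : Fin (M + 1)) (u : 𝓢'(Conf M, ℂ))
    (h : MemSobolev 2 2 u) : MemSobolev 0 2 (particleLaplacian i u) := by
  refine memSobolev_sum _ _ fun a _ => ?_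
  have := (h.lineDerivOp (m := dir i a)).lineDerivOp (m := dir i a)
  norm_num at this
  exact this

/-- On `H²` the free Hamiltonian takes values in `L²`. -/
theorem exists_freeHamiltonian {M : ℕ} (m : ℝ) {φ : L2 M} (h : InSobolev 2 φ) :
    ∃ χ : L2 M, (χ : 𝓢'(Conf M, ℂ)) = freeHamiltonian m (φ : 𝓢'(Conf M, ℂ)) := by
  have h₁ := (memSobolev_particleLaplacian 0 _ h).smul ((1 / (2 * m) : ℝ) : ℂ)
  have h₂ := (memSobolev_sum Finset.univ _
    fun i _ => memSobolev_particleLaplacian (Fin.succ i) _ h).smul ((1 / 2 : ℝ) : ℂ)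
  have key : MemSobolev 0 2 (freeHamiltonian m (φ : 𝓢'(Conf M, ℂ))) := h₁.neg.sub h₂
  obtain ⟨χ, hχ⟩ := memSobolev_zero_iff.1 key
  exact ⟨χ, hχ.symm⟩

/-- The free Hamiltonian `H² → L²`. -/
def freeHamiltonianL2 {M : ℕ} (m : ℝ) (φ : L2 M) (h : InSobolev 2 φ) : L2 M :=
  (exists_freeHamiltonian m h).choose

/-- The value `H ψ` of the Hamiltonian at `ψ = φ + 𝒢ξ`, given by
`(H + μ) ψ = (-(2m)⁻¹ Δ_{x₀} - ½ ∑ᵢ Δ_{xᵢ} + μ) φ`. -/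
def hamiltonian {n : ℕ} {m α μ : ℝ} {ψ φ : L2 (n + 2)} {ξ : L2 (n + 1)}
    (h : IsDomainDecomposition m α μ ψ φ ξ) : L2 (n + 2) :=
  freeHamiltonianL2 m φ h.regular_sobolev + (μ : ℂ) • φ - (μ : ℂ) • ψ

/-- The momentum density of the particle of mass `m`. -/
def densityUp {M : ℕ} (ψ : L2 M) (k : E3) : ℝ :=
  ∫ q : Fin M → E3, ‖hat ψ (pt k q)‖ ^ 2

/-- The momentum density of the `N = M + 1` fermions:
`N ∫ |ψ̂(k₀, k, k₂, …, k_N)|² dk₀ dk₂ ⋯ dk_N`, where `q = (k₀, k₂, …, k_N)`. -/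
def densityDown {M : ℕ} (ψ : L2 (M + 1)) (k : E3) : ℝ :=
  ((M : ℝ) + 1) * ∫ q : Fin (M + 1) → E3,
    ‖hat ψ (pt (q 0) (Fin.cons k (Fin.tail q) : Fin (M + 1) → E3))‖ ^ 2

/-- The contact `C = (2m/(m+1))² N ‖ξ‖²`, for `N = M + 1` fermions. -/
def contact {M : ℕ} (m : ℝ) (ξ : L2 M) : ℝ :=
  (2 * m / (m + 1)) ^ 2 * ((M : ℝ) + 1) * ‖ξ‖ ^ 2

/-- `p_↑ = (2m/(m+1)) ‖ξ‖⁻² ∫ k₁ |ξ̂(k₁, …, k_N)|² dk₁ ⋯ dk_N`; the first variable of `ξ`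
has index `0` here. -/
def momentumUp {M : ℕ} (m : ℝ) (ξ : L2 M) : E3 :=
  (2 * m / (m + 1) * (‖ξ‖ ^ 2)⁻¹) • ∫ k : Conf M, ‖hat ξ k‖ ^ 2 • k 0

/-- `p_↓ = p_↑ / m`. -/
def momentumDown {M : ℕ} (m : ℝ) (ξ : L2 M) : E3 := (1 / m) • momentumUp m ξ

/-- `k² n_↑(k) - C / |k - p_↑|²`. -/
def tailUp {M : ℕ} (m : ℝ) (ψ : L2 (M + 1)) (ξ : L2 M) (k : E3) : ℝ :=
  ‖k‖ ^ 2 * densityUp ψ k - contact m ξ / ‖k - momentumUp m ξ‖ ^ 2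

/-- `k² n_↓(k) - C / |k - p_↓|²`. -/
def tailDown {M : ℕ} (m : ℝ) (ψ : L2 (M + 1)) (ξ : L2 M) (k : E3) : ℝ :=
  ‖k‖ ^ 2 * densityDown ψ k - contact m ξ / ‖k - momentumDown m ξ‖ ^ 2

end PointInteraction

end

/-!
In momentum space `ψ̂ = φ̂ + 𝒢 ∑ᵢ ±ξᵢ` with `ξᵢ = ξ̂(k₀ + kᵢ, k₁, …, kᵢ₋₁, kᵢ₊₁, …)`. In the
expansion of `k² |ψ̂|²` only the diagonal terms `k² 𝒢² |ξᵢ|²` fail to be integrable: the products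
with `φ̂` are controlled by its decay, and the products of different charge terms by a Schur test
with a weighted AM-GM inequality.

In terms of the momenta `w` after merging the distinguished particle with particle `i`, the symbol
`𝒢` is a multiple of `(|x - c w₀|² + b(w)²)⁻¹`, where `x` is the observed momentum and `c` the mass
fraction of the observed particle. For large `x`, `|x|² / (|x - q|² + b²)²` behaves
like `1/|x - 2q|²`, up to an integrable error. The average of `1/|x - 2q|²` over `w` is in turn
`1/|x - p|²`, with `p` the average of `2q`, up to an integrable error, because the leading term of
the difference is linear in `2q - p`. For `q = c w₀` this gives the poles `p_↑` and `p_↓`; the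
averages are finite since `ξ ∈ H¹`.

The integrals of these errors are explicit. Together with the kinetic energy of the other fermions
in the diagonal terms, which needs no subtraction, they add up to `-N` times the diagonal part
of `⟨ξ|Γξ⟩`, and the interference `∑_{i ≠ j} ±∫ 𝒢 ξ̄ᵢ ξⱼ` is `-N` times its off-diagonal part. What
remains is the pairing of `φ̂` with `∑ᵢ ±ξᵢ`: by antisymmetry it is `N` times the pairing of `ξ`
with the trace of `φ`, which the boundary condition expresses by `α ‖ξ‖²` and `⟨ξ|Γξ⟩`.
-/

noncomputable section

namespace PointInteraction

section ProductMeasure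

variable {ι : Type*} [Fintype ι] {E : ι → Type*} [∀ i, NormedAddCommGroup (E i)]
  [∀ i, InnerProductSpace ℝ (E i)] [∀ i, FiniteDimensional ℝ (E i)]
  [∀ i, MeasurableSpace (E i)] [∀ i, BorelSpace (E i)]

theorem measurePreserving_piLp_toLp :
    MeasurePreserving (WithLp.toLp 2 : (∀ i, E i) → PiLp 2 E) := by
  classical
  let b i := stdOrthonormalBasis ℝ (E i)
  let B : OrthonormalBasis (Σ i, Fin (Module.finrank ℝ (E i))) ℝ (PiLp 2 E) :=
    Pi.orthonormalBasis b
  have hm : Measurable (WithLp.toLp 2 : (∀ i, E i) → PiLp 2 E) := by fun_prop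
  refine ⟨hm, ?_⟩
  have hadd : (Measure.map (WithLp.toLp 2) volume : Measure (PiLp 2 E)).IsAddHaarMeasure :=
    (PiLp.continuousLinearEquiv 2 ℝ E).symm.isAddHaarMeasure_map volume
  rw [← B.addHaar_eq_volume, eq_comm, Module.Basis.addHaar_eq_iff,
    Measure.map_apply hm B.toBasis.parallelepiped.isCompact.measurableSet,
    Module.Basis.coe_parallelepiped]
  have hbox : WithLp.toLp 2 ⁻¹' parallelepiped B.toBasis =
      Set.univ.pi fun i => parallelepiped (b i) := by
    ext x
    simp only [← OrthonormalBasis.coe_toBasis, parallelepiped_basis_eq]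
    simp [B, Sigma.forall]
  rw [hbox, volume_pi_pi]
  exact Finset.prod_eq_one fun i _ => (b i).volume_parallelepiped

end ProductMeasure

section Configurations

variable {M : ℕ}

@[simp] theorem pt_zero (x₀ : E3) (x : Fin M → E3) : pt x₀ x 0 = x₀ := rfl

@[simp] theorem pt_succ (x₀ : E3) (x : Fin M → E3) (i : Fin M) : pt x₀ x i.succ = x i := rfl

@[simp] theorem rest_pt (x₀ : E3) (x : Fin M → E3) : rest (pt x₀ x) = x := rfl

@[simp] theorem pt_rest (x : Conf M) : pt (x 0) (rest x) = x :=
  PiLp.ext (Fin.cases rfl fun _ => rfl)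

theorem norm_sq_conf (x : Conf M) : ‖x‖ ^ 2 = ‖x 0‖ ^ 2 + ∑ i, ‖rest x i‖ ^ 2 := by
  rw [PiLp.norm_sq_eq_of_L2, Fin.sum_univ_succ]
  rfl

theorem finrank_conf (M : ℕ) : Module.finrank ℝ (Conf M) = 3 * (M + 1) := by
  rw [(WithLp.linearEquiv 2 ℝ (Fin (M + 1) → E3)).finrank_eq, Module.finrank_pi_fintype]
  simp [mul_comm]

/-- `(x₀, x) ↦ (x₀, x₁, …, x_M)` as an equivalence of measurable spaces. -/
def ptEquiv (M : ℕ) : E3 × (Fin M → E3) ≃ᵐ Conf M :=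
  (MeasurableEquiv.piFinSuccAbove (fun _ : Fin (M + 1) => E3) 0).symm.trans
    (MeasurableEquiv.toLp 2 (Fin (M + 1) → E3))

theorem ptEquiv_apply (p : E3 × (Fin M → E3)) : ptEquiv M p = pt p.1 p.2 := by
  simp [ptEquiv, pt, MeasurableEquiv.piFinSuccAbove, Fin.insertNthEquiv]

theorem coe_ptEquiv : ⇑(ptEquiv M) = fun p => pt p.1 p.2 := funext ptEquiv_apply

theorem measurePreserving_pt : MeasurePreserving fun p : E3 × (Fin M → E3) => pt p.1 p.2 := by
  rw [← coe_ptEquiv]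
  exact ((volume_preserving_piFinSuccAbove (fun _ : Fin (M + 1) => E3) 0).symm).trans
    measurePreserving_piLp_toLp

theorem measurableEmbedding_pt :
    MeasurableEmbedding fun p : E3 × (Fin M → E3) => pt p.1 p.2 :=
  coe_ptEquiv (M := M) ▸ (ptEquiv M).measurableEmbedding

theorem continuous_pt : Continuous fun p : E3 × (Fin M → E3) => pt p.1 p.2 := by
  unfold pt
  fun_prop

theorem continuous_rest : Continuous fun x : Conf M => rest x := by
  unfold rest
  fun_prop

end Configurations

section Permutations

variable {M : ℕ}

/-- The extension of a permutation of the `M` identical particles to all `M + 1` particles that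
fixes the distinguished one. -/
def extendPerm (σ : Equiv.Perm (Fin M)) : Equiv.Perm (Fin (M + 1)) :=
  Equiv.Perm.decomposeFin.symm (0, σ)

@[simp] theorem extendPerm_zero (σ : Equiv.Perm (Fin M)) : extendPerm σ 0 = 0 := by
  simp [extendPerm]

@[simp] theorem extendPerm_succ (σ : Equiv.Perm (Fin M)) (i : Fin M) :
    extendPerm σ i.succ = (σ i).succ := by
  simp [extendPerm]

theorem sign_extendPerm (σ : Equiv.Perm (Fin M)) :
    Equiv.Perm.sign (extendPerm σ) = Equiv.Perm.sign σ := by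
  simp [extendPerm]

theorem exists_extendPerm_eq {τ : Equiv.Perm (Fin (M + 1))} (h : τ 0 = 0) :
    ∃ σ, extendPerm σ = τ := by
  obtain ⟨⟨i, σ⟩, rfl⟩ := Equiv.Perm.decomposeFin.symm.surjective τ
  rw [Equiv.Perm.decomposeFin_symm_apply_zero] at h
  exact ⟨σ, by rw [extendPerm, h]⟩

/-- The action `(x₀, x₁, …, x_M) ↦ (x₀, x_{σ 1}, …, x_{σ M})` of a permutation of the identical
particles on configurations. -/
def permConf (σ : Equiv.Perm (Fin M)) : Conf M ≃ₗᵢ[ℝ] Conf M :=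
  LinearIsometryEquiv.piLpCongrLeft 2 ℝ E3 (extendPerm σ).symm

theorem permConf_apply (σ : Equiv.Perm (Fin M)) (x : Conf M) :
    permConf σ x = pt (x 0) fun i => rest x (σ i) := by
  refine PiLp.ext (Fin.cases ?_ fun i => ?_) <;> simp [permConf, Equiv.piCongrLeft', rest]

@[simp] theorem permConf_zero (σ : Equiv.Perm (Fin M)) (k : Conf M) : permConf σ k 0 = k 0 := by
  rw [permConf_apply, pt_zero]

@[simp] theorem rest_permConf (σ : Equiv.Perm (Fin M)) (k : Conf M) (i : Fin M) :
    rest (permConf σ k) i = rest k (σ i) := by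
  rw [permConf_apply, rest_pt]

theorem permConf_permConf (σ τ : Equiv.Perm (Fin M)) (k : Conf M) :
    permConf σ (permConf τ k) = permConf (τ * σ) k := by
  simp [permConf_apply]

theorem measurePreserving_permConf (σ : Equiv.Perm (Fin M)) : MeasurePreserving (permConf σ) :=
  (permConf σ).measurePreserving

theorem measurableEmbedding_permConf (σ : Equiv.Perm (Fin M)) : MeasurableEmbedding (permConf σ) :=
  (permConf σ).toHomeomorph.measurableEmbedding

/-- Antisymmetry of a function on configurations, up to null sets. `IsAntisymm` is its version for
elements of `L²`. -/
def AEAntisymm (X : Conf M → ℂ) : Prop :=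
  ∀ σ : Equiv.Perm (Fin M), ∀ᵐ k : Conf M, X (permConf σ k) = ((Equiv.Perm.sign σ : ℤ) : ℂ) * X k

theorem isAntisymm_iff_aeAntisymm {u : L2 M} : IsAntisymm u ↔ AEAntisymm u := by
  simp only [IsAntisymm, AEAntisymm, permConf_apply]

theorem sign_mul_sign {ι : Type*} [Fintype ι] [DecidableEq ι] (σ : Equiv.Perm ι) :
    ((Equiv.Perm.sign σ : ℤ) : ℂ) * ((Equiv.Perm.sign σ : ℤ) : ℂ) = 1 := by
  exact_mod_cast Int.units_coe_mul_self (Equiv.Perm.sign σ)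

theorem norm_sign_mul {ι : Type*} [Fintype ι] [DecidableEq ι] (σ : Equiv.Perm ι) (z : ℂ) :
    ‖((Equiv.Perm.sign σ : ℤ) : ℂ) * z‖ = ‖z‖ := by
  rcases Int.units_eq_one_or (Equiv.Perm.sign σ) with h | h <;> simp [h]

end Permutations

section FourierGeneral

variable {E F : Type*} [NormedAddCommGroup E] [InnerProductSpace ℝ E] [FiniteDimensional ℝ E]
  [MeasurableSpace E] [BorelSpace E] [NormedAddCommGroup F]

theorem ae_comp_const_smul {p : E → Prop} {c : ℝ} (hc : c ≠ 0) (h : ∀ᵐ k, p k) :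
    ∀ᵐ k : E, p (c • k) :=
  (Measure.quasiMeasurePreserving_smul volume hc).ae h

theorem memLp_comp_const_smul {f : E → F} {p : ℝ≥0∞} {c : ℝ} (hc : c ≠ 0) (hf : MemLp f p) :
    MemLp (fun k => f (c • k)) p := by
  have h : MemLp f p (Measure.map (c • ·) (volume : Measure E)) := by
    rw [Measure.map_addHaar_smul _ hc]
    exact hf.smul_measure ENNReal.ofReal_ne_top
  exact h.comp_of_map (measurable_const_smul _).aemeasurable

theorem ae_eq_smul_of_smulLeftCLM_eq [NormedSpace ℂ F] [CompleteSpace F] {p : ℝ≥0∞}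
    [hp : Fact (1 ≤ p)] {g : E → ℂ} (hg : g.HasTemperateGrowth) {u v : Lp F p (volume : Measure E)}
    (h : smulLeftCLM F g (u : 𝓢'(E, F)) = (v : 𝓢'(E, F))) :
    v =ᵐ[volume] fun k => g k • u k := by
  have hu : LocallyIntegrable u := (Lp.memLp u).locallyIntegrable hp.out
  have hgu : LocallyIntegrable fun k => g k • u k := hu.continuous_smul hg.1.continuous
  refine ae_eq_of_integral_contDiff_smul_eq ((Lp.memLp v).locallyIntegrable hp.out) hgu
    fun f f_smooth f_cpt => ?_
  have hf₁ : HasCompactSupport (Complex.ofRealCLM ∘ f) := f_cpt.comp_left rfl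
  have hf₂ : ContDiff ℝ (⊤ : ℕ∞) (Complex.ofRealCLM ∘ f) := by fun_prop
  have htest := congrArg (fun T : 𝓢'(E, F) => T (hf₁.toSchwartzMap hf₂)) h
  simp only [smulLeftCLM_apply_apply, Lp.toTemperedDistribution_apply,
    SchwartzMap.smulLeftCLM_apply_apply hg, HasCompactSupport.toSchwartzMap_toFun,
    Function.comp_apply, Complex.ofRealCLM_apply] at htest
  calc ∫ k, f k • v k = ∫ k, (f k : ℂ) • v k := by simp only [Complex.coe_smul]
    _ = ∫ k, (g k • (f k : ℂ)) • u k := htest.symm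
    _ = ∫ k, f k • g k • u k := by simp only [smul_eq_mul, mul_comm (g _), mul_smul,
      Complex.coe_smul]

theorem fourier_compMeasurePreserving [InnerProductSpace ℂ F] [CompleteSpace F] {E' : Type*}
    [NormedAddCommGroup E'] [InnerProductSpace ℝ E'] [FiniteDimensional ℝ E']
    [MeasurableSpace E'] [BorelSpace E'] (R : E' ≃ₗᵢ[ℝ] E) (u : Lp F 2 (volume : Measure E)) :
    (𝓕 (Lp.compMeasurePreserving R R.measurePreserving u) : Lp F 2 (volume : Measure E')) =
      Lp.compMeasurePreserving R R.measurePreserving (𝓕 u) := by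
  have hR : Continuous fun u : Lp F 2 (volume : Measure E) =>
      Lp.compMeasurePreserving R R.measurePreserving u :=
    (Lp.compMeasurePreservingₗᵢ ℂ R R.measurePreserving).continuous
  have hF : Continuous fun u : Lp F 2 (volume : Measure E) => (𝓕 u : Lp F 2 volume) :=
    (Lp.fourierTransformₗᵢ E F).continuous
  have hF' : Continuous fun u : Lp F 2 (volume : Measure E') => (𝓕 u : Lp F 2 volume) :=
    (Lp.fourierTransformₗᵢ E' F).continuous
  have hS (g : 𝓢(E, F)) : Lp.compMeasurePreserving R R.measurePreserving (g.toLp 2) =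
      (SchwartzMap.compCLMOfContinuousLinearEquiv ℂ R.toContinuousLinearEquiv g).toLp 2 := by
    refine Lp.ext <| (Lp.coeFn_compMeasurePreserving _ _).trans <|
      EventuallyEq.trans ?_ (SchwartzMap.coeFn_toLp _ 2 volume).symm
    exact R.measurePreserving.quasiMeasurePreserving.ae_eq_comp (SchwartzMap.coeFn_toLp g 2 volume)
  refine DenseRange.induction_on
    (p := fun u => 𝓕 (Lp.compMeasurePreserving R R.measurePreserving u) =
      Lp.compMeasurePreserving R R.measurePreserving (𝓕 u))
    (SchwartzMap.denseRange_toLpCLM (p := 2) ENNReal.ofNat_ne_top) u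
    (isClosed_eq (hF'.comp hR) (hR.comp hF)) fun f => ?_
  rw [SchwartzMap.toLpCLM_apply, hS, SchwartzMap.toLp_fourier_eq, SchwartzMap.toLp_fourier_eq, hS]
  congr 1
  ext x
  simp only [SchwartzMap.fourier_coe]
  exact Real.fourier_comp_linearIsometry R f x

end FourierGeneral

section Hat

variable {M : ℕ}

theorem inv_two_pi_ne_zero : (2 * Real.pi)⁻¹ ≠ 0 := by positivity

theorem measurable_hat (u : L2 M) : Measurable (hat u) := by
  have h : Measurable (𝓕 u : L2 M) := (Lp.stronglyMeasurable _).measurable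
  exact (h.comp (measurable_const_smul ((2 * Real.pi)⁻¹ : ℝ))).const_mul _

theorem hat_add (u v : L2 M) : hat (u + v) =ᵐ[volume] fun k => hat u k + hat v k := by
  have h : (𝓕 (u + v) : L2 M) = 𝓕 u + 𝓕 v := FourierAdd.fourier_add u v
  filter_upwards [ae_comp_const_smul inv_two_pi_ne_zero (Lp.coeFn_add (𝓕 u : L2 M) (𝓕 v))]
    with k hk
  simp only [hat, h, hk, Pi.add_apply, mul_add]

theorem hat_smul (c : ℂ) (u : L2 M) : hat (c • u) =ᵐ[volume] fun k => c * hat u k := by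
  have h : (𝓕 (c • u) : L2 M) = c • 𝓕 u := FourierSMul.fourier_smul c u
  filter_upwards [ae_comp_const_smul inv_two_pi_ne_zero (Lp.coeFn_smul c (𝓕 u : L2 M))] with k hk
  simp only [hat, h, hk, Pi.smul_apply, smul_eq_mul]
  ring

theorem hat_sub (u v : L2 M) : hat (u - v) =ᵐ[volume] fun k => hat u k - hat v k := by
  have h := hat_add u ((-1 : ℂ) • v)
  rw [neg_one_smul, ← sub_eq_add_neg] at h
  filter_upwards [h, neg_one_smul ℂ v ▸ hat_smul (-1 : ℂ) v] with k hk hk'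
  rw [hk, hk', neg_one_mul, sub_eq_add_neg]

theorem memLp_hat (u : L2 M) : MemLp (hat u) 2 :=
  (memLp_comp_const_smul inv_two_pi_ne_zero (Lp.memLp (𝓕 u : L2 M))).const_mul _

theorem conj_hat_mul_hat (u v : L2 M) (k : Conf M) :
    starRingEnd ℂ (hat u k) * hat v k = (((2 * Real.pi) ^ (3 * (M + 1)))⁻¹ : ℝ) *
      inner ℂ ((𝓕 u : L2 M) ((2 * Real.pi)⁻¹ • k)) ((𝓕 v : L2 M) ((2 * Real.pi)⁻¹ • k)) := by
  have hpow : (2 * Real.pi) ^ (-(3 * ((M : ℝ) + 1)) / 2) *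
      (2 * Real.pi) ^ (-(3 * ((M : ℝ) + 1)) / 2) = ((2 * Real.pi) ^ (3 * (M + 1)))⁻¹ := by
    rw [← Real.rpow_add Real.two_pi_pos, add_halves, Real.rpow_neg Real.two_pi_pos.le,
      ← Real.rpow_natCast]
    push_cast
    rfl
  rw [← hpow, RCLike.inner_apply]
  simp only [hat, map_mul, Complex.conj_ofReal, Complex.ofReal_mul]
  ring

theorem inner_eq_integral_conj_hat_mul_hat (u v : L2 M) :
    inner ℂ u v = ∫ k, starRingEnd ℂ (hat u k) * hat v k := by
  have hscale := Measure.integral_comp_smul (volume : Measure (Conf M))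
    (fun k => inner ℂ ((𝓕 u : L2 M) k) ((𝓕 v : L2 M) k)) (2 * Real.pi)⁻¹
  have hpos : 0 < (2 * Real.pi) ^ (3 * (M + 1)) := by positivity
  have hcancel : ((2 * Real.pi) ^ (3 * (M + 1)))⁻¹ * |((2 * Real.pi)⁻¹ ^ (3 * (M + 1)))⁻¹| = 1 := by
    rw [inv_pow, inv_inv, abs_of_pos hpos, inv_mul_cancel₀ hpos.ne']
  simp_rw [conj_hat_mul_hat]
  rw [integral_const_mul, hscale, finrank_conf, Complex.real_smul, ← mul_assoc,
    ← Complex.ofReal_mul, hcancel, Complex.ofReal_one, one_mul, ← MeasureTheory.L2.inner_def,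
    Lp.inner_fourier_eq]

theorem integral_norm_sq_hat (u : L2 M) : ∫ k, ‖hat u k‖ ^ 2 = ‖u‖ ^ 2 := by
  have h := inner_eq_integral_conj_hat_mul_hat u u
  simp_rw [RCLike.conj_mul] at h
  rw [inner_self_eq_norm_sq_to_K] at h
  norm_cast at h
  exact_mod_cast h.symm

theorem IsAntisymm.aeAntisymm_hat {u : L2 M} (h : IsAntisymm u) : AEAntisymm (hat u) := by
  intro σ
  let R := permConf σ
  have hu : Lp.compMeasurePreserving R R.measurePreserving u =
      ((Equiv.Perm.sign σ : ℤ) : ℂ) • u := by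
    refine Lp.ext ((Lp.coeFn_compMeasurePreserving _ _).trans ?_)
    filter_upwards [isAntisymm_iff_aeAntisymm.1 h σ,
      Lp.coeFn_smul ((Equiv.Perm.sign σ : ℤ) : ℂ) u] with x hx hx'
    rw [hx', Function.comp_apply, hx, Pi.smul_apply, smul_eq_mul]
  have hFu := Lp.coeFn_compMeasurePreserving (𝓕 u : L2 M) R.measurePreserving
  rw [← fourier_compMeasurePreserving, hu] at hFu
  filter_upwards [ae_comp_const_smul inv_two_pi_ne_zero hFu,
    hat_smul ((Equiv.Perm.sign σ : ℤ) : ℂ) u] with k hk hk'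
  rw [← hk', hat, hat, hk, Function.comp_apply, map_smul]

end Hat

section Sobolev

variable {M : ℕ}

/-- `X` is, as a function of momentum, the Fourier transform of an element of `H^s`. -/
structure MemFourierSobolev (s : ℝ) (X : Conf M → ℂ) : Prop where
  measurable : Measurable X
  memLp : MemLp (fun k => (((1 + ‖k‖ ^ 2) ^ (s / 2) : ℝ) : ℂ) * X k) 2

theorem one_add_norm_sq_rpow_le {E : Type*} [NormedAddCommGroup E] [NormedSpace ℝ E] {s c : ℝ}
    (hs : 0 ≤ s) (hc : 1 ≤ c) (k : E) :
    (1 + ‖k‖ ^ 2) ^ (s / 2) ≤ c ^ s * (1 + ‖c⁻¹ • k‖ ^ 2) ^ (s / 2) := by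
  have hc₀ : 0 < c := one_pos.trans_le hc
  have hpow : c ^ s = (c ^ 2) ^ (s / 2) := by
    rw [← Real.rpow_natCast, ← Real.rpow_mul hc₀.le, Nat.cast_ofNat, mul_div_cancel₀ s two_ne_zero]
  have hnorm : c ^ 2 * (1 + ‖c⁻¹ • k‖ ^ 2) = c ^ 2 + ‖k‖ ^ 2 := by
    rw [norm_smul, Real.norm_of_nonneg (by positivity)]
    field_simp
  rw [hpow, ← Real.mul_rpow (by positivity) (by positivity), hnorm]
  gcongr
  exact one_le_pow₀ hc

theorem InSobolev.memFourierSobolev_hat {s : ℝ} (hs : 0 ≤ s) {u : L2 M} (h : InSobolev s u) :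
    MemFourierSobolev s (hat u) := by
  obtain ⟨v, hv⟩ := memSobolev_iff_exists_smulLeftCLM_fourier.1 h
  rw [Lp.fourier_toTemperedDistribution_eq] at hv
  have hae := ae_eq_smul_of_smulLeftCLM_eq (by fun_prop) hv
  have hv' := ((memLp_comp_const_smul inv_two_pi_ne_zero (Lp.memLp v)).const_mul
    (((2 * Real.pi) ^ (-(3 * ((M : ℝ) + 1)) / 2) : ℝ) : ℂ)).const_mul
      (((2 * Real.pi) ^ s : ℝ) : ℂ)
  refine ⟨measurable_hat u, hv'.mono ?_ ?_⟩
  · exact ((Complex.measurable_ofReal.comp (by fun_prop)).mul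
      (measurable_hat u)).aestronglyMeasurable
  · filter_upwards [ae_comp_const_smul inv_two_pi_ne_zero hae] with k hk
    have hp : (1 : ℝ) ≤ 2 * Real.pi := by linarith [Real.pi_gt_three]
    have hw (x : Conf M) : ‖(((1 + ‖x‖ ^ 2) ^ (s / 2) : ℝ) : ℂ)‖ = (1 + ‖x‖ ^ 2) ^ (s / 2) := by
      rw [Complex.norm_real, Real.norm_of_nonneg (by positivity)]
    have hc : ‖(((2 * Real.pi) ^ s : ℝ) : ℂ)‖ = (2 * Real.pi) ^ s := by
      rw [Complex.norm_real, Real.norm_of_nonneg (by positivity)]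
    simp only [hk, hat, norm_mul, smul_eq_mul, hw, hc]
    refine (mul_le_mul_of_nonneg_right (one_add_norm_sq_rpow_le hs hp k) (by positivity)).trans_eq
      (by ring)

theorem MemFourierSobolev.memLp_mul {s : ℝ} {X : Conf M → ℂ} (hX : MemFourierSobolev s X)
    {v : Conf M → ℝ} (hv : Measurable v) {C : ℝ} (hC : ∀ k, |v k| ≤ C * (1 + ‖k‖ ^ 2) ^ (s / 2)) :
    MemLp (fun k => (v k : ℂ) * X k) 2 := by
  refine (hX.memLp.const_mul (C : ℂ)).mono
    ((Complex.measurable_ofReal.comp hv).mul hX.measurable).aestronglyMeasurable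
    (Eventually.of_forall fun k => ?_)
  have hpos : (0 : ℝ) ≤ (1 + ‖k‖ ^ 2) ^ (s / 2) := by positivity
  simp only [norm_mul, Complex.norm_real, Real.norm_eq_abs, ← mul_assoc]
  gcongr
  exact (hC k).trans (mul_le_mul_of_nonneg_right (le_abs_self C) hpos |>.trans_eq
    (by rw [abs_of_nonneg hpos]))

theorem MemFourierSobolev.integrable {s : ℝ} {X : Conf M → ℂ} (hX : MemFourierSobolev s X) :
    Integrable fun k => (1 + ‖k‖ ^ 2) ^ s * ‖X k‖ ^ 2 := by
  refine (hX.memLp.integrable_norm_pow two_ne_zero).congr (Eventually.of_forall fun k => ?_)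
  simp only [norm_mul, mul_pow, Complex.norm_real, Real.norm_eq_abs, sq_abs]
  rw [← Real.rpow_mul_natCast (by positivity), Nat.cast_ofNat, div_mul_cancel₀ s two_ne_zero]

end Sobolev

section FreeHamiltonian

theorem hasTemperateGrowth_const_smul {E : Type*} [NormedAddCommGroup E] [NormedSpace ℝ E]
    {g : E → ℂ} (c : ℂ) (hg : g.HasTemperateGrowth) : (c • g).HasTemperateGrowth :=
  (Function.HasTemperateGrowth.const c).smul hg

variable {M : ℕ}

theorem inner_dir (k : Conf M) (i : Fin (M + 1)) (a : Fin 3) : inner ℝ k (dir i a) = k i a := by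
  rw [PiLp.inner_apply, Finset.sum_eq_single i]
  · simp only [dir, Pi.single_eq_same, EuclideanSpace.inner_single_right]
    simp
  · intro j _ hj
    simp [dir, hj]
  · simp

theorem hasTemperateGrowth_coord (i : Fin (M + 1)) (a : Fin 3) :
    (fun k : Conf M => ((k i a : ℝ) : ℂ)).HasTemperateGrowth := by
  have h : (fun k : Conf M => ((inner ℝ k (dir i a) : ℝ) : ℂ)).HasTemperateGrowth := by fun_prop
  simpa only [inner_dir] using h

theorem ofReal_norm_sq_particle (i : Fin (M + 1)) :
    (fun k : Conf M => ((‖k i‖ ^ 2 : ℝ) : ℂ)) =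
      fun k => ∑ a : Fin 3, ((k i a : ℝ) : ℂ) * ((k i a : ℝ) : ℂ) := by
  funext k
  rw [EuclideanSpace.norm_sq_eq]
  simp [sq]

theorem hasTemperateGrowth_norm_sq_particle (i : Fin (M + 1)) :
    (fun k : Conf M => ((‖k i‖ ^ 2 : ℝ) : ℂ)).HasTemperateGrowth := by
  rw [ofReal_norm_sq_particle]
  exact .sum fun a _ => (hasTemperateGrowth_coord i a).mul (hasTemperateGrowth_coord i a)

theorem fourier_lineDeriv_lineDeriv_dir (i : Fin (M + 1)) (a : Fin 3) (u : 𝓢'(Conf M, ℂ)) :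
    𝓕 (∂_{dir i a} (∂_{dir i a} u)) = (-(2 * Real.pi) ^ 2 : ℂ) •
      smulLeftCLM ℂ (fun k : Conf M => ((k i a : ℝ) : ℂ) * ((k i a : ℝ) : ℂ)) (𝓕 u) := by
  rw [fourier_lineDerivOp_eq, fourier_lineDerivOp_eq]
  simp only [inner_dir]
  rw [map_smul, smulLeftCLM_smulLeftCLM_apply (hasTemperateGrowth_coord i a)
    (hasTemperateGrowth_coord i a), smul_smul, mul_mul_mul_comm, Complex.I_mul_I]
  congr 1
  ring

theorem fourier_particleLaplacian (i : Fin (M + 1)) (u : 𝓢'(Conf M, ℂ)) :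
    𝓕 (particleLaplacian i u) =
      (-(2 * Real.pi) ^ 2 : ℂ) • smulLeftCLM ℂ (fun k => ((‖k i‖ ^ 2 : ℝ) : ℂ)) (𝓕 u) := by
  have hsum : 𝓕 (particleLaplacian i u) = ∑ a : Fin 3, 𝓕 (∂_{dir i a} (∂_{dir i a} u)) :=
    map_sum (fourierCLM ℂ 𝓢'(Conf M, ℂ)) _ _
  have hsymbol : smulLeftCLM ℂ (fun k : Conf M => ((‖k i‖ ^ 2 : ℝ) : ℂ)) =
      ∑ a : Fin 3, smulLeftCLM ℂ fun k : Conf M => ((k i a : ℝ) : ℂ) * ((k i a : ℝ) : ℂ) := by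
    rw [ofReal_norm_sq_particle]
    exact smulLeftCLM_sum fun a _ =>
      (hasTemperateGrowth_coord i a).mul (hasTemperateGrowth_coord i a)
  rw [hsum, hsymbol]
  simp only [fourier_lineDeriv_lineDeriv_dir, ← Finset.smul_sum, sum_apply]

/-- The kinetic energy `k₀²/(2m) + ½ ∑ᵢ kᵢ²`, the Fourier symbol of the free Hamiltonian. -/
def kinetic (m : ℝ) (k : Conf M) : ℝ :=
  1 / (2 * m) * ‖k 0‖ ^ 2 + 1 / 2 * ∑ i, ‖rest k i‖ ^ 2

theorem kinetic_smul (m c : ℝ) (k : Conf M) : kinetic m (c • k) = c ^ 2 * kinetic m k := by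
  simp only [kinetic, rest, PiLp.smul_apply, norm_smul, mul_pow, Real.norm_eq_abs, sq_abs,
    ← Finset.mul_sum]
  ring

theorem ofReal_kinetic (m : ℝ) :
    (fun k : Conf M => (kinetic m k : ℂ)) =
      ((1 / (2 * m) : ℝ) : ℂ) • (fun k : Conf M => ((‖k 0‖ ^ 2 : ℝ) : ℂ)) +
        ((1 / 2 : ℝ) : ℂ) • fun k : Conf M => ∑ i : Fin M, ((‖k i.succ‖ ^ 2 : ℝ) : ℂ) := by
  funext k
  simp [kinetic, rest]

theorem hasTemperateGrowth_sum_norm_sq :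
    (fun k : Conf M => ∑ i : Fin M, ((‖k i.succ‖ ^ 2 : ℝ) : ℂ)).HasTemperateGrowth :=
  .sum fun i _ => hasTemperateGrowth_norm_sq_particle i.succ

theorem hasTemperateGrowth_kinetic (m : ℝ) :
    (fun k : Conf M => (kinetic m k : ℂ)).HasTemperateGrowth := by
  rw [ofReal_kinetic]
  exact (hasTemperateGrowth_const_smul _ (hasTemperateGrowth_norm_sq_particle 0)).add
    (hasTemperateGrowth_const_smul _ hasTemperateGrowth_sum_norm_sq)

theorem smulLeftCLM_kinetic (m : ℝ) :
    smulLeftCLM ℂ (fun k : Conf M => (kinetic m k : ℂ)) =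
      ((1 / (2 * m) : ℝ) : ℂ) • smulLeftCLM ℂ (fun k : Conf M => ((‖k 0‖ ^ 2 : ℝ) : ℂ)) +
        ((1 / 2 : ℝ) : ℂ) • ∑ i : Fin M,
          smulLeftCLM ℂ (fun k : Conf M => ((‖k i.succ‖ ^ 2 : ℝ) : ℂ)) := by
  have h₀ := hasTemperateGrowth_norm_sq_particle (M := M) 0
  have hs := hasTemperateGrowth_sum_norm_sq (M := M)
  rw [ofReal_kinetic, smulLeftCLM_add (hasTemperateGrowth_const_smul _ h₀)
    (hasTemperateGrowth_const_smul _ hs), smulLeftCLM_smul h₀, smulLeftCLM_smul hs,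
    smulLeftCLM_sum fun i _ => hasTemperateGrowth_norm_sq_particle i.succ]

theorem fourier_freeHamiltonian (m : ℝ) (u : 𝓢'(Conf M, ℂ)) :
    𝓕 (freeHamiltonian m u) =
      ((2 * Real.pi) ^ 2 : ℂ) • smulLeftCLM ℂ (fun k => (kinetic m k : ℂ)) (𝓕 u) := by
  have hlin : 𝓕 (freeHamiltonian m u) =
      -(((1 / (2 * m) : ℝ) : ℂ) • 𝓕 (particleLaplacian 0 u))
        - ((1 / 2 : ℝ) : ℂ) • ∑ i : Fin M, 𝓕 (particleLaplacian i.succ u) := by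
    change fourierCLM ℂ 𝓢'(Conf M, ℂ) (freeHamiltonian m u) = _
    rw [freeHamiltonian, map_sub, map_neg, map_smul, map_smul, map_sum]
    rfl
  simp only [hlin, fourier_particleLaplacian, smulLeftCLM_kinetic, ← Finset.smul_sum,
    add_apply, smul_apply, sum_apply]
  module

theorem hat_freeHamiltonianL2 (m : ℝ) (φ : L2 M) (h : InSobolev 2 φ) :
    hat (freeHamiltonianL2 m φ h) =ᵐ[volume] fun k => (kinetic m k : ℂ) * hat φ k := by
  have hχ := congrArg (fun T : 𝓢'(Conf M, ℂ) => 𝓕 T) (exists_freeHamiltonian m h).choose_spec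
  simp only [fourier_freeHamiltonian, Lp.fourier_toTemperedDistribution_eq,
    ← smul_apply, ← smulLeftCLM_smul (hasTemperateGrowth_kinetic m)] at hχ
  have hae := ae_eq_smul_of_smulLeftCLM_eq
    (hasTemperateGrowth_const_smul _ (hasTemperateGrowth_kinetic m)) hχ.symm
  filter_upwards [ae_comp_const_smul inv_two_pi_ne_zero hae] with k hk
  have hpi : ((2 * Real.pi : ℝ) : ℂ) ≠ 0 := by exact_mod_cast Real.two_pi_pos.ne'
  rw [hat, freeHamiltonianL2, hk, hat]
  simp only [Pi.smul_apply, kinetic_smul, smul_eq_mul]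
  push_cast at hpi ⊢
  field_simp

end FreeHamiltonian

section BochnerIntegral

/-- `f` is integrable with integral `a`: the analogue of `HasSum` for the Bochner integral, which
keeps track of integrability through a computation. -/
def HasBochnerIntegral {α E : Type*} [MeasurableSpace α] [NormedAddCommGroup E] [NormedSpace ℝ E]
    (f : α → E) (μ : Measure α) (a : E) : Prop :=
  Integrable f μ ∧ ∫ x, f x ∂μ = a

namespace HasBochnerIntegral

variable {α β E : Type*} [MeasurableSpace α] [MeasurableSpace β] [NormedAddCommGroup E]
  [NormedSpace ℝ E] {f g : α → E} {μ : Measure α} {ν : Measure β} {a b : E}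

theorem of_integrable (hf : Integrable f μ) : HasBochnerIntegral f μ (∫ x, f x ∂μ) := ⟨hf, rfl⟩

theorem add (hf : HasBochnerIntegral f μ a) (hg : HasBochnerIntegral g μ b) :
    HasBochnerIntegral (fun x => f x + g x) μ (a + b) :=
  ⟨hf.1.add hg.1, by rw [integral_add hf.1 hg.1, hf.2, hg.2]⟩

theorem sub (hf : HasBochnerIntegral f μ a) (hg : HasBochnerIntegral g μ b) :
    HasBochnerIntegral (fun x => f x - g x) μ (a - b) :=
  ⟨hf.1.sub hg.1, by rw [integral_sub hf.1 hg.1, hf.2, hg.2]⟩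

theorem const_mul {𝕜 : Type*} [RCLike 𝕜] {f : α → 𝕜} {a : 𝕜} (c : 𝕜)
    (hf : HasBochnerIntegral f μ a) : HasBochnerIntegral (fun x => c * f x) μ (c * a) :=
  ⟨hf.1.const_mul c, by rw [integral_const_mul, hf.2]⟩

theorem sum {ι : Type*} (s : Finset ι) {f : ι → α → E} {a : ι → E}
    (h : ∀ i ∈ s, HasBochnerIntegral (f i) μ (a i)) :
    HasBochnerIntegral (fun x => ∑ i ∈ s, f i x) μ (∑ i ∈ s, a i) :=
  ⟨integrable_finsetSum s fun i hi => (h i hi).1, by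
    rw [integral_finsetSum s fun i hi => (h i hi).1]
    exact Finset.sum_congr rfl fun i hi => (h i hi).2⟩

theorem congr (hf : HasBochnerIntegral f μ a) (h : f =ᵐ[μ] g) : HasBochnerIntegral g μ a :=
  ⟨hf.1.congr h, by rw [← integral_congr_ae h, hf.2]⟩

theorem comp_iff {F : β → E} {T : α → β} (hT : MeasurePreserving T μ ν)
    (he : MeasurableEmbedding T) :
    HasBochnerIntegral (fun x => F (T x)) μ a ↔ HasBochnerIntegral F ν a := by
  rw [HasBochnerIntegral, HasBochnerIntegral, hT.integral_comp he]
  exact and_congr_left fun _ => hT.integrable_comp_emb he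

theorem comp {F : β → E} {T : α → β} (hF : HasBochnerIntegral F ν a)
    (hT : MeasurePreserving T μ ν) (he : MeasurableEmbedding T) :
    HasBochnerIntegral (fun x => F (T x)) μ a :=
  (comp_iff hT he).2 hF

theorem integral_abs_le_of_abs_le {f g : α → ℝ} {b : ℝ} (hg : HasBochnerIntegral g μ b)
    (hf : AEStronglyMeasurable f μ) (hfg : ∀ᵐ x ∂μ, |f x| ≤ g x) :
    Integrable f μ ∧ ∫ x, |f x| ∂μ ≤ b :=
  have hint : Integrable f μ := hg.1.mono' hf hfg
  ⟨hint, (integral_mono_ae hint.abs hg.1 hfg).trans_eq hg.2⟩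

section Translation

variable {G : Type*} [AddCommGroup G] [MeasurableSpace G] [MeasurableAdd G] {μ : Measure G}
  [μ.IsAddRightInvariant] {f : G → E}

theorem comp_sub_right (hf : HasBochnerIntegral f μ a) (u : G) :
    HasBochnerIntegral (fun k => f (k - u)) μ a :=
  hf.comp (measurePreserving_sub_right μ u) (measurableEmbedding_subRight u)

theorem comp_add_right (hf : HasBochnerIntegral f μ a) (u : G) :
    HasBochnerIntegral (fun k => f (k + u)) μ a :=
  hf.comp (measurePreserving_add_right μ u) (measurableEmbedding_addRight u)

end Translation

end HasBochnerIntegral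

end BochnerIntegral

section RadialIntegrals

theorem integrable_radial_iff (f : ℝ → ℝ) :
    Integrable (fun k : E3 => f ‖k‖) ↔ IntegrableOn (fun r : ℝ => r ^ 2 * f r) (Set.Ioi 0) := by
  rw [integrable_fun_norm_addHaar, finrank_euclideanSpace, Fintype.card_fin]
  simp only [smul_eq_mul]

theorem integral_radial (f : ℝ → ℝ) :
    ∫ k : E3, f ‖k‖ = 4 * Real.pi * ∫ r in Set.Ioi (0 : ℝ), r ^ 2 * f r := by
  rw [integral_fun_norm_addHaar, finrank_euclideanSpace, Fintype.card_fin, Measure.real,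
    EuclideanSpace.volume_ball_fin_three]
  simp only [nsmul_eq_mul, smul_eq_mul, ENNReal.toReal_mul]
  rw [ENNReal.toReal_ofReal (by positivity), ENNReal.toReal_pow, ENNReal.toReal_ofReal one_pos.le]
  push_cast
  ring_nf

theorem hasBochnerIntegral_radial_of_hasDerivAt {f g g' : ℝ → ℝ} {l : ℝ}
    (hf : ∀ r ∈ Set.Ioi (0 : ℝ), r ^ 2 * f r = g' r) (hg : ∀ r, HasDerivAt g (g' r) r)
    (hpos : ∀ r, 0 ≤ g' r) (hl : Tendsto g atTop (𝓝 l)) :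
    HasBochnerIntegral (fun k : E3 => f ‖k‖) volume (4 * Real.pi * (l - g 0)) := by
  rw [HasBochnerIntegral, integrable_radial_iff, integral_radial,
    integrableOn_congr_fun hf measurableSet_Ioi, setIntegral_congr_fun measurableSet_Ioi hf]
  exact ⟨integrableOn_Ioi_deriv_of_nonneg' (fun r _ => hg r) (fun r _ => hpos r) hl,
    by rw [integral_Ioi_of_hasDerivAt_of_nonneg' (fun r _ => hg r) (fun r _ => hpos r) hl]⟩

variable {b : ℝ}

theorem tendsto_arctan_div (hb : 0 < b) :
    Tendsto (fun r : ℝ => Real.arctan (r / b)) atTop (𝓝 (Real.pi / 2)) :=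
  (Real.tendsto_arctan_atTop.mono_right nhdsWithin_le_nhds).comp
    (tendsto_id.atTop_div_const hb)

theorem hasDerivAt_arctan_div (hb : 0 < b) (r : ℝ) :
    HasDerivAt (fun r : ℝ => Real.arctan (r / b) / b) (r ^ 2 + b ^ 2)⁻¹ r := by
  refine (((hasDerivAt_id r).div_const b).arctan.div_const b).congr_deriv ?_
  have : r ^ 2 + b ^ 2 ≠ 0 := by positivity
  simp only [id]
  field_simp
  ring

theorem tendsto_div_sq_add_sq (b : ℝ) :
    Tendsto (fun r : ℝ => r / (r ^ 2 + b ^ 2)) atTop (𝓝 0) := by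
  refine squeeze_zero' (g := fun r : ℝ => r⁻¹) ?_ ?_ tendsto_inv_atTop_zero
  · filter_upwards [eventually_gt_atTop 0] with r hr
    positivity
  · filter_upwards [eventually_gt_atTop 0] with r hr
    rw [div_le_iff₀ (by positivity), mul_add, sq, inv_mul_cancel_left₀ hr.ne']
    exact le_add_of_nonneg_right (by positivity)

theorem hasBochnerIntegral_inv_norm_sq_mul_norm_sq_add_sq (hb : 0 < b) :
    HasBochnerIntegral (fun k : E3 => (‖k‖ ^ 2 * (‖k‖ ^ 2 + b ^ 2))⁻¹) volume
      (2 * Real.pi ^ 2 / b) := by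
  have h := hasBochnerIntegral_radial_of_hasDerivAt (f := fun r => (r ^ 2 * (r ^ 2 + b ^ 2))⁻¹)
    (fun r (hr : 0 < r) => by field_simp) (hasDerivAt_arctan_div hb) (fun r => by positivity)
    ((tendsto_arctan_div hb).div_const b)
  convert h using 1
  simp only [zero_div, Real.arctan_zero]
  ring

theorem hasDerivAt_arctan_div_sub_div (hb : 0 < b) (r : ℝ) :
    HasDerivAt (fun r : ℝ => (Real.arctan (r / b) / b - r / (r ^ 2 + b ^ 2)) / 2)
      (r ^ 2 * ((r ^ 2 + b ^ 2) ^ 2)⁻¹) r := by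
  have h0 : r ^ 2 + b ^ 2 ≠ 0 := by positivity
  refine (((hasDerivAt_arctan_div hb r).sub ((hasDerivAt_id r).div
    (((hasDerivAt_id r).pow 2).add_const (b ^ 2)) h0)).div_const 2).congr_deriv ?_
  simp only [id, Pi.pow_apply]
  field_simp
  ring

theorem hasBochnerIntegral_inv_norm_sq_add_sq_sq (hb : 0 < b) :
    HasBochnerIntegral (fun k : E3 => ((‖k‖ ^ 2 + b ^ 2) ^ 2)⁻¹) volume (Real.pi ^ 2 / b) := by
  have h := hasBochnerIntegral_radial_of_hasDerivAt (f := fun r => ((r ^ 2 + b ^ 2) ^ 2)⁻¹)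
    (fun r _ => rfl) (hasDerivAt_arctan_div_sub_div hb) (fun r => by positivity)
    ((((tendsto_arctan_div hb).div_const b).sub (tendsto_div_sq_add_sq b)).div_const 2)
  convert h using 1
  simp only [zero_div, Real.arctan_zero]
  ring

end RadialIntegrals

section ShiftKernel

theorem ae_ne (u : E3) : ∀ᵐ k : E3, k ≠ u := by
  simp [ae_iff, measure_singleton]

theorem inner_sq_le {E : Type*} [NormedAddCommGroup E] [InnerProductSpace ℝ E] (x y : E) :
    inner ℝ x y ^ 2 ≤ ‖x‖ ^ 2 * ‖y‖ ^ 2 := by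
  rw [← mul_pow, ← sq_abs]
  gcongr
  exact abs_real_inner_le_norm x y

/-- `1/|k-u|² - 1/|k|²` minus an odd function of `k` which is its leading order for large `k`. -/
def shiftKernel (u k : E3) : ℝ :=
  (‖k - u‖ ^ 2)⁻¹ - (‖k‖ ^ 2)⁻¹ - 2 * inner ℝ k u / (‖k‖ ^ 2 + 1) ^ 2

theorem measurable_shiftKernel : Measurable fun p : E3 × E3 => shiftKernel p.1 p.2 := by
  unfold shiftKernel
  fun_prop

theorem abs_resolvent_remainder_le {A B s U : ℝ} (hA : 0 < A) (hB : 0 < B) (hU : 0 ≤ U)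
    (hs : s ^ 2 ≤ A * U) (hAB : A - B = 2 * s - U) :
    |B⁻¹ - A⁻¹ - 2 * s / A ^ 2| ≤ U * (4 * (A ^ 2)⁻¹ + (B ^ 2)⁻¹) := by
  have hrem : B⁻¹ - A⁻¹ - 2 * s / A ^ 2 = (A - B) ^ 2 / (A ^ 2 * B) - U * (A ^ 2)⁻¹ := by
    rw [show 2 * s = A - B + U by linarith]
    field_simp
    ring
  have hdiff : (A - B) ^ 2 ≤ 2 * U * (A + B) := by
    rw [show A + B = 2 * A - (2 * s - U) by linarith, hAB]
    nlinarith [sq_nonneg U]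
  have hquot : (A - B) ^ 2 / (A ^ 2 * B) ≤ U * (3 * (A ^ 2)⁻¹ + (B ^ 2)⁻¹) :=
    calc (A - B) ^ 2 / (A ^ 2 * B) ≤ 2 * U * (A + B) / (A ^ 2 * B) := by gcongr
      _ = U * (2 * (A⁻¹ * B⁻¹) + 2 * (A⁻¹) ^ 2) := by field_simp
      _ ≤ U * (3 * (A ^ 2)⁻¹ + (B ^ 2)⁻¹) := by
        rw [← inv_pow, ← inv_pow]
        refine mul_le_mul_of_nonneg_left ?_ hU
        linarith [two_mul_le_add_sq A⁻¹ B⁻¹]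
  have hnonneg : 0 ≤ (A - B) ^ 2 / (A ^ 2 * B) := by positivity
  have hUA : 0 ≤ U * (A ^ 2)⁻¹ := by positivity
  have : 0 ≤ U * (B ^ 2)⁻¹ := by positivity
  rw [hrem, abs_le]
  constructor <;> linarith

theorem abs_shiftKernel_le {u k : E3} (h0 : k ≠ 0) (hu : k ≠ u) :
    |shiftKernel u k| ≤ (‖k - u‖ ^ 2 * (‖k - u‖ ^ 2 + 1))⁻¹ + (‖k‖ ^ 2 * (‖k‖ ^ 2 + 1))⁻¹ +
      ‖u‖ ^ 2 * (4 * ((‖k‖ ^ 2 + 1) ^ 2)⁻¹ + ((‖k - u‖ ^ 2 + 1) ^ 2)⁻¹) := by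
  have hinv {x : E3} (hx : x ≠ 0) :
      (‖x‖ ^ 2)⁻¹ = (‖x‖ ^ 2 * (‖x‖ ^ 2 + 1))⁻¹ + (‖x‖ ^ 2 + 1)⁻¹ := by
    have := norm_pos_iff.2 hx
    field_simp
    ring
  have hrem := abs_resolvent_remainder_le (A := ‖k‖ ^ 2 + 1) (B := ‖k - u‖ ^ 2 + 1)
    (s := inner ℝ k u) (by positivity) (by positivity) (sq_nonneg ‖u‖)
    ((inner_sq_le k u).trans (by gcongr; linarith)) (by rw [norm_sub_sq_real]; ring)
  have hsplit : shiftKernel u k =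
      (‖k - u‖ ^ 2 * (‖k - u‖ ^ 2 + 1))⁻¹ - (‖k‖ ^ 2 * (‖k‖ ^ 2 + 1))⁻¹ +
        ((‖k - u‖ ^ 2 + 1)⁻¹ - (‖k‖ ^ 2 + 1)⁻¹ - 2 * inner ℝ k u / (‖k‖ ^ 2 + 1) ^ 2) := by
    rw [shiftKernel, hinv h0, hinv (sub_ne_zero.2 hu)]
    ring
  rw [hsplit]
  refine (abs_add_le _ _).trans (add_le_add ((abs_sub _ _).trans_eq ?_) hrem)
  rw [abs_of_nonneg (by positivity), abs_of_nonneg (by positivity)]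

theorem integral_abs_shiftKernel_le (u : E3) :
    Integrable (shiftKernel u) ∧ ∫ k, |shiftKernel u k| ≤ Real.pi ^ 2 * (4 + 5 * ‖u‖ ^ 2) := by
  have hsing := hasBochnerIntegral_inv_norm_sq_mul_norm_sq_add_sq one_pos
  have hsq := hasBochnerIntegral_inv_norm_sq_add_sq_sq one_pos
  simp only [one_pow, div_one] at hsing hsq
  have hmajor := ((hsing.comp_sub_right u).add hsing).add
    (((hsq.const_mul 4).add (hsq.comp_sub_right u)).const_mul (‖u‖ ^ 2))
  have hbound := hmajor.integral_abs_le_of_abs_le (f := shiftKernel u)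
    (measurable_shiftKernel.comp measurable_prodMk_left).aestronglyMeasurable
    (by filter_upwards [ae_ne 0, ae_ne u] with k h0 hu using abs_shiftKernel_le h0 hu)
  exact ⟨hbound.1, hbound.2.trans_eq (by ring)⟩

/-- The second difference of `1/|k|²` with step `u`. -/
def secondDifference (u k : E3) : ℝ := (‖k - u‖ ^ 2)⁻¹ + (‖k + u‖ ^ 2)⁻¹ - 2 * (‖k‖ ^ 2)⁻¹

theorem secondDifference_eq (u k : E3) :
    secondDifference u k = shiftKernel u k + shiftKernel (-u) k := by
  simp only [secondDifference, shiftKernel, sub_neg_eq_add, inner_neg_right]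
  ring

theorem integrable_secondDifference (u : E3) : Integrable (secondDifference u) :=
  ((integral_abs_shiftKernel_le u).1.add (integral_abs_shiftKernel_le (-u)).1).congr
    (Eventually.of_forall fun k => (secondDifference_eq u k).symm)

theorem secondDifference_two_smul (u k : E3) :
    secondDifference ((2 : ℝ) • u) k =
      secondDifference u (k + u) + 2 * secondDifference u k + secondDifference u (k - u) := by
  have h₁ : k - (2 : ℝ) • u = k - u - u := by rw [two_smul]; abel
  have h₂ : k + (2 : ℝ) • u = k + u + u := by rw [two_smul]; abel
  simp only [secondDifference, h₁, h₂, add_sub_cancel_right, sub_add_cancel]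
  ring

theorem secondDifference_two_smul_two_smul (u k : E3) :
    secondDifference ((2 : ℝ) • u) ((2 : ℝ) • k) = 4⁻¹ * secondDifference u k := by
  simp only [secondDifference, ← smul_sub, ← smul_add, norm_smul, mul_pow, mul_inv]
  norm_num
  ring

-- The integral is homogeneous of degree one in the step and quadruples when the step is doubled.
theorem hasBochnerIntegral_secondDifference (u : E3) :
    HasBochnerIntegral (secondDifference u) volume 0 := by
  have h := HasBochnerIntegral.of_integrable (integrable_secondDifference u)
  have hquadruple : ∫ k, secondDifference ((2 : ℝ) • u) k = 4 * ∫ k, secondDifference u k := by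
    simp_rw [secondDifference_two_smul]
    rw [(((h.comp_add_right u).add (h.const_mul 2)).add (h.comp_sub_right u)).2]
    ring
  have hdouble : ∫ k, secondDifference ((2 : ℝ) • u) k = 2 * ∫ k, secondDifference u k := by
    have hscale := Measure.integral_comp_smul (volume : Measure E3)
      (fun k => secondDifference ((2 : ℝ) • u) k) 2
    simp_rw [secondDifference_two_smul_two_smul] at hscale
    rw [integral_const_mul, finrank_euclideanSpace, Fintype.card_fin, smul_eq_mul,
      abs_of_pos (by norm_num)] at hscale
    linarith
  exact ⟨h.1, by linarith⟩

theorem integral_shiftKernel (u : E3) : ∫ k, shiftKernel u k = 0 := by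
  have hneg : ∫ k, shiftKernel (-u) k = ∫ k, shiftKernel u k := by
    rw [← integral_neg_eq_self]
    congr 1 with k
    simp only [shiftKernel, ← neg_sub', norm_neg, inner_neg_neg]
  have hzero := (hasBochnerIntegral_secondDifference u).2
  simp_rw [secondDifference_eq] at hzero
  rw [integral_add (integral_abs_shiftKernel_le u).1 (integral_abs_shiftKernel_le (-u)).1,
    hneg] at hzero
  linarith

end ShiftKernel

section DiagonalKernel

/-- The difference between `|k|²/(|k-q|²+b²)²` and its leading behaviour `1/|k-2q|²` for
large `k`. -/
def diagKernel (q : E3) (b : ℝ) (k : E3) : ℝ :=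
  ‖k‖ ^ 2 / (‖k - q‖ ^ 2 + b ^ 2) ^ 2 - (‖k - (2 : ℝ) • q‖ ^ 2)⁻¹

theorem measurable_diagKernel :
    Measurable fun p : E3 × ℝ × E3 => diagKernel p.1 p.2.1 p.2.2 := by
  unfold diagKernel
  fun_prop

theorem inv_add_mul_le {L Y d : ℝ} (hL : 0 ≤ L) (hY : 0 < Y) (hd : 0 < d) :
    ((L + d) * Y)⁻¹ ≤
      (Y * (Y + d))⁻¹ + 1 / 2 * (((L + d) ^ 2)⁻¹ + ((Y + d) ^ 2)⁻¹) := by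
  have hsplit : ((L + d) * Y)⁻¹ = d / (L + d) * (Y * (Y + d))⁻¹ + (L + d)⁻¹ * (Y + d)⁻¹ := by
    field_simp
    ring
  have hle : d / (L + d) * (Y * (Y + d))⁻¹ ≤ (Y * (Y + d))⁻¹ :=
    mul_le_of_le_one_left (by positivity) ((div_le_one (by positivity)).2 (by linarith))
  rw [hsplit, ← inv_pow, ← inv_pow]
  linarith [two_mul_le_add_sq (L + d)⁻¹ (Y + d)⁻¹]

-- Here `L = |k-q|²`, `Q = |q|²`, `s = ⟪k-q, q⟫`, `d = b²`.
theorem abs_diagonal_remainder_le {L Q s d c : ℝ} (hL : 0 ≤ L) (hQ : 0 ≤ Q) (hd : 0 < d)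
    (hs : s ^ 2 ≤ L * Q) (hY : 0 < L - 2 * s + Q) (hQc : Q ≤ c * d) :
    |(L + 2 * s + Q) / (L + d) ^ 2 - (L - 2 * s + Q)⁻¹| ≤
      6 * (1 + c) ^ 2 * d * ((L + d) * (L - 2 * s + Q))⁻¹ := by
  have hc : 0 ≤ c := nonneg_of_mul_nonneg_left (hQ.trans hQc) hd
  have hnum : |2 * L * (Q - d) + Q ^ 2 - d ^ 2 - 4 * s ^ 2| ≤ 6 * (1 + c) ^ 2 * d * (L + d) :=
    calc |2 * L * (Q - d) + Q ^ 2 - d ^ 2 - 4 * s ^ 2| ≤ 6 * (Q + d) * (L + Q + d) := by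
          rw [abs_le]
          constructor <;> nlinarith [mul_nonneg hL hQ, mul_nonneg hL hd.le, mul_nonneg hQ hd.le,
            sq_nonneg s, sq_nonneg Q, sq_nonneg d]
      _ ≤ 6 * ((1 + c) * d) * ((1 + c) * (L + d)) := by
          gcongr
          · linarith
          · nlinarith
      _ = 6 * (1 + c) ^ 2 * d * (L + d) := by ring
  have heq : (L + 2 * s + Q) / (L + d) ^ 2 - (L - 2 * s + Q)⁻¹ =
      (2 * L * (Q - d) + Q ^ 2 - d ^ 2 - 4 * s ^ 2) / ((L + d) ^ 2 * (L - 2 * s + Q)) := by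
    field_simp
    ring
  rw [heq, abs_div, abs_of_pos (show 0 < (L + d) ^ 2 * (L - 2 * s + Q) by positivity)]
  calc _ ≤ 6 * (1 + c) ^ 2 * d * (L + d) / ((L + d) ^ 2 * (L - 2 * s + Q)) := by gcongr
    _ = _ := by field_simp

variable {b : ℝ}

theorem abs_diagKernel_le {q : E3} {c : ℝ} (hb : 0 < b) (hq : ‖q‖ ^ 2 ≤ c * b ^ 2) {k : E3}
    (hk : k ≠ (2 : ℝ) • q) :
    |diagKernel q b k| ≤ 6 * (1 + c) ^ 2 * b ^ 2 *
      ((‖k - (2 : ℝ) • q‖ ^ 2 * (‖k - (2 : ℝ) • q‖ ^ 2 + b ^ 2))⁻¹ +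
        1 / 2 * (((‖k - q‖ ^ 2 + b ^ 2) ^ 2)⁻¹ + ((‖k - (2 : ℝ) • q‖ ^ 2 + b ^ 2) ^ 2)⁻¹)) := by
  have hY : 0 < ‖k - (2 : ℝ) • q‖ ^ 2 := pow_pos (norm_pos_iff.2 (sub_ne_zero.2 hk)) 2
  have hsub : ‖k - (2 : ℝ) • q‖ ^ 2 = ‖k - q‖ ^ 2 - 2 * inner ℝ (k - q) q + ‖q‖ ^ 2 := by
    rw [← norm_sub_sq_real, two_smul, sub_sub]
  have hadd : ‖k‖ ^ 2 = ‖k - q‖ ^ 2 + 2 * inner ℝ (k - q) q + ‖q‖ ^ 2 := by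
    rw [← norm_add_sq_real, sub_add_cancel]
  have hrem := abs_diagonal_remainder_le (sq_nonneg ‖k - q‖) (sq_nonneg ‖q‖) (pow_pos hb 2)
    (inner_sq_le (k - q) q) (hsub ▸ hY) hq
  rw [← hsub, ← hadd] at hrem
  exact hrem.trans (mul_le_mul_of_nonneg_left
    (inv_add_mul_le (sq_nonneg _) hY (pow_pos hb 2))
    (by have : 0 ≤ (1 + c) ^ 2 := sq_nonneg _; positivity))

theorem integral_abs_diagKernel_le (q : E3) {c : ℝ} (hb : 0 < b) (hq : ‖q‖ ^ 2 ≤ c * b ^ 2) :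
    Integrable (diagKernel q b) ∧
      ∫ k, |diagKernel q b k| ≤ 18 * (1 + c) ^ 2 * Real.pi ^ 2 * b := by
  have hsing := hasBochnerIntegral_inv_norm_sq_mul_norm_sq_add_sq hb
  have hsq := hasBochnerIntegral_inv_norm_sq_add_sq_sq hb
  have hmajor := ((hsing.comp_sub_right ((2 : ℝ) • q)).add
    (((hsq.comp_sub_right q).add (hsq.comp_sub_right ((2 : ℝ) • q))).const_mul (1 / 2))).const_mul
      (6 * (1 + c) ^ 2 * b ^ 2)
  have hbound := hmajor.integral_abs_le_of_abs_le (f := diagKernel q b)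
    (measurable_diagKernel.comp (f := fun k => (q, b, k)) (by fun_prop)).aestronglyMeasurable
    (by filter_upwards [ae_ne ((2 : ℝ) • q)] with k hk using abs_diagKernel_le hb hq hk)
  refine ⟨hbound.1, hbound.2.trans_eq ?_⟩
  field_simp
  ring

theorem integrable_diagKernel (q : E3) (hb : 0 < b) : Integrable (diagKernel q b) :=
  (integral_abs_diagKernel_le q (c := ‖q‖ ^ 2 / b ^ 2) hb (by field_simp; rfl)).1

theorem diagKernel_add_diagKernel_neg (q : E3) (hb : 0 < b) {k : E3} (hk : k ≠ 0) :
    diagKernel q b (k + q) + diagKernel q b (-k + q) =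
      2 * (-b ^ 2 * (‖k‖ ^ 2 * (‖k‖ ^ 2 + b ^ 2))⁻¹ +
        (‖q‖ ^ 2 - b ^ 2) * ((‖k‖ ^ 2 + b ^ 2) ^ 2)⁻¹) - secondDifference q k := by
  have := norm_pos_iff.2 hk
  have h₁ : k + q - (2 : ℝ) • q = k - q := by rw [two_smul]; abel
  have h₂ : -k + q - (2 : ℝ) • q = -(k + q) := by rw [two_smul]; abel
  have h₃ : -k + q = -(k - q) := by abel
  have hinv : (‖k‖ ^ 2)⁻¹ = (‖k‖ ^ 2 + b ^ 2)⁻¹ + b ^ 2 * (‖k‖ ^ 2 * (‖k‖ ^ 2 + b ^ 2))⁻¹ := by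
    field_simp
  simp only [diagKernel, secondDifference, h₁, h₂, add_sub_cancel_right]
  rw [h₃, norm_neg, norm_neg, norm_neg, hinv, div_eq_mul_inv, div_eq_mul_inv, norm_add_sq_real,
    norm_sub_sq_real]
  field_simp
  ring

-- The singular parts of `diagKernel q b (q + k)` and `diagKernel q b (q - k)` add up to a second
-- difference, whose integral vanishes.
theorem hasBochnerIntegral_diagKernel (q : E3) (hb : 0 < b) :
    HasBochnerIntegral (diagKernel q b) volume
      (-3 * Real.pi ^ 2 * b + Real.pi ^ 2 * ‖q‖ ^ 2 / b) := by
  have hint := integrable_diagKernel q hb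
  have hshift : Integrable fun k => diagKernel q b (k + q) := hint.comp_add_right q
  have hsymm : ∫ k, (diagKernel q b (k + q) + diagKernel q b (-k + q)) =
      2 * ∫ k, diagKernel q b k := by
    rw [integral_add hshift hshift.comp_neg,
      integral_neg_eq_self (fun k => diagKernel q b (k + q)), integral_add_right_eq_self, two_mul]
  have hvalue := (((hasBochnerIntegral_inv_norm_sq_mul_norm_sq_add_sq hb).const_mul (-b ^ 2)).add
    ((hasBochnerIntegral_inv_norm_sq_add_sq_sq hb).const_mul (‖q‖ ^ 2 - b ^ 2))).const_mul 2
  have hsum := (hvalue.sub (hasBochnerIntegral_secondDifference q)).congr <|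
    (ae_ne 0).mono fun k hk => (diagKernel_add_diagKernel_neg q hb hk).symm
  refine ⟨hint, ?_⟩
  have := hsymm.symm.trans hsum.2
  have hsimp : 2 * (-b ^ 2 * (2 * Real.pi ^ 2 / b) + (‖q‖ ^ 2 - b ^ 2) * (Real.pi ^ 2 / b)) =
      2 * (-3 * Real.pi ^ 2 * b + Real.pi ^ 2 * ‖q‖ ^ 2 / b) := by
    field_simp
    ring
  linarith

end DiagonalKernel

section Pairing

variable {M : ℕ}

/-- The momenta `(k₀ + kᵢ, k₁, …, kᵢ₋₁, kᵢ₊₁, …)` after merging the distinguished particle with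
particle `i`. -/
def pairMap (i : Fin (M + 1)) (k : Conf (M + 1)) : Conf M :=
  pt (k 0 + rest k i) (i.removeNth (rest k))

@[simp] theorem pairMap_zero (i : Fin (M + 1)) (k : Conf (M + 1)) :
    pairMap i k 0 = k 0 + rest k i := rfl

@[simp] theorem rest_pairMap (i : Fin (M + 1)) (k : Conf (M + 1)) (j : Fin M) :
    rest (pairMap i k) j = rest k (i.succAbove j) := rfl

theorem continuous_pairMap (i : Fin (M + 1)) : Continuous (pairMap (M := M) i) := by
  have hsum : Continuous fun k : Conf (M + 1) => k 0 + rest k i := by unfold rest; fun_prop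
  have hremove : Continuous fun k : Conf (M + 1) => i.removeNth (rest k) :=
    continuous_pi fun j => (continuous_apply (i.succAbove j)).comp continuous_rest
  exact continuous_pt.comp (hsum.prodMk hremove)

theorem measurePreserving_pairMap_pt (i : Fin (M + 1)) (x : E3) :
    MeasurePreserving fun q : Fin (M + 1) → E3 => pairMap i (pt x q) :=
  measurePreserving_pt.comp <|
    ((measurePreserving_add_left volume x).prod (MeasurePreserving.id volume)).comp
      (volume_preserving_piFinSuccAbove (fun _ : Fin (M + 1) => E3) i)

theorem injective_pairMap_pt (i : Fin (M + 1)) (x : E3) :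
    Function.Injective fun q : Fin (M + 1) → E3 => pairMap i (pt x q) := by
  refine Function.LeftInverse.injective
    (g := fun w => i.insertNth (α := fun _ => E3) (w 0 - x) (rest w)) fun q => ?_
  simp [pairMap]

theorem measurableEmbedding_pairMap_pt (i : Fin (M + 1)) (x : E3) :
    MeasurableEmbedding fun q : Fin (M + 1) → E3 => pairMap i (pt x q) :=
  (measurePreserving_pairMap_pt i x).measurable.measurableEmbedding (injective_pairMap_pt i x)

/-- The change of variables to the momentum of the distinguished particle and the momenta after
merging it with particle `i`. -/
def splitMap (i : Fin (M + 1)) (k : Conf (M + 1)) : E3 × Conf M := (k 0, pairMap i k)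

theorem measurePreserving_splitMap (i : Fin (M + 1)) :
    MeasurePreserving (splitMap (M := M) i) volume (volume.prod volume) := by
  have hskew : MeasurePreserving
      (fun p : E3 × (Fin (M + 1) → E3) => (p.1, pairMap i (pt p.1 p.2)))
      (volume.prod volume) (volume.prod volume) :=
    (MeasurePreserving.id volume).skew_product
      (g := fun x q => pairMap i (pt x q))
      ((continuous_pairMap i).measurable.comp measurePreserving_pt.measurable)
      (Eventually.of_forall fun x => (measurePreserving_pairMap_pt i x).map_eq)
  have hpt : MeasurePreserving (ptEquiv (M + 1)) := coe_ptEquiv (M := M + 1) ▸ measurePreserving_pt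
  have heq : splitMap i = (fun p : E3 × (Fin (M + 1) → E3) => (p.1, pairMap i (pt p.1 p.2))) ∘
      (ptEquiv (M + 1)).symm := by
    funext k
    obtain ⟨p, rfl⟩ := (ptEquiv (M + 1)).surjective k
    rw [Function.comp_apply, MeasurableEquiv.symm_apply_apply, ptEquiv_apply]
    rfl
  exact heq ▸ hskew.comp hpt.symm

theorem injective_splitMap (i : Fin (M + 1)) : Function.Injective (splitMap (M := M) i) := by
  refine Function.LeftInverse.injective
    (g := fun p => pt p.1 (i.insertNth (α := fun _ => E3) (p.2 0 - p.1) (rest p.2))) fun k => ?_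
  simp [splitMap, pairMap]

theorem measurableEmbedding_splitMap (i : Fin (M + 1)) :
    MeasurableEmbedding (splitMap (M := M) i) :=
  (measurePreserving_splitMap i).measurable.measurableEmbedding (injective_splitMap i)

theorem quasiMeasurePreserving_pairMap (i : Fin (M + 1)) :
    Measure.QuasiMeasurePreserving (pairMap (M := M) i) :=
  Measure.quasiMeasurePreserving_snd.comp (measurePreserving_splitMap i).quasiMeasurePreserving

theorem pairMap_permConf_extendPerm (σ : Equiv.Perm (Fin M)) (k : Conf (M + 1)) :
    pairMap 0 (permConf (extendPerm σ) k) = permConf σ (pairMap 0 k) := by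
  rw [permConf_apply σ, pairMap]
  simp only [permConf_zero, rest_permConf, extendPerm_zero, pairMap_zero]
  congr 1

theorem pairMap_eq_permConf (i : Fin (M + 1)) (k : Conf (M + 1)) :
    pairMap i k = pairMap 0 (permConf i.cycleRange.symm k) := by
  simp only [pairMap, permConf_zero, rest_permConf, Fin.cycleRange_symm_zero]
  congr 1
  funext j
  simp [Fin.removeNth]

theorem pairMap_permConf (τ : Equiv.Perm (Fin (M + 1))) (i : Fin (M + 1)) :
    ∃ σ : Equiv.Perm (Fin M),
      Equiv.Perm.sign σ * (-1) ^ (i : ℕ) = Equiv.Perm.sign τ * (-1) ^ (τ i : ℕ) ∧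
      ∀ k, pairMap i (permConf τ k) = permConf σ (pairMap (τ i) k) := by
  obtain ⟨σ, hσ⟩ : ∃ σ, extendPerm σ = (τ i).cycleRange.symm⁻¹ * (τ * i.cycleRange.symm) :=
    exists_extendPerm_eq (by simp [Equiv.Perm.inv_def])
  have hτ : τ * i.cycleRange.symm = (τ i).cycleRange.symm * extendPerm σ := by
    rw [hσ, mul_inv_cancel_left]
  refine ⟨σ, ?_, fun k => ?_⟩
  · have hsign := congrArg Equiv.Perm.sign hτ
    simp only [Equiv.Perm.sign_mul, sign_extendPerm, Equiv.Perm.sign_symm, Fin.sign_cycleRange]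
      at hsign
    calc Equiv.Perm.sign σ * (-1) ^ (i : ℕ)
        = (-1) ^ (τ i : ℕ) * ((-1) ^ (τ i : ℕ) * Equiv.Perm.sign σ) * (-1) ^ (i : ℕ) := by
          rw [← mul_assoc, Int.units_mul_self, one_mul]
      _ = Equiv.Perm.sign τ * (-1) ^ (τ i : ℕ) := by
          rw [← hsign, mul_assoc, mul_assoc, Int.units_mul_self, mul_one, mul_comm]
  · rw [pairMap_eq_permConf, permConf_permConf, hτ, ← permConf_permConf,
      pairMap_permConf_extendPerm, ← pairMap_eq_permConf]

end Pairing

section ChargeSum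

variable {M : ℕ} {X : Conf M → ℂ}

/-- The `i`-th summand `±X(k₀ + kᵢ, k₁, …, kᵢ₋₁, kᵢ₊₁, …)` of `chargeSum`. -/
def chargeTerm (X : Conf M → ℂ) (i : Fin (M + 1)) (k : Conf (M + 1)) : ℂ :=
  (-1) ^ (i : ℕ) * X (pairMap i k)

/-- The antisymmetrized function that is multiplied with `greenSymbol` in `greenHat`. -/
def chargeSum (X : Conf M → ℂ) (k : Conf (M + 1)) : ℂ := ∑ i, chargeTerm X i k

theorem norm_chargeTerm (X : Conf M → ℂ) (i : Fin (M + 1)) (k : Conf (M + 1)) :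
    ‖chargeTerm X i k‖ = ‖X (pairMap i k)‖ := by
  simp [chargeTerm]

theorem measurable_chargeTerm (hX : Measurable X) (i : Fin (M + 1)) :
    Measurable (chargeTerm X i) :=
  (hX.comp (continuous_pairMap i).measurable).const_mul _

theorem AEAntisymm.chargeTerm_permConf (hX : AEAntisymm X) (τ : Equiv.Perm (Fin (M + 1)))
    (i : Fin (M + 1)) :
    ∀ᵐ k, chargeTerm X i (permConf τ k) =
      ((Equiv.Perm.sign τ : ℤ) : ℂ) * chargeTerm X (τ i) k := by
  obtain ⟨σ, hsign, hσ⟩ := pairMap_permConf τ i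
  have hsign' : ((Equiv.Perm.sign σ : ℤ) : ℂ) * (-1) ^ (i : ℕ) =
      ((Equiv.Perm.sign τ : ℤ) : ℂ) * (-1) ^ (τ i : ℕ) := by
    simpa using congrArg (fun u : ℤˣ => ((u : ℤ) : ℂ)) hsign
  filter_upwards [(quasiMeasurePreserving_pairMap (τ i)).ae (hX σ)] with k hk
  rw [chargeTerm, chargeTerm, hσ, hk, ← mul_assoc, ← mul_assoc, ← hsign', mul_comm ((-1) ^ _)]

theorem AEAntisymm.chargeSum (hX : AEAntisymm X) : AEAntisymm (chargeSum X) := by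
  intro τ
  filter_upwards [ae_all_iff.2 fun i => hX.chargeTerm_permConf τ i] with k hk
  simp only [PointInteraction.chargeSum, hk, ← Finset.mul_sum]
  rw [Equiv.sum_comp τ fun i => chargeTerm X i k]

end ChargeSum

section ProductIntegrals

variable {α β E : Type*} [MeasurableSpace α] [MeasurableSpace β] [NormedAddCommGroup E]
  [NormedSpace ℝ E] {μ : Measure α} {ν : Measure β} [SFinite μ] [SFinite ν] {f : α × β → E} {a : E}

theorem HasBochnerIntegral.of_integral_norm_le {W : β → ℝ}
    (hf : AEStronglyMeasurable f (μ.prod ν)) (hint : ∀ y, Integrable (fun x => f (x, y)) μ)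
    (hW : Integrable W ν) (hle : ∀ y, ∫ x, ‖f (x, y)‖ ∂μ ≤ W y) :
    HasBochnerIntegral f (μ.prod ν) (∫ y, ∫ x, f (x, y) ∂μ ∂ν) := by
  have hi : Integrable f (μ.prod ν) := by
    refine (integrable_prod_iff' hf).2 ⟨Eventually.of_forall hint,
      hW.mono' hf.norm.prod_swap.integral_prod_right' (Eventually.of_forall fun y => ?_)⟩
    rw [Real.norm_of_nonneg (integral_nonneg fun x => norm_nonneg _)]
    exact hle y
  exact ⟨hi, integral_prod_symm _ hi⟩

theorem HasBochnerIntegral.marginal (h : HasBochnerIntegral f (μ.prod ν) a) :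
    HasBochnerIntegral (fun x => ∫ y, f (x, y) ∂ν) μ a :=
  ⟨h.1.integral_prod_left, by rw [← integral_prod _ h.1, h.2]⟩

end ProductIntegrals

section WeightedKernels

variable {M : ℕ} {X : Conf M → ℂ}

theorem norm_zero_sq_le (w : Conf M) : ‖w 0‖ ^ 2 ≤ ‖w‖ ^ 2 := by
  rw [norm_sq_conf w]
  exact le_add_of_nonneg_right (by positivity)

theorem norm_rest_sq_le (w : Conf M) (j : Fin M) : ‖rest w j‖ ^ 2 ≤ ‖w‖ ^ 2 := by
  rw [norm_sq_conf w]
  exact (Finset.single_le_sum (f := fun i => ‖rest w i‖ ^ 2) (fun i _ => sq_nonneg _)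
    (Finset.mem_univ j)).trans (le_add_of_nonneg_left (sq_nonneg _))

theorem MemFourierSobolev.integrable_norm_sq {s : ℝ} (hs : 0 ≤ s) (hX : MemFourierSobolev s X) :
    Integrable fun w => ‖X w‖ ^ 2 := by
  refine hX.integrable.mono' (hX.measurable.norm.pow_const 2).aestronglyMeasurable
    (Eventually.of_forall fun w => ?_)
  rw [Real.norm_of_nonneg (sq_nonneg _)]
  exact le_mul_of_one_le_left (sq_nonneg _)
    (Real.one_le_rpow (le_add_of_nonneg_right (sq_nonneg _)) hs)

theorem MemFourierSobolev.integrable_one_add_norm_sq_mul (hX : MemFourierSobolev 1 X) :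
    Integrable fun w => (1 + ‖w‖ ^ 2) * ‖X w‖ ^ 2 := by
  simpa only [Real.rpow_one] using hX.integrable

theorem MemFourierSobolev.integrable_first_moment (hX : MemFourierSobolev 1 X) :
    Integrable fun w : Conf M => ‖X w‖ ^ 2 • w 0 := by
  have hcoord : Measurable fun w : Conf M => w 0 := by fun_prop
  refine hX.integrable_one_add_norm_sq_mul.mono'
    ((hX.measurable.norm.pow_const 2).smul hcoord).aestronglyMeasurable
    (Eventually.of_forall fun w => ?_)
  rw [norm_smul, Real.norm_of_nonneg (sq_nonneg _), mul_comm]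
  refine mul_le_mul_of_nonneg_right ?_ (sq_nonneg _)
  nlinarith [norm_zero_sq_le w, sq_nonneg (‖w 0‖ - 1)]

theorem hasBochnerIntegral_norm_sq_mul_kernel (hX : MemFourierSobolev 1 X) {K : E3 → Conf M → ℝ}
    (hK : Measurable (Function.uncurry K)) {C : ℝ} (hint : ∀ w, Integrable fun x => K x w)
    (hle : ∀ w, ∫ x, |K x w| ≤ C * (1 + ‖w‖ ^ 2)) :
    HasBochnerIntegral (fun p : E3 × Conf M => ‖X p.2‖ ^ 2 * K p.1 p.2) (volume.prod volume)
      (∫ w, ‖X w‖ ^ 2 * ∫ x, K x w) := by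
  have hm : Measurable fun p : E3 × Conf M => ‖X p.2‖ ^ 2 * K p.1 p.2 :=
    ((hX.measurable.comp measurable_snd).norm.pow_const 2).mul hK
  simp only [← integral_const_mul]
  refine HasBochnerIntegral.of_integral_norm_le hm.aestronglyMeasurable
    (fun w => (hint w).const_mul (‖X w‖ ^ 2)) (hX.integrable_one_add_norm_sq_mul.const_mul C)
    fun w => ?_
  simp only [norm_mul, norm_pow, norm_norm]
  rw [integral_const_mul]
  calc ‖X w‖ ^ 2 * ∫ x, |K x w| ≤ ‖X w‖ ^ 2 * (C * (1 + ‖w‖ ^ 2)) :=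
        mul_le_mul_of_nonneg_left (hle w) (sq_nonneg _)
    _ = C * ((1 + ‖w‖ ^ 2) * ‖X w‖ ^ 2) := by ring

theorem hasBochnerIntegral_norm_sq_chargeTerm_mul_kernel (hX : MemFourierSobolev 1 X)
    {K : E3 → Conf M → ℝ} (hK : Measurable (Function.uncurry K)) {C : ℝ}
    (hint : ∀ w, Integrable fun x => K x w) (hle : ∀ w, ∫ x, |K x w| ≤ C * (1 + ‖w‖ ^ 2))
    (i : Fin (M + 1)) :
    HasBochnerIntegral (fun k => ‖chargeTerm X i k‖ ^ 2 * K (k 0) (pairMap i k)) volume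
      (∫ w, ‖X w‖ ^ 2 * ∫ x, K x w) := by
  have h := HasBochnerIntegral.comp (T := splitMap i)
    (hasBochnerIntegral_norm_sq_mul_kernel hX hK hint hle)
    (measurePreserving_splitMap i) (measurableEmbedding_splitMap i)
  exact h.congr (Eventually.of_forall fun k => by simp only [norm_chargeTerm, splitMap])

end WeightedKernels

section PairResolvent

variable {M : ℕ}

/-- The factor `(m+1)/(2m)` in front of the square of the relative momentum of a pair: half the
inverse reduced mass. -/
def pairFactor (m : ℝ) : ℝ := (m + 1) / (2 * m)

/-- The inverse of `greenSymbol` in terms of the momentum `x` of the distinguished particle and the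
momenta `w` after merging it with another particle. -/
def pairDenom (m μ : ℝ) (x : E3) (w : Conf M) : ℝ :=
  1 / (2 * m) * ‖x‖ ^ 2 + 1 / 2 * ‖w 0 - x‖ ^ 2 + 1 / 2 * ∑ i, ‖rest w i‖ ^ 2 + μ

/-- The part of `pairDenom` that does not depend on the relative momentum of the pair. -/
def pairRest (m μ : ℝ) (w : Conf M) : ℝ :=
  ‖w 0‖ ^ 2 / (2 * (m + 1)) + 1 / 2 * ∑ i, ‖rest w i‖ ^ 2 + μ

/-- The length `b` for which `pairDenom` is proportional to `|p|² + b²`, with `p` the relative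
momentum of the pair. -/
def pairWidth (m μ : ℝ) (w : Conf M) : ℝ := √(pairRest m μ w / pairFactor m)

variable {m μ : ℝ}

theorem pairFactor_pos (hm : 0 < m) : 0 < pairFactor m := by
  unfold pairFactor
  positivity

theorem continuous_pairWidth : Continuous (pairWidth (M := M) m μ) := by
  unfold pairWidth pairRest rest
  fun_prop

theorem continuous_pairDenom :
    Continuous fun p : E3 × Conf M => pairDenom m μ p.1 p.2 := by
  unfold pairDenom rest
  fun_prop

theorem pairRest_zero_le (hm : 0 < m) (w : Conf M) :
    pairRest m μ (0 : Conf M) ≤ pairRest m μ w := by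
  have hkin : 0 ≤ ‖w 0‖ ^ 2 / (2 * (m + 1)) + 1 / 2 * ∑ i, ‖rest w i‖ ^ 2 := by positivity
  simpa [pairRest, rest] using hkin

theorem pairRest_pos (hm : 0 < m) (hμ : 0 < μ) (w : Conf M) : 0 < pairRest m μ w := by
  unfold pairRest
  positivity

theorem pairRest_le (hm : 0 < m) (hμ : 0 < μ) (w : Conf M) :
    pairRest m μ w ≤ (1 + μ) * (1 + ‖w‖ ^ 2) := by
  have hrest : 0 ≤ ∑ i, ‖rest w i‖ ^ 2 := by positivity
  have hzero : ‖w 0‖ ^ 2 / (2 * (m + 1)) ≤ ‖w 0‖ ^ 2 := div_le_self (sq_nonneg _) (by linarith)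
  rw [norm_sq_conf, pairRest]
  generalize ‖w 0‖ ^ 2 / (2 * (m + 1)) = u at *
  generalize (∑ i, ‖rest w i‖ ^ 2) = v at *
  nlinarith [sq_nonneg ‖w 0‖]

theorem pairWidth_pos (hm : 0 < m) (hμ : 0 < μ) (w : Conf M) : 0 < pairWidth m μ w :=
  Real.sqrt_pos.2 (div_pos (pairRest_pos hm hμ w) (pairFactor_pos hm))

theorem pairWidth_zero_le (hm : 0 < m) (w : Conf M) :
    pairWidth m μ (0 : Conf M) ≤ pairWidth m μ w :=
  Real.sqrt_le_sqrt (div_le_div_of_nonneg_right (pairRest_zero_le hm w) (pairFactor_pos hm).le)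

theorem pairWidth_sq (hm : 0 < m) (hμ : 0 < μ) (w : Conf M) :
    pairWidth m μ w ^ 2 = pairRest m μ w / pairFactor m :=
  Real.sq_sqrt (div_pos (pairRest_pos hm hμ w) (pairFactor_pos hm)).le

theorem pairFactor_mul_pairWidth_sq (hm : 0 < m) (hμ : 0 < μ) (w : Conf M) :
    pairFactor m * pairWidth m μ w ^ 2 = pairRest m μ w := by
  rw [pairWidth_sq hm hμ, mul_div_cancel₀ _ (pairFactor_pos hm).ne']

theorem exists_pairWidth_le (hm : 0 < m) (hμ : 0 < μ) :
    ∃ C : ℝ, ∀ w : Conf M, pairWidth m μ w ≤ C * (1 + ‖w‖ ^ 2) := by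
  refine ⟨1 + (1 + μ) / pairFactor m, fun w => ?_⟩
  have hsq : pairWidth m μ w ^ 2 ≤ (1 + μ) / pairFactor m * (1 + ‖w‖ ^ 2) := by
    rw [pairWidth_sq hm hμ, div_mul_eq_mul_div]
    exact div_le_div_of_nonneg_right (pairRest_le hm hμ w) (pairFactor_pos hm).le
  nlinarith [sq_nonneg (pairWidth m μ w - 1), sq_nonneg ‖w‖]

theorem norm_zero_sq_le_pairWidth_sq (hm : 0 < m) (hμ : 0 < μ) (w : Conf M) :
    ‖w 0‖ ^ 2 ≤ (m + 1) ^ 2 / m * pairWidth m μ w ^ 2 := by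
  have hrest : 0 ≤ 1 / 2 * ∑ i, ‖rest w i‖ ^ 2 := by positivity
  calc ‖w 0‖ ^ 2 = (m + 1) ^ 2 / m * (‖w 0‖ ^ 2 / (2 * (m + 1)) / pairFactor m) := by
        rw [pairFactor]
        field_simp
    _ ≤ (m + 1) ^ 2 / m * (pairRest m μ w / pairFactor m) := by
        have := pairFactor_pos hm
        gcongr
        rw [pairRest]
        linarith
    _ = (m + 1) ^ 2 / m * pairWidth m μ w ^ 2 := by rw [pairWidth_sq hm hμ]

theorem pairDenom_pos (hm : 0 < m) (hμ : 0 < μ) (x : E3) (w : Conf M) : 0 < pairDenom m μ x w := by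
  unfold pairDenom
  positivity

theorem pairDenom_eq (hm : 0 < m) (hμ : 0 < μ) (x : E3) (w : Conf M) :
    pairDenom m μ x w =
      pairFactor m * (‖x - (m / (m + 1)) • w 0‖ ^ 2 + pairWidth m μ w ^ 2) := by
  rw [mul_add, pairFactor_mul_pairWidth_sq hm hμ, pairDenom, pairRest, norm_sub_sq_real,
    norm_sub_sq_real, inner_smul_right, norm_smul, real_inner_comm,
    Real.norm_of_nonneg (by positivity), pairFactor]
  field_simp
  ring

theorem pairDenom_sub_eq (hm : 0 < m) (hμ : 0 < μ) (y : E3) (w : Conf M) :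
    pairDenom m μ (w 0 - y) w =
      pairFactor m * (‖y - (1 / (m + 1)) • w 0‖ ^ 2 + pairWidth m μ w ^ 2) := by
  have hfrac : m / (m + 1) = 1 - 1 / (m + 1) := by
    field_simp
    ring
  have hneg : w 0 - y - (m / (m + 1)) • w 0 = -(y - (1 / (m + 1)) • w 0) := by
    rw [hfrac]
    module
  rw [pairDenom_eq hm hμ, hneg, norm_neg]

theorem hasBochnerIntegral_inv_pairDenom_sq (hm : 0 < m) (hμ : 0 < μ) (w : Conf M) :
    HasBochnerIntegral (fun x => (pairDenom m μ x w ^ 2)⁻¹) volume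
      ((pairFactor m ^ 2)⁻¹ * (Real.pi ^ 2 / pairWidth m μ w)) := by
  have h := ((hasBochnerIntegral_inv_norm_sq_add_sq_sq (pairWidth_pos hm hμ w)).comp_sub_right
    ((m / (m + 1)) • w 0)).const_mul (pairFactor m ^ 2)⁻¹
  simpa only [pairDenom_eq hm hμ, mul_pow, mul_inv] using h

theorem kinetic_nonneg (hm : 0 < m) (k : Conf M) : 0 ≤ kinetic m k := by
  unfold kinetic
  positivity

theorem continuous_kinetic : Continuous (kinetic (M := M) m) := by
  unfold kinetic rest
  fun_prop

theorem greenSymbol_eq_kinetic (k : Conf M) : greenSymbol m μ k = (kinetic m k + μ)⁻¹ := rfl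

theorem greenSymbol_pos (hm : 0 < m) (hμ : 0 < μ) (k : Conf M) : 0 < greenSymbol m μ k :=
  inv_pos.2 (add_pos_of_nonneg_of_pos (kinetic_nonneg hm k) hμ)

theorem measurable_greenSymbol : Measurable (greenSymbol (M := M) m μ) :=
  (continuous_kinetic.add_const μ).measurable.inv

theorem greenSymbol_eq_inv_pairDenom (i : Fin (M + 1)) (k : Conf (M + 1)) :
    greenSymbol m μ k = (pairDenom m μ (k 0) (pairMap i k))⁻¹ := by
  rw [greenSymbol, pairDenom, Fin.sum_univ_succAbove _ i]
  simp only [pairMap_zero, rest_pairMap, add_sub_cancel_left]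
  ring

theorem hasBochnerIntegral_greenSymbol_sq_mul_norm_sq_chargeTerm (hm : 0 < m) (hμ : 0 < μ)
    {X : Conf M → ℂ} (hX : MemFourierSobolev 1 X) {V : Conf M → ℝ} (hV : Measurable V) {C : ℝ}
    (hC : ∀ w, |V w| ≤ C * (1 + ‖w‖ ^ 2)) (i : Fin (M + 1)) :
    HasBochnerIntegral
      (fun k => V (pairMap i k) * greenSymbol m μ k ^ 2 * ‖chargeTerm X i k‖ ^ 2) volume
      (∫ w, ‖X w‖ ^ 2 * (V w * ((pairFactor m ^ 2)⁻¹ * (Real.pi ^ 2 / pairWidth m μ w)))) := by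
  have hD := hasBochnerIntegral_inv_pairDenom_sq (M := M) hm hμ
  have hK : Measurable (Function.uncurry fun (x : E3) (w : Conf M) =>
      V w * (pairDenom m μ x w ^ 2)⁻¹) :=
    (hV.comp measurable_snd).mul (continuous_pairDenom.measurable.pow_const 2).inv
  have hle (w : Conf M) : ∫ x, |V w * (pairDenom m μ x w ^ 2)⁻¹| ≤
      (pairFactor m ^ 2)⁻¹ * (Real.pi ^ 2 / pairWidth m μ (0 : Conf M)) * C * (1 + ‖w‖ ^ 2) := by
    have hwidth := pairWidth_zero_le (μ := μ) hm w
    have hpos := pairWidth_pos hm hμ (0 : Conf M)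
    have hbound := (abs_nonneg _).trans (hC w)
    have hw := pairWidth_pos hm hμ w
    calc ∫ x, |V w * (pairDenom m μ x w ^ 2)⁻¹|
        = |V w| * ((pairFactor m ^ 2)⁻¹ * (Real.pi ^ 2 / pairWidth m μ w)) := by
          simp only [abs_mul, abs_inv, abs_pow, sq_abs, integral_const_mul, (hD w).2]
      _ ≤ C * (1 + ‖w‖ ^ 2) *
            ((pairFactor m ^ 2)⁻¹ * (Real.pi ^ 2 / pairWidth m μ (0 : Conf M))) := by
          gcongr
          exact hC w
      _ = _ := by ring
  have h := hasBochnerIntegral_norm_sq_chargeTerm_mul_kernel hX hK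
    (fun w => (hD w).1.const_mul _) hle i
  simp only [integral_const_mul, (hD _).2] at h
  refine h.congr (Eventually.of_forall fun k => ?_)
  simp only
  rw [greenSymbol_eq_inv_pairDenom i, inv_pow]
  ring

end PairResolvent

section TailKernel

/-- The kernel `|x|²/(|x-q|²+b²)² - 1/|x-p|²`, made integrable by subtracting its odd leading order,
which is linear in `2q - p`. -/
def tailKernel (q : E3) (b : ℝ) (p x : E3) : ℝ :=
  diagKernel q b x + shiftKernel ((2 : ℝ) • q) x - shiftKernel p x

theorem tailKernel_eq (q : E3) (b : ℝ) (p x : E3) :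
    tailKernel q b p x = ‖x‖ ^ 2 / (‖x - q‖ ^ 2 + b ^ 2) ^ 2 - (‖x - p‖ ^ 2)⁻¹ -
      2 * inner ℝ x ((2 : ℝ) • q - p) / (‖x‖ ^ 2 + 1) ^ 2 := by
  simp only [tailKernel, diagKernel, shiftKernel, inner_sub_right]
  ring

theorem hasBochnerIntegral_tailKernel (q : E3) {b : ℝ} (hb : 0 < b) (p : E3) :
    HasBochnerIntegral (tailKernel q b p) volume
      (-3 * Real.pi ^ 2 * b + Real.pi ^ 2 * ‖q‖ ^ 2 / b) := by
  have hshift (u : E3) : HasBochnerIntegral (shiftKernel u) volume 0 :=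
    ⟨(integral_abs_shiftKernel_le u).1, integral_shiftKernel u⟩
  have h := ((hasBochnerIntegral_diagKernel q hb).add (hshift ((2 : ℝ) • q))).sub (hshift p)
  rw [add_zero, sub_zero] at h
  exact h

theorem integral_abs_tailKernel_le {q : E3} {b c : ℝ} (hb : 0 < b) (hq : ‖q‖ ^ 2 ≤ c * b ^ 2)
    (p : E3) :
    ∫ x, |tailKernel q b p x| ≤ 18 * (1 + c) ^ 2 * Real.pi ^ 2 * b +
      Real.pi ^ 2 * (4 + 5 * ‖(2 : ℝ) • q‖ ^ 2) + Real.pi ^ 2 * (4 + 5 * ‖p‖ ^ 2) := by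
  obtain ⟨hdiag, hdiag_le⟩ := integral_abs_diagKernel_le q hb hq
  obtain ⟨hq', hq_le⟩ := integral_abs_shiftKernel_le ((2 : ℝ) • q)
  obtain ⟨hp, hp_le⟩ := integral_abs_shiftKernel_le p
  have hsum := ((HasBochnerIntegral.of_integrable hdiag.abs).add
    (HasBochnerIntegral.of_integrable hq'.abs)).add (HasBochnerIntegral.of_integrable hp.abs)
  calc ∫ x, |tailKernel q b p x|
      ≤ ∫ x, (|diagKernel q b x| + |shiftKernel ((2 : ℝ) • q) x| + |shiftKernel p x|) :=
        integral_mono (hasBochnerIntegral_tailKernel q hb p).1.abs hsum.1 fun x =>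
          (abs_sub _ _).trans (add_le_add_left (abs_add_le _ _) _)
    _ = _ := hsum.2
    _ ≤ _ := add_le_add (add_le_add hdiag_le hq_le) hp_le

variable {M : ℕ} {m μ : ℝ}

theorem measurable_tailKernel (c : ℝ) (p : E3) :
    Measurable (Function.uncurry fun (x : E3) (w : Conf M) =>
      tailKernel (c • w 0) (pairWidth m μ w) p x) := by
  have := (continuous_pairWidth (M := M) (m := m) (μ := μ)).measurable
  unfold tailKernel diagKernel shiftKernel Function.uncurry
  fun_prop

theorem norm_smul_zero_sq_le (hm : 0 < m) (hμ : 0 < μ) (c : ℝ) (w : Conf M) :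
    ‖c • w 0‖ ^ 2 ≤ c ^ 2 * ((m + 1) ^ 2 / m) * pairWidth m μ w ^ 2 := by
  rw [norm_smul, mul_pow, Real.norm_eq_abs, sq_abs, mul_assoc]
  exact mul_le_mul_of_nonneg_left (norm_zero_sq_le_pairWidth_sq hm hμ w) (sq_nonneg c)

theorem exists_integral_abs_tailKernel_le (hm : 0 < m) (hμ : 0 < μ) (c : ℝ) (p : E3) :
    ∃ C : ℝ, ∀ w : Conf M,
      ∫ x, |tailKernel (c • w 0) (pairWidth m μ w) p x| ≤ C * (1 + ‖w‖ ^ 2) := by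
  obtain ⟨C, hC⟩ := exists_pairWidth_le (M := M) hm hμ
  let D := 18 * (1 + c ^ 2 * ((m + 1) ^ 2 / m)) ^ 2 * Real.pi ^ 2
  have hD : 0 ≤ D := by positivity
  refine ⟨D * C + Real.pi ^ 2 * (4 + 20 * c ^ 2) + Real.pi ^ 2 * (4 + 5 * ‖p‖ ^ 2), fun w => ?_⟩
  have hnorm : ‖(2 : ℝ) • c • w 0‖ ^ 2 ≤ 4 * c ^ 2 * ‖w‖ ^ 2 := by
    rw [smul_smul, norm_smul, mul_pow, Real.norm_eq_abs, sq_abs, mul_pow]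
    norm_num
    exact mul_le_mul_of_nonneg_left (norm_zero_sq_le w) (by positivity)
  calc ∫ x, |tailKernel (c • w 0) (pairWidth m μ w) p x|
      ≤ D * pairWidth m μ w + Real.pi ^ 2 * (4 + 5 * ‖(2 : ℝ) • c • w 0‖ ^ 2) +
          Real.pi ^ 2 * (4 + 5 * ‖p‖ ^ 2) :=
        integral_abs_tailKernel_le (pairWidth_pos hm hμ w) (norm_smul_zero_sq_le hm hμ c w) p
    _ ≤ D * (C * (1 + ‖w‖ ^ 2)) + Real.pi ^ 2 * ((4 + 20 * c ^ 2) * (1 + ‖w‖ ^ 2)) +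
          Real.pi ^ 2 * (4 + 5 * ‖p‖ ^ 2) * (1 + ‖w‖ ^ 2) := by
        refine add_le_add (add_le_add ?_ ?_)
          (le_mul_of_one_le_right (by positivity) (le_add_of_nonneg_right (sq_nonneg _)))
        · exact mul_le_mul_of_nonneg_left (hC w) hD
        · exact mul_le_mul_of_nonneg_left
            (by nlinarith [sq_nonneg c, sq_nonneg ‖w‖]) (sq_nonneg Real.pi)
    _ = _ := by ring

/-- The integral of `tailKernel (c • w 0) (pairWidth m μ w) p`: the contribution to a momentum tail
of a pair of total momentum `w 0` in which the observed particle carries the fraction `c`. -/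
def tailWeight (m μ c : ℝ) (w : Conf M) : ℝ :=
  -3 * Real.pi ^ 2 * pairWidth m μ w + Real.pi ^ 2 * ‖c • w 0‖ ^ 2 / pairWidth m μ w

variable {X : Conf M → ℂ}

theorem integrable_norm_sq_mul_resolvent_sq (hm : 0 < m) (hμ : 0 < μ) (hX : MemFourierSobolev 1 X)
    (c : ℝ) (x : E3) : Integrable fun w : Conf M => ‖X w‖ ^ 2 *
      (‖x‖ ^ 2 / (‖x - c • w 0‖ ^ 2 + pairWidth m μ w ^ 2) ^ 2) := by
  have hwidth := (continuous_pairWidth (M := M) (m := m) (μ := μ)).measurable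
  have hpos := pairWidth_pos hm hμ (0 : Conf M)
  have hmeasurable : Measurable fun w : Conf M => ‖X w‖ ^ 2 *
      (‖x‖ ^ 2 / (‖x - c • w 0‖ ^ 2 + pairWidth m μ w ^ 2) ^ 2) :=
    (hX.measurable.norm.pow_const 2).mul (by fun_prop)
  refine ((hX.integrable_norm_sq zero_le_one).mul_const
    (‖x‖ ^ 2 / (pairWidth m μ (0 : Conf M) ^ 2) ^ 2)).mono' hmeasurable.aestronglyMeasurable
    (Eventually.of_forall fun w => ?_)
  have hle : pairWidth m μ (0 : Conf M) ^ 2 ≤ ‖x - c • w 0‖ ^ 2 + pairWidth m μ w ^ 2 :=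
    (pow_le_pow_left₀ hpos.le (pairWidth_zero_le hm w) 2).trans
      (le_add_of_nonneg_left (sq_nonneg _))
  rw [Real.norm_of_nonneg (by positivity)]
  gcongr

theorem integral_norm_sq_mul_tailKernel (hm : 0 < m) (hμ : 0 < μ) (hX : MemFourierSobolev 1 X)
    {c : ℝ} {p : E3} (hp : (2 * c) • ∫ w, ‖X w‖ ^ 2 • w 0 = (∫ w, ‖X w‖ ^ 2) • p) (x : E3) :
    ∫ w, ‖X w‖ ^ 2 * tailKernel (c • w 0) (pairWidth m μ w) p x =
      (∫ w, ‖X w‖ ^ 2 * (‖x‖ ^ 2 / (‖x - c • w 0‖ ^ 2 + pairWidth m μ w ^ 2) ^ 2)) -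
        (∫ w, ‖X w‖ ^ 2) * (‖x - p‖ ^ 2)⁻¹ := by
  have hX₀ := hX.integrable_norm_sq zero_le_one
  have hX₁ := hX.integrable_first_moment
  have hcentered : HasBochnerIntegral
      (fun w : Conf M => (2 * c) • (‖X w‖ ^ 2 • w 0) - ‖X w‖ ^ 2 • p) volume 0 := by
    have hmoment : HasBochnerIntegral (fun w : Conf M => (2 * c) • (‖X w‖ ^ 2 • w 0)) volume
        ((2 * c) • ∫ w, ‖X w‖ ^ 2 • w 0) := ⟨hX₁.smul (2 * c), integral_smul _ _⟩
    have hpole : HasBochnerIntegral (fun w : Conf M => ‖X w‖ ^ 2 • p) volume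
        ((∫ w, ‖X w‖ ^ 2) • p) := ⟨hX₀.smul_const p, integral_smul_const _ _⟩
    have h := hmoment.sub hpole
    rw [hp, sub_self] at h
    exact h
  have hinner : HasBochnerIntegral (fun w : Conf M =>
      inner ℝ x ((2 * c) • (‖X w‖ ^ 2 • w 0) - ‖X w‖ ^ 2 • p)) volume 0 :=
    ⟨hcentered.1.const_inner x, by rw [integral_inner hcentered.1, hcentered.2, inner_zero_right]⟩
  have hpole : HasBochnerIntegral (fun w : Conf M => ‖X w‖ ^ 2 * (‖x - p‖ ^ 2)⁻¹) volume
      ((∫ w, ‖X w‖ ^ 2) * (‖x - p‖ ^ 2)⁻¹) :=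
    ⟨hX₀.mul_const _, integral_mul_const _ _⟩
  have htotal := ((HasBochnerIntegral.of_integrable
    (integrable_norm_sq_mul_resolvent_sq hm hμ hX c x)).sub hpole).sub
    (hinner.const_mul (2 / (‖x‖ ^ 2 + 1) ^ 2))
  rw [mul_zero, sub_zero] at htotal
  rw [← htotal.2]
  refine integral_congr_ae (Eventually.of_forall fun w => ?_)
  simp only [tailKernel_eq, inner_sub_right, inner_smul_right]
  ring

theorem hasBochnerIntegral_norm_sq_mul_tailKernel (hm : 0 < m) (hμ : 0 < μ)
    (hX : MemFourierSobolev 1 X) (c : ℝ) (p : E3) :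
    HasBochnerIntegral
      (fun z : E3 × Conf M => ‖X z.2‖ ^ 2 * tailKernel (c • z.2 0) (pairWidth m μ z.2) p z.1)
      (volume.prod volume)
      (∫ w, ‖X w‖ ^ 2 * tailWeight m μ c w) := by
  obtain ⟨C, hC⟩ := exists_integral_abs_tailKernel_le (M := M) hm hμ c p
  have hK (w : Conf M) := hasBochnerIntegral_tailKernel (c • w 0) (pairWidth_pos hm hμ w) p
  have h := hasBochnerIntegral_norm_sq_mul_kernel hX (measurable_tailKernel c p)
    (fun w => (hK w).1) hC
  simpa only [(hK _).2, tailWeight] using h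

theorem integrable_norm_sq_mul_tailWeight (hm : 0 < m) (hμ : 0 < μ)
    (hX : MemFourierSobolev 1 X) (c : ℝ) :
    Integrable fun w => ‖X w‖ ^ 2 * tailWeight m μ c w := by
  have h := (hasBochnerIntegral_norm_sq_mul_tailKernel hm hμ hX c 0).1.integral_prod_right
  simpa only [integral_const_mul,
    (hasBochnerIntegral_tailKernel _ (pairWidth_pos hm hμ _) _).2, tailWeight] using h

theorem hasBochnerIntegral_diagonal_tail (hm : 0 < m) (hμ : 0 < μ) (hX : MemFourierSobolev 1 X)
    {c : ℝ} {p : E3} (hp : (2 * c) • ∫ w, ‖X w‖ ^ 2 • w 0 = (∫ w, ‖X w‖ ^ 2) • p) :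
    HasBochnerIntegral
      (fun x => (∫ w, ‖X w‖ ^ 2 * (‖x‖ ^ 2 / (‖x - c • w 0‖ ^ 2 + pairWidth m μ w ^ 2) ^ 2)) -
        (∫ w, ‖X w‖ ^ 2) * (‖x - p‖ ^ 2)⁻¹) volume
      (∫ w, ‖X w‖ ^ 2 * tailWeight m μ c w) := by
  have h := (hasBochnerIntegral_norm_sq_mul_tailKernel hm hμ hX c p).marginal
  simpa only [integral_norm_sq_mul_tailKernel hm hμ hX hp] using h

end TailKernel

section SchurTest

variable {M : ℕ} {m μ : ℝ}

theorem ae_rest_ne_zero (i : Fin M) : ∀ᵐ k : Conf M, rest k i ≠ 0 := by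
  have hcoord : Measure.QuasiMeasurePreserving fun k : Conf M => k.ofLp i.succ :=
    (Measure.quasiMeasurePreserving_eval (fun _ => volume) i.succ).comp
      (MeasurePreserving.symm (MeasurableEquiv.toLp 2 (Fin (M + 1) → E3))
        measurePreserving_piLp_toLp).quasiMeasurePreserving
  exact hcoord.ae (ae_ne 0)

/-- The kernel of the Schur test for two different charge terms. -/
def schurKernel (m μ : ℝ) (j : Fin M) (x : E3) (w : Conf M) : ℝ :=
  ‖rest w j‖ ^ 2 / ‖w 0 - x‖ ^ 2 * (pairDenom m μ x w)⁻¹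

theorem measurable_schurKernel (j : Fin M) :
    Measurable (Function.uncurry (schurKernel (M := M) m μ j)) := by
  have hnum : Continuous fun z : E3 × Conf M => ‖rest z.2 j‖ ^ 2 := by unfold rest; fun_prop
  have hden : Continuous fun z : E3 × Conf M => ‖z.2 0 - z.1‖ ^ 2 := by fun_prop
  exact (hnum.measurable.div hden.measurable).mul continuous_pairDenom.measurable.inv

theorem schurKernel_nonneg (hm : 0 < m) (hμ : 0 < μ) (j : Fin M) (x : E3) (w : Conf M) :
    0 ≤ schurKernel m μ j x w := by
  have := pairDenom_pos hm hμ x w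
  unfold schurKernel
  positivity

theorem le_pairDenom (hm : 0 < m) (x : E3) (w : Conf M) (j : Fin M) :
    1 / 2 * (‖w 0 - x‖ ^ 2 + (‖rest w j‖ ^ 2 + 2 * μ)) ≤ pairDenom m μ x w := by
  have hsum : ‖rest w j‖ ^ 2 ≤ ∑ i, ‖rest w i‖ ^ 2 :=
    Finset.single_le_sum (f := fun i => ‖rest w i‖ ^ 2) (fun i _ => sq_nonneg _)
      (Finset.mem_univ j)
  have hx : 0 ≤ 1 / (2 * m) * ‖x‖ ^ 2 := by positivity
  unfold pairDenom
  linarith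

theorem schurKernel_le (hm : 0 < m) (hμ : 0 < μ) (j : Fin M) (x : E3) (w : Conf M) :
    schurKernel m μ j x w ≤ 2 * ‖rest w j‖ ^ 2 *
      (‖x - w 0‖ ^ 2 * (‖x - w 0‖ ^ 2 + √(‖rest w j‖ ^ 2 + 2 * μ) ^ 2))⁻¹ := by
  rw [norm_sub_rev x, Real.sq_sqrt (by positivity)]
  calc schurKernel m μ j x w ≤ ‖rest w j‖ ^ 2 / ‖w 0 - x‖ ^ 2 *
        (1 / 2 * (‖w 0 - x‖ ^ 2 + (‖rest w j‖ ^ 2 + 2 * μ)))⁻¹ :=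
        mul_le_mul_of_nonneg_left (inv_anti₀ (by positivity) (le_pairDenom hm x w j))
          (by positivity)
    _ = _ := by
        rw [mul_inv, mul_inv, div_eq_mul_inv]
        ring

theorem hasBochnerIntegral_schurMajorant (hμ : 0 < μ) (j : Fin M) (w : Conf M) :
    HasBochnerIntegral (fun x => 2 * ‖rest w j‖ ^ 2 *
      (‖x - w 0‖ ^ 2 * (‖x - w 0‖ ^ 2 + √(‖rest w j‖ ^ 2 + 2 * μ) ^ 2))⁻¹) volume
      (2 * ‖rest w j‖ ^ 2 * (2 * Real.pi ^ 2 / √(‖rest w j‖ ^ 2 + 2 * μ))) :=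
  ((hasBochnerIntegral_inv_norm_sq_mul_norm_sq_add_sq
    (Real.sqrt_pos.2 (by positivity))).comp_sub_right (w 0)).const_mul _

theorem integrable_schurKernel (hm : 0 < m) (hμ : 0 < μ) (j : Fin M) (w : Conf M) :
    Integrable fun x => schurKernel m μ j x w :=
  (hasBochnerIntegral_schurMajorant hμ j w).1.mono'
    (measurable_schurKernel j).of_uncurry_right.aestronglyMeasurable
    (Eventually.of_forall fun x => by
      rw [Real.norm_of_nonneg (schurKernel_nonneg hm hμ j x w)]
      exact schurKernel_le hm hμ j x w)

theorem integral_abs_schurKernel_le (hm : 0 < m) (hμ : 0 < μ) (j : Fin M) (w : Conf M) :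
    ∫ x, |schurKernel m μ j x w| ≤ 4 * Real.pi ^ 2 / √(2 * μ) * (1 + ‖w‖ ^ 2) := by
  have hmajorant := hasBochnerIntegral_schurMajorant hμ j w
  have hsqrt : √(2 * μ) ≤ √(‖rest w j‖ ^ 2 + 2 * μ) :=
    Real.sqrt_le_sqrt (le_add_of_nonneg_left (sq_nonneg _))
  have hrest : ‖rest w j‖ ^ 2 ≤ 1 + ‖w‖ ^ 2 :=
    (norm_rest_sq_le w j).trans (le_add_of_nonneg_left zero_le_one)
  simp only [abs_of_nonneg (schurKernel_nonneg hm hμ j _ w)]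
  calc ∫ x, schurKernel m μ j x w
      ≤ 2 * ‖rest w j‖ ^ 2 * (2 * Real.pi ^ 2 / √(‖rest w j‖ ^ 2 + 2 * μ)) :=
        (integral_mono (integrable_schurKernel hm hμ j w) hmajorant.1
          fun x => schurKernel_le hm hμ j x w).trans_eq hmajorant.2
    _ ≤ 2 * (1 + ‖w‖ ^ 2) * (2 * Real.pi ^ 2 / √(2 * μ)) := by
        have : 0 < √(2 * μ) := by positivity
        gcongr
    _ = _ := by ring

variable {X : Conf M → ℂ}

theorem integrable_norm_sq_chargeTerm_mul_ratio_mul_greenSymbol (hm : 0 < m) (hμ : 0 < μ)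
    (hX : MemFourierSobolev 1 X) {i j : Fin (M + 1)} (hij : i ≠ j) :
    Integrable fun k : Conf (M + 1) => ‖chargeTerm X i k‖ ^ 2 *
      (‖rest k j‖ ^ 2 / ‖rest k i‖ ^ 2 * greenSymbol m μ k) := by
  obtain ⟨j, rfl⟩ := Fin.exists_succAbove_eq hij.symm
  have h := (hasBochnerIntegral_norm_sq_chargeTerm_mul_kernel hX
    (measurable_schurKernel (m := m) (μ := μ) j) (integrable_schurKernel hm hμ j)
    (integral_abs_schurKernel_le hm hμ j) i).1
  simpa only [schurKernel, ← greenSymbol_eq_inv_pairDenom, pairMap_zero, rest_pairMap,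
    add_sub_cancel_left] using h

theorem mul_le_half_sq_mul_ratio_add {a b : ℝ} (ha : 0 < a) (hb : 0 < b) (s t : ℝ) :
    s * t ≤ 1 / 2 * (s ^ 2 * (b ^ 2 / a ^ 2) + t ^ 2 * (a ^ 2 / b ^ 2)) := by
  have hsplit : s * t = s * (b / a) * (t * (a / b)) := by field_simp
  rw [hsplit, ← div_pow, ← div_pow, ← mul_pow, ← mul_pow]
  linarith [two_mul_le_add_sq (s * (b / a)) (t * (a / b))]

-- The weight `|k_j|²/|k_i|²` makes each half of the AM-GM bound an integrable singular kernel,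
-- whereas the two terms `𝒢 |ξ_i|²` alone are not integrable.
theorem integrable_greenSymbol_mul_norm_chargeTerm_mul (hm : 0 < m) (hμ : 0 < μ)
    (hX : MemFourierSobolev 1 X) {i j : Fin (M + 1)} (hij : i ≠ j) :
    Integrable fun k : Conf (M + 1) =>
      greenSymbol m μ k * (‖chargeTerm X i k‖ * ‖chargeTerm X j k‖) := by
  have hi := integrable_norm_sq_chargeTerm_mul_ratio_mul_greenSymbol hm hμ hX hij
  have hj := integrable_norm_sq_chargeTerm_mul_ratio_mul_greenSymbol hm hμ hX hij.symm
  refine ((hi.add hj).const_mul (1 / 2)).mono' (measurable_greenSymbol.mul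
    ((measurable_chargeTerm hX.measurable i).norm.mul
      (measurable_chargeTerm hX.measurable j).norm)).aestronglyMeasurable ?_
  filter_upwards [ae_rest_ne_zero i, ae_rest_ne_zero j] with k hki hkj
  have hG := greenSymbol_pos hm hμ k
  rw [Real.norm_of_nonneg (by positivity), Pi.add_apply]
  calc greenSymbol m μ k * (‖chargeTerm X i k‖ * ‖chargeTerm X j k‖)
      ≤ greenSymbol m μ k * (1 / 2 * (‖chargeTerm X i k‖ ^ 2 * (‖rest k j‖ ^ 2 / ‖rest k i‖ ^ 2) +
          ‖chargeTerm X j k‖ ^ 2 * (‖rest k i‖ ^ 2 / ‖rest k j‖ ^ 2))) :=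
        mul_le_mul_of_nonneg_left (mul_le_half_sq_mul_ratio_add (norm_pos_iff.2 hki)
          (norm_pos_iff.2 hkj) _ _) hG.le
    _ = _ := by ring

theorem integrable_greenSymbol_mul_conj_chargeTerm_mul (hm : 0 < m) (hμ : 0 < μ)
    (hX : MemFourierSobolev 1 X) {i j : Fin (M + 1)} (hij : i ≠ j) :
    Integrable fun k : Conf (M + 1) =>
      (greenSymbol m μ k : ℂ) * ((starRingEnd ℂ) (chargeTerm X i k) * chargeTerm X j k) := by
  refine (integrable_greenSymbol_mul_norm_chargeTerm_mul hm hμ hX hij).mono'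
    ((Complex.measurable_ofReal.comp measurable_greenSymbol).mul
      ((Complex.continuous_conj.measurable.comp (measurable_chargeTerm hX.measurable i)).mul
        (measurable_chargeTerm hX.measurable j))).aestronglyMeasurable
    (Eventually.of_forall fun k => ?_)
  rw [norm_mul, norm_mul, Complex.norm_real, Complex.norm_conj,
    Real.norm_of_nonneg (greenSymbol_pos hm hμ k).le]

/-- The sum of the interference terms between different charge terms, which is the off-diagonal part
of `‖chargeSum X k‖ ^ 2`. -/
def offSum (X : Conf M → ℂ) (k : Conf (M + 1)) : ℝ :=
  ∑ i, ∑ j ∈ Finset.univ.erase i, ((starRingEnd ℂ) (chargeTerm X i k) * chargeTerm X j k).re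

theorem norm_sq_chargeSum (X : Conf M → ℂ) (k : Conf (M + 1)) :
    ‖chargeSum X k‖ ^ 2 = ∑ i, ‖chargeTerm X i k‖ ^ 2 + offSum X k := by
  have hsq (z : ℂ) : ‖z‖ ^ 2 = ((starRingEnd ℂ) z * z).re := by
    rw [Complex.conj_mul', ← Complex.ofReal_pow, Complex.ofReal_re]
  rw [hsq, chargeSum, map_sum, Finset.sum_mul_sum, Complex.re_sum, offSum,
    ← Finset.sum_add_distrib]
  refine Finset.sum_congr rfl fun i _ => ?_
  rw [hsq, Complex.re_sum, Finset.add_sum_erase Finset.univ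
    (fun j => ((starRingEnd ℂ) (chargeTerm X i k) * chargeTerm X j k).re) (Finset.mem_univ i)]

theorem integrable_greenSymbol_mul_offSum (hm : 0 < m) (hμ : 0 < μ) (hX : MemFourierSobolev 1 X) :
    Integrable fun k : Conf (M + 1) => greenSymbol m μ k * offSum X k := by
  simp only [offSum, Finset.mul_sum, ← Complex.re_ofReal_mul]
  exact integrable_finsetSum _ fun i _ => integrable_finsetSum _ fun j hj =>
    (integrable_greenSymbol_mul_conj_chargeTerm_mul hm hμ hX (Finset.ne_of_mem_erase hj).symm).re

end SchurTest

section SquareIntegrability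

variable {M : ℕ} {m μ : ℝ} {X : Conf M → ℂ}

theorem kinetic_add_le (hm : 0 < m) (hμ : 0 < μ) (k : Conf M) :
    kinetic m k + μ ≤ (1 / (2 * m) + 1 / 2 + μ) * (1 + ‖k‖ ^ 2) := by
  have hmass : 0 ≤ 1 / (2 * m) := by positivity
  have hzero := norm_zero_sq_le k
  have hrest : ∑ i, ‖rest k i‖ ^ 2 ≤ ‖k‖ ^ 2 := by
    rw [norm_sq_conf k]
    exact le_add_of_nonneg_left (sq_nonneg _)
  rw [kinetic]
  nlinarith [mul_le_mul_of_nonneg_left hzero hmass, mul_nonneg hμ.le (sq_nonneg ‖k‖)]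

theorem memLp_greenSymbol_mul_chargeTerm (hm : 0 < m) (hμ : 0 < μ) (hX : MemFourierSobolev 1 X)
    (i : Fin (M + 1)) : MemLp (fun k => (greenSymbol m μ k : ℂ) * chargeTerm X i k) 2 := by
  have hmeas : Measurable fun k => (greenSymbol m μ k : ℂ) * chargeTerm X i k :=
    (Complex.measurable_ofReal.comp measurable_greenSymbol).mul
      (measurable_chargeTerm hX.measurable i)
  refine (memLp_two_iff_integrable_sq_norm hmeas.aestronglyMeasurable).2 ?_
  have h := hasBochnerIntegral_greenSymbol_sq_mul_norm_sq_chargeTerm hm hμ hX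
    (V := fun _ => 1) measurable_const (C := 1) (fun w => by
      rw [abs_one, one_mul]
      exact le_add_of_nonneg_right (sq_nonneg _)) i
  simpa only [norm_mul, mul_pow, Complex.norm_real, Real.norm_eq_abs, sq_abs, one_mul] using h.1

theorem memLp_greenSymbol_mul_chargeSum (hm : 0 < m) (hμ : 0 < μ) (hX : MemFourierSobolev 1 X) :
    MemLp (fun k => (greenSymbol m μ k : ℂ) * chargeSum X k) 2 := by
  simpa only [chargeSum, Finset.mul_sum] using
    memLp_finsetSum Finset.univ fun i _ => memLp_greenSymbol_mul_chargeTerm hm hμ hX i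

theorem integrable_norm_rest_sq_mul_greenSymbol_sq_mul_norm_sq_chargeTerm (hm : 0 < m) (hμ : 0 < μ)
    (hX : MemFourierSobolev 1 X) {i l : Fin (M + 1)} (hil : l ≠ i) :
    Integrable fun k => ‖rest k l‖ ^ 2 * greenSymbol m μ k ^ 2 * ‖chargeTerm X i k‖ ^ 2 := by
  obtain ⟨j, rfl⟩ := Fin.exists_succAbove_eq hil
  have h := hasBochnerIntegral_greenSymbol_sq_mul_norm_sq_chargeTerm hm hμ hX
    (V := fun w => ‖rest w j‖ ^ 2) (by unfold rest; fun_prop) (C := 1) (fun w => by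
      rw [abs_of_nonneg (sq_nonneg _), one_mul]
      exact (norm_rest_sq_le w j).trans (le_add_of_nonneg_left zero_le_one)) i
  simpa only [rest_pairMap] using h.1

end SquareIntegrability

section Densities

variable {M : ℕ} {m μ : ℝ}

/-- The momentum configuration in which the first fermion has momentum `x` and the remaining
particles have momenta `q = (k₀, k₂, …)`, as in `densityDown`. -/
def downPt (x : E3) (q : Fin (M + 1) → E3) : Conf (M + 1) :=
  pt (q 0) (Fin.cons x (Fin.tail q) : Fin (M + 1) → E3)

theorem downPt_eq_swap (x : E3) (q : Fin (M + 1) → E3) :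
    downPt x q = LinearIsometryEquiv.piLpCongrLeft 2 ℝ E3 (Equiv.swap 0 1) (pt x q) := by
  refine PiLp.ext (Fin.cases rfl (Fin.cases rfl fun i => ?_))
  have hfix : Equiv.swap (0 : Fin (M + 2)) 1 i.succ.succ = i.succ.succ :=
    Equiv.swap_apply_of_ne_of_ne (Fin.succ_ne_zero _)
      fun h => Fin.succ_ne_zero i (Fin.succ_injective _ h)
  simp [downPt, Equiv.piCongrLeft', hfix, pt, Fin.tail]

theorem measurePreserving_downPt :
    MeasurePreserving fun p : E3 × (Fin (M + 1) → E3) => downPt p.1 p.2 := by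
  simp only [downPt_eq_swap]
  exact (LinearIsometryEquiv.measurePreserving _).comp measurePreserving_pt

theorem measurableEmbedding_downPt :
    MeasurableEmbedding fun p : E3 × (Fin (M + 1) → E3) => downPt p.1 p.2 := by
  simp only [downPt_eq_swap]
  exact (LinearIsometryEquiv.piLpCongrLeft 2 ℝ E3
    (Equiv.swap 0 1)).toHomeomorph.measurableEmbedding.comp measurableEmbedding_pt

theorem pairMap_zero_downPt (x : E3) (q : Fin (M + 1) → E3) :
    pairMap 0 (downPt x q) = pairMap 0 (pt x q) := by
  simp only [pairMap, downPt, pt_zero, rest_pt, Fin.cons_zero, add_comm (q 0)]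
  rfl

@[simp] theorem rest_downPt_zero (x : E3) (q : Fin (M + 1) → E3) : rest (downPt x q) 0 = x := rfl

theorem greenSymbol_pt (hm : 0 < m) (hμ : 0 < μ) (i : Fin (M + 1)) (x : E3)
    (q : Fin (M + 1) → E3) :
    greenSymbol m μ (pt x q) =
      (pairFactor m * (‖x - (m / (m + 1)) • pairMap i (pt x q) 0‖ ^ 2 +
        pairWidth m μ (pairMap i (pt x q)) ^ 2))⁻¹ := by
  rw [greenSymbol_eq_inv_pairDenom i, pt_zero, pairDenom_eq hm hμ]

theorem greenSymbol_downPt (hm : 0 < m) (hμ : 0 < μ) (x : E3) (q : Fin (M + 1) → E3) :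
    greenSymbol m μ (downPt x q) =
      (pairFactor m * (‖x - (1 / (m + 1)) • pairMap 0 (pt x q) 0‖ ^ 2 +
        pairWidth m μ (pairMap 0 (pt x q)) ^ 2))⁻¹ := by
  have hzero : downPt x q 0 = pairMap 0 (downPt x q) 0 - x := by
    rw [pairMap_zero, rest_downPt_zero, add_sub_cancel_right]
  rw [greenSymbol_eq_inv_pairDenom 0, hzero, pairDenom_sub_eq hm hμ, pairMap_zero_downPt]

variable {X : Conf M → ℂ}

theorem hasBochnerIntegral_pairMap_pt (hm : 0 < m) (hμ : 0 < μ) (hX : MemFourierSobolev 1 X)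
    (c : ℝ) (i : Fin (M + 1)) (x : E3) :
    HasBochnerIntegral (fun q : Fin (M + 1) → E3 => (pairFactor m ^ 2)⁻¹ *
      (‖X (pairMap i (pt x q))‖ ^ 2 * (‖x‖ ^ 2 / (‖x - c • pairMap i (pt x q) 0‖ ^ 2 +
        pairWidth m μ (pairMap i (pt x q)) ^ 2) ^ 2))) volume
      ((pairFactor m ^ 2)⁻¹ * ∫ w, ‖X w‖ ^ 2 *
        (‖x‖ ^ 2 / (‖x - c • w 0‖ ^ 2 + pairWidth m μ w ^ 2) ^ 2)) :=
  ((HasBochnerIntegral.of_integrable (integrable_norm_sq_mul_resolvent_sq hm hμ hX c x)).const_mul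
    (pairFactor m ^ 2)⁻¹).comp (measurePreserving_pairMap_pt i x)
    (measurableEmbedding_pairMap_pt i x)

theorem hasBochnerIntegral_green_sq_chargeTerm_pt (hm : 0 < m) (hμ : 0 < μ)
    (hX : MemFourierSobolev 1 X) (i : Fin (M + 1)) (x : E3) :
    HasBochnerIntegral (fun q : Fin (M + 1) → E3 =>
        ‖x‖ ^ 2 * (greenSymbol m μ (pt x q) ^ 2 * ‖chargeTerm X i (pt x q)‖ ^ 2)) volume
      ((pairFactor m ^ 2)⁻¹ * ∫ w, ‖X w‖ ^ 2 *
        (‖x‖ ^ 2 / (‖x - (m / (m + 1)) • w 0‖ ^ 2 + pairWidth m μ w ^ 2) ^ 2)) := by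
  refine (hasBochnerIntegral_pairMap_pt hm hμ hX (m / (m + 1)) i x).congr
    (Eventually.of_forall fun q => ?_)
  simp only [norm_chargeTerm, greenSymbol_pt hm hμ i, inv_pow, mul_pow, mul_inv, div_eq_mul_inv]
  ring

theorem hasBochnerIntegral_green_sq_chargeTerm_downPt (hm : 0 < m) (hμ : 0 < μ)
    (hX : MemFourierSobolev 1 X) (x : E3) :
    HasBochnerIntegral (fun q : Fin (M + 1) → E3 =>
        ‖x‖ ^ 2 * (greenSymbol m μ (downPt x q) ^ 2 * ‖chargeTerm X 0 (downPt x q)‖ ^ 2)) volume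
      ((pairFactor m ^ 2)⁻¹ * ∫ w, ‖X w‖ ^ 2 *
        (‖x‖ ^ 2 / (‖x - (1 / (m + 1)) • w 0‖ ^ 2 + pairWidth m μ w ^ 2) ^ 2)) := by
  refine (hasBochnerIntegral_pairMap_pt hm hμ hX (1 / (m + 1)) 0 x).congr
    (Eventually.of_forall fun q => ?_)
  simp only [norm_chargeTerm, greenSymbol_downPt hm hμ, pairMap_zero_downPt, inv_pow, mul_pow,
    mul_inv, div_eq_mul_inv]
  ring

/-- The part of `k₀² |Ψ|²` that remains after removing the slowly decaying diagonal terms; it is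
integrable for the wave functions in the domain. -/
def regularUp (m μ : ℝ) (X : Conf M → ℂ) (Ψ : Conf (M + 1) → ℂ) (k : Conf (M + 1)) : ℝ :=
  ‖k 0‖ ^ 2 * (‖Ψ k‖ ^ 2 - ∑ i, greenSymbol m μ k ^ 2 * ‖chargeTerm X i k‖ ^ 2)

/-- The part of `|rest k l|² |Ψ|²` that remains after removing the slowly decaying diagonal term,
the one in which fermion `l` has merged with the distinguished particle. -/
def regularDown (m μ : ℝ) (X : Conf M → ℂ) (Ψ : Conf (M + 1) → ℂ) (l : Fin (M + 1))
    (k : Conf (M + 1)) : ℝ :=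
  ‖rest k l‖ ^ 2 * (‖Ψ k‖ ^ 2 - greenSymbol m μ k ^ 2 * ‖chargeTerm X l k‖ ^ 2)

variable {Ψ : Conf (M + 1) → ℂ}

theorem norm_sq_mul_integral_norm_sq_pt_eq (hm : 0 < m) (hμ : 0 < μ) (hX : MemFourierSobolev 1 X)
    (hΨ : Integrable (regularUp m μ X Ψ)) :
    (fun x => ‖x‖ ^ 2 * ∫ q : Fin (M + 1) → E3, ‖Ψ (pt x q)‖ ^ 2) =ᵐ[volume] fun x =>
      (∫ q, regularUp m μ X Ψ (pt x q)) + (M + 1) * ((pairFactor m ^ 2)⁻¹ * ∫ w, ‖X w‖ ^ 2 *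
        (‖x‖ ^ 2 / (‖x - (m / (m + 1)) • w 0‖ ^ 2 + pairWidth m μ w ^ 2) ^ 2)) := by
  have hsections := (measurePreserving_pt.integrable_comp_emb measurableEmbedding_pt).2 hΨ
  filter_upwards [hsections.prod_right_ae] with x hx
  have htotal := (HasBochnerIntegral.of_integrable hx).add (HasBochnerIntegral.sum Finset.univ
    fun i _ => hasBochnerIntegral_green_sq_chargeTerm_pt hm hμ hX i x)
  rw [← integral_const_mul]
  refine (htotal.congr (Eventually.of_forall fun q => ?_)).2.trans ?_
  · simp only [Function.comp_apply, regularUp, pt_zero, ← Finset.mul_sum]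
    ring
  · simp only [Finset.sum_const, Finset.card_univ, Fintype.card_fin, nsmul_eq_mul,
      Function.comp_apply, Nat.cast_add_one]

theorem norm_sq_mul_integral_norm_sq_downPt_eq (hm : 0 < m) (hμ : 0 < μ)
    (hX : MemFourierSobolev 1 X) (hΨ : Integrable (regularDown m μ X Ψ 0)) :
    (fun x => ‖x‖ ^ 2 * ∫ q : Fin (M + 1) → E3, ‖Ψ (downPt x q)‖ ^ 2) =ᵐ[volume] fun x =>
      (∫ q, regularDown m μ X Ψ 0 (downPt x q)) + (pairFactor m ^ 2)⁻¹ * ∫ w, ‖X w‖ ^ 2 *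
        (‖x‖ ^ 2 / (‖x - (1 / (m + 1)) • w 0‖ ^ 2 + pairWidth m μ w ^ 2) ^ 2) := by
  have hsections := (measurePreserving_downPt.integrable_comp_emb measurableEmbedding_downPt).2 hΨ
  filter_upwards [hsections.prod_right_ae] with x hx
  have htotal := (HasBochnerIntegral.of_integrable hx).add
    (hasBochnerIntegral_green_sq_chargeTerm_downPt hm hμ hX x)
  rw [← integral_const_mul]
  refine (htotal.congr (Eventually.of_forall fun q => ?_)).2
  simp only [Function.comp_apply, regularDown, rest_downPt_zero]
  ring

theorem greenSymbol_permConf (σ : Equiv.Perm (Fin M)) (k : Conf M) :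
    greenSymbol m μ (permConf σ k) = greenSymbol m μ k := by
  simp only [greenSymbol, permConf_zero, rest_permConf]
  rw [Equiv.sum_comp σ fun i => ‖rest k i‖ ^ 2]

theorem integral_regularDown_eq (hX : AEAntisymm X) (hΨ : AEAntisymm Ψ) (l : Fin (M + 1)) :
    ∫ k, regularDown m μ X Ψ l k = ∫ k, regularDown m μ X Ψ 0 k := by
  rw [← (measurePreserving_permConf (Equiv.swap 0 l)).integral_comp
    (measurableEmbedding_permConf (Equiv.swap 0 l)) (regularDown m μ X Ψ 0)]
  refine integral_congr_ae ?_
  filter_upwards [hX.chargeTerm_permConf (Equiv.swap 0 l) 0, hΨ (Equiv.swap 0 l)] with k hXk hΨk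
  simp only [regularDown, hXk, hΨk, norm_sign_mul, greenSymbol_permConf, rest_permConf,
    Equiv.swap_apply_left]

end Densities

section Coincidence

variable {M : ℕ}

/-- The momentum configuration in which the distinguished particle has momentum `x`, the pair that
it forms with particle `i` has total momentum `w 0`, and the other momenta are those of `w`: the
inverse of `splitMap i`. -/
def joinPair (i : Fin (M + 1)) (x : E3) (w : Conf M) : Conf (M + 1) :=
  pt x (i.insertNth (α := fun _ => E3) (w 0 - x) (rest w))

theorem pairMap_joinPair (i : Fin (M + 1)) (x : E3) (w : Conf M) :
    pairMap i (joinPair i x w) = w := by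
  simp [joinPair, pairMap, pt_rest]

theorem joinPair_pairMap (i : Fin (M + 1)) (k : Conf (M + 1)) :
    joinPair i (k 0) (pairMap i k) = k := by
  have hrest : rest (pairMap i k) = i.removeNth (rest k) := rest_pt _ _
  rw [joinPair, pairMap_zero, hrest, add_sub_cancel_left, Fin.insertNth_self_removeNth,
    pt_rest]

theorem joinPair_smul (i : Fin (M + 1)) (c : ℝ) (x : E3) (w : Conf M) :
    joinPair i (c • x) (c • w) = c • joinPair i x w := by
  refine PiLp.ext (Fin.cases rfl (i.succAboveCases ?_ fun j => ?_))
  · simp only [joinPair, PiLp.smul_apply, pt_succ, Fin.insertNth_apply_same, smul_sub]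
  · simp only [joinPair, PiLp.smul_apply, pt_succ, Fin.insertNth_apply_succAbove, rest]

theorem norm_le_norm_joinPair (i : Fin (M + 1)) (x : E3) (w : Conf M) : ‖x‖ ≤ ‖joinPair i x w‖ :=
  PiLp.norm_apply_le (joinPair i x w) 0

theorem continuous_joinPair (i : Fin (M + 1)) :
    Continuous fun p : E3 × Conf M => joinPair i p.1 p.2 :=
  continuous_pt.comp (continuous_fst.prodMk
    (Continuous.finInsertNth i (by fun_prop) (continuous_rest.comp continuous_snd)))

theorem hasBochnerIntegral_integral_joinPair {E : Type*} [NormedAddCommGroup E] [NormedSpace ℝ E]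
    (i : Fin (M + 1)) {G : Conf (M + 1) → E} (hG : Integrable G) :
    HasBochnerIntegral (fun w => ∫ x, G (joinPair i x w)) volume (∫ k, G k) := by
  have h : HasBochnerIntegral (fun p : E3 × Conf M => G (joinPair i p.1 p.2))
      (volume.prod volume) (∫ k, G k) := by
    rw [← HasBochnerIntegral.comp_iff (measurePreserving_splitMap i)
      (measurableEmbedding_splitMap i)]
    simp only [splitMap, joinPair_pairMap]
    exact HasBochnerIntegral.of_integrable hG
  exact ⟨h.1.integral_prod_right, by rw [← integral_prod_symm _ h.1, h.2]⟩

theorem coincidence_last (x : Conf M) : coincidence x (Fin.last M).succ = x 0 := by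
  rw [coincidence, pt_succ, Fin.snoc_last]

theorem coincidence_castSucc (x : Conf M) (i : Fin M) :
    coincidence x i.castSucc.succ = x i.succ := by
  rw [coincidence, pt_succ, Fin.snoc_castSucc]
  rfl

theorem isLinearMap_coincidence : IsLinearMap ℝ (coincidence (M := M)) where
  map_add x y := by
    refine PiLp.ext (Fin.cases rfl (Fin.lastCases ?_ fun i => ?_))
    · simp only [PiLp.add_apply, coincidence_last]
    · simp only [PiLp.add_apply, coincidence_castSucc]
  map_smul c x := by
    refine PiLp.ext (Fin.cases rfl (Fin.lastCases ?_ fun i => ?_))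
    · simp only [PiLp.smul_apply, coincidence_last]
    · simp only [PiLp.smul_apply, coincidence_castSucc]

theorem continuous_coincidence : Continuous (coincidence (M := M)) := by
  refine continuous_pt.comp (Continuous.prodMk (f := fun x : Conf M => x 0) (by fun_prop)
    (continuous_pi fun i => ?_))
  refine Fin.lastCases ?_ (fun i => ?_) i
  · exact (by fun_prop : Continuous fun x : Conf M => x 0).congr
      fun x => (Fin.snoc_last (α := fun _ => E3) (x 0) (rest x)).symm
  · exact (by fun_prop : Continuous fun x : Conf M => x i.succ).congr
      fun x => (Fin.snoc_castSucc (α := fun _ => E3) (x 0) (rest x) i).symm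

/-- `coincidence` as a continuous linear map. -/
def coincidenceCLM (M : ℕ) : Conf M →L[ℝ] Conf (M + 1) :=
  ⟨isLinearMap_coincidence.mk' coincidence, continuous_coincidence⟩

theorem norm_le_norm_coincidence (x : Conf M) : ‖x‖ ≤ ‖coincidence x‖ := by
  refine le_of_sq_le_sq ?_ (norm_nonneg _)
  rw [norm_sq_conf, norm_sq_conf, Fin.sum_univ_castSucc (n := M), coincidence, rest_pt, pt_zero,
    Fin.snoc_last]
  simp only [Fin.snoc_castSucc]
  linarith [sq_nonneg ‖x 0‖]

theorem antilipschitz_coincidenceCLM : AntilipschitzWith 1 (coincidenceCLM M) :=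
  AddMonoidHomClass.antilipschitz_of_bound _ fun x => by
    rw [NNReal.coe_one, one_mul]
    exact norm_le_norm_coincidence x

theorem inner_pairMap_last (k : Conf (M + 1)) (y : Conf M) :
    inner ℝ (pairMap (Fin.last M) k) y = inner ℝ k (coincidence y) := by
  have hsucc (i : Fin M) : pairMap (Fin.last M) k i.succ = k i.castSucc.succ := by
    change rest (pairMap (Fin.last M) k) i = _
    rw [rest_pairMap, Fin.succAbove_last]
    rfl
  have hzero : coincidence y 0 = y 0 := rfl
  rw [PiLp.inner_apply, PiLp.inner_apply, Fin.sum_univ_succ, Fin.sum_univ_succ,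
    Fin.sum_univ_castSucc (n := M)]
  simp only [hsucc, coincidence_castSucc, coincidence_last, hzero, pairMap_zero, inner_add_left,
    rest]
  ring

/-- The restriction of a Schwartz function to the plane of coincidence. -/
def restrictSchwartz (f : 𝓢(Conf (M + 1), ℂ)) : 𝓢(Conf M, ℂ) :=
  SchwartzMap.compCLMOfAntilipschitz ℂ (coincidenceCLM M).hasTemperateGrowth
    antilipschitz_coincidenceCLM f

theorem restrictSchwartz_apply (f : 𝓢(Conf (M + 1), ℂ)) (x : Conf M) :
    restrictSchwartz f x = f (coincidence x) := rfl

theorem exists_norm_schwartz_le {E F : Type*} [NormedAddCommGroup E] [NormedSpace ℝ E]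
    [NormedAddCommGroup F] [NormedSpace ℝ F] (f : 𝓢(E, F)) (n : ℕ) :
    ∃ C : ℝ, 0 ≤ C ∧ ∀ x, ‖f x‖ ≤ C * (1 + ‖x‖) ^ (-(n : ℝ)) := by
  refine ⟨2 ^ n * ((Finset.Iic (n, 0)).sup fun m => SchwartzMap.seminorm ℝ m.1 m.2) f,
    mul_nonneg (by positivity) (apply_nonneg _ _), fun x => ?_⟩
  have h := SchwartzMap.one_add_le_sup_seminorm_apply (𝕜 := ℝ) (m := (n, 0)) le_rfl le_rfl f x
  rw [norm_iteratedFDeriv_zero, mul_comm] at h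
  rw [Real.rpow_neg (by positivity), ← div_eq_mul_inv, le_div_iff₀ (by positivity),
    Real.rpow_natCast]
  exact h

theorem continuous_integral_joinPair (i : Fin (M + 1)) (f : 𝓢(Conf (M + 1), ℂ)) :
    Continuous fun w => ∫ x, f (joinPair i x w) := by
  obtain ⟨C, hC, hfC⟩ := exists_norm_schwartz_le f 4
  refine continuous_of_dominated (bound := fun x : E3 => C * (1 + ‖x‖) ^ (-((4 : ℕ) : ℝ)))
    (fun w => ?_) (fun w => Eventually.of_forall fun x => ?_) ?_
    (Eventually.of_forall fun x => ?_)
  · exact (f.continuous.comp ((continuous_joinPair i).comp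
      (Continuous.prodMk_left w))).aestronglyMeasurable
  · refine (hfC _).trans (mul_le_mul_of_nonneg_left ?_ hC)
    exact Real.rpow_le_rpow_of_nonpos (by positivity)
      (by linarith [norm_le_norm_joinPair i x w]) (by norm_num)
  · refine Integrable.const_mul (integrable_one_add_norm ?_) C
    rw [finrank_euclideanSpace_fin]
    norm_num
  · exact f.continuous.comp ((continuous_joinPair i).comp (Continuous.prodMk_right x))

theorem fourierInv_integral_joinPair_last (f : 𝓢(Conf (M + 1), ℂ)) :
    𝓕⁻ (fun w : Conf M => ∫ x, (𝓕 f : 𝓢(Conf (M + 1), ℂ)) (joinPair (Fin.last M) x w)) =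
      (restrictSchwartz f : Conf M → ℂ) := by
  funext y
  have hinv : (𝓕⁻ (𝓕 f)) (coincidence y) = f (coincidence y) := by
    rw [FourierTransform.fourierInv_fourier_eq]
  have hint : Integrable fun k : Conf (M + 1) =>
      Real.fourierChar (inner ℝ (pairMap (Fin.last M) k) y) • (𝓕 f) k := by
    have hcont : Continuous fun k : Conf (M + 1) =>
        Real.fourierChar (inner ℝ (pairMap (Fin.last M) k) y) • (𝓕 f) k :=
      (Real.continuous_fourierChar.comp ((continuous_pairMap _).inner continuous_const)).smul
        (𝓕 f).continuous
    exact (𝓕 f).integrable.mono hcont.aestronglyMeasurable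
      (Eventually.of_forall fun k => by rw [Circle.norm_smul])
  have hjoin := (hasBochnerIntegral_integral_joinPair (Fin.last M) hint).2
  simp only [pairMap_joinPair, inner_pairMap_last] at hjoin
  rw [restrictSchwartz_apply, ← hinv, SchwartzMap.fourierInv_coe, Real.fourierInv_eq,
    Real.fourierInv_eq, ← hjoin]
  refine integral_congr_ae (Eventually.of_forall fun w => ?_)
  simp only [Circle.smul_def]
  rw [integral_smul]

theorem fourier_restrictSchwartz (f : 𝓢(Conf (M + 1), ℂ)) (w : Conf M) :
    𝓕 (restrictSchwartz f) w = ∫ x, (𝓕 f) (joinPair (Fin.last M) x w) := by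
  have hinv := fourierInv_integral_joinPair_last f
  have hint := (hasBochnerIntegral_integral_joinPair (Fin.last M) (𝓕 f).integrable).1
  have hfourier : Integrable
      (𝓕 fun w : Conf M => ∫ x, (𝓕 f : 𝓢(Conf (M + 1), ℂ)) (joinPair (Fin.last M) x w)) := by
    have hneg : 𝓕 (fun w : Conf M => ∫ x, (𝓕 f : 𝓢(Conf (M + 1), ℂ))
        (joinPair (Fin.last M) x w)) = fun y => restrictSchwartz f (-y) := by
      funext y
      rw [← hinv, Real.fourierInv_eq_fourier_neg, neg_neg]
    rw [hneg]
    exact ((LinearIsometryEquiv.neg ℝ (E := Conf M)).measurePreserving.integrable_comp_emb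
      (LinearIsometryEquiv.neg ℝ (E := Conf M)).toHomeomorph.measurableEmbedding).2
      (restrictSchwartz f).integrable
  have h := (continuous_integral_joinPair (Fin.last M) (𝓕 f)).fourier_fourierInv_eq hint hfourier
  rw [hinv, ← SchwartzMap.fourier_coe] at h
  exact congrFun h w

end Coincidence

section Trace

variable {M : ℕ}

/-- The unitary Fourier transform of a Schwartz function, defined at every point and not only almost
everywhere as `hat`. -/
def schwartzHat (f : 𝓢(Conf M, ℂ)) (k : Conf M) : ℂ :=
  (((2 * Real.pi) ^ (-(3 * ((M : ℝ) + 1)) / 2) : ℝ) : ℂ) * (𝓕 f) ((2 * Real.pi)⁻¹ • k)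

theorem hat_toLp (f : 𝓢(Conf M, ℂ)) : hat (f.toLp 2 volume) =ᵐ[volume] schwartzHat f := by
  have h : (𝓕 (f.toLp 2 volume) : L2 M) =ᵐ[volume] ((𝓕 f : 𝓢(Conf M, ℂ)) : Conf M → ℂ) := by
    rw [SchwartzMap.toLp_fourier_eq]
    exact SchwartzMap.coeFn_toLp _ _ _
  filter_upwards [ae_comp_const_smul inv_two_pi_ne_zero h] with k hk
  rw [hat, hk, schwartzHat]

theorem integral_joinPair_smul (i : Fin (M + 1)) (F : Conf (M + 1) → ℂ) {c : ℝ} (hc : 0 < c)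
    (w : Conf M) :
    ∫ x, F (joinPair i x (c • w)) =
      ((c ^ 3 : ℝ) : ℂ) * ∫ x, F (c • joinPair i x w) := by
  have hscale := Measure.integral_comp_smul (volume : Measure E3)
    (fun x => F (joinPair i x (c • w))) c
  simp only [joinPair_smul] at hscale
  rw [hscale, finrank_euclideanSpace_fin, Complex.real_smul, ← mul_assoc, ← Complex.ofReal_mul,
    abs_of_pos (by positivity), mul_inv_cancel₀ (by positivity), Complex.ofReal_one, one_mul]

theorem schwartzHat_restrictSchwartz (f : 𝓢(Conf (M + 1), ℂ)) (w : Conf M) :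
    schwartzHat (restrictSchwartz f) w =
      ((((2 * Real.pi) ^ (3 / 2 : ℝ))⁻¹ : ℝ) : ℂ) *
        ∫ x, schwartzHat f (joinPair (Fin.last M) x w) := by
  have hpow : (2 * Real.pi) ^ (-(3 * ((M : ℝ) + 1)) / 2) * (2 * Real.pi)⁻¹ ^ 3 =
      ((2 * Real.pi) ^ (3 / 2 : ℝ))⁻¹ *
        (2 * Real.pi) ^ (-(3 * (((M + 1 : ℕ) : ℝ) + 1)) / 2) := by
    rw [inv_pow, ← Real.rpow_natCast, ← Real.rpow_neg Real.two_pi_pos.le,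
      ← Real.rpow_neg Real.two_pi_pos.le, ← Real.rpow_add Real.two_pi_pos,
      ← Real.rpow_add Real.two_pi_pos]
    congr 1
    push_cast
    ring
  simp only [schwartzHat]
  rw [fourier_restrictSchwartz, integral_joinPair_smul _ _ (inv_pos.2 Real.two_pi_pos),
    integral_const_mul, ← mul_assoc, ← mul_assoc, ← Complex.ofReal_mul, ← Complex.ofReal_mul, hpow]

theorem inner_restrictSchwartz (f : 𝓢(Conf (M + 1), ℂ)) (ξ : L2 M)
    (hint : Integrable fun k => starRingEnd ℂ (hat (f.toLp 2 volume) k) *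
      hat ξ (pairMap (Fin.last M) k)) :
    inner ℂ ((restrictSchwartz f).toLp 2 volume : L2 M) ξ =
      ((((2 * Real.pi) ^ (3 / 2 : ℝ))⁻¹ : ℝ) : ℂ) *
        ∫ k, starRingEnd ℂ (hat (f.toLp 2 volume) k) * hat ξ (pairMap (Fin.last M) k) := by
  have hae : (fun k => starRingEnd ℂ (hat (f.toLp 2 volume) k) * hat ξ (pairMap (Fin.last M) k))
      =ᵐ[volume] fun k => starRingEnd ℂ (schwartzHat f k) * hat ξ (pairMap (Fin.last M) k) := by
    filter_upwards [hat_toLp f] with k hk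
    rw [hk]
  rw [inner_eq_integral_conj_hat_mul_hat, integral_congr_ae hae,
    ← (hasBochnerIntegral_integral_joinPair (Fin.last M) (hint.congr hae)).2, ← integral_const_mul]
  refine integral_congr_ae ?_
  filter_upwards [hat_toLp (restrictSchwartz f)] with w hw
  simp only [pairMap_joinPair]
  rw [hw, schwartzHat_restrictSchwartz, integral_mul_const, integral_conj, map_mul,
    Complex.conj_ofReal, mul_assoc]

theorem conj_mul_eq_weighted (s : ℝ) (X Y : Conf M → ℂ) (k : Conf M) :
    starRingEnd ℂ (X k) * Y k =
      starRingEnd ℂ ((((1 + ‖k‖ ^ 2) ^ (s / 2) : ℝ) : ℂ) * X k) *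
        ((((1 + ‖k‖ ^ 2) ^ (-s / 2) : ℝ) : ℂ) * Y k) := by
  have hcancel :
      (((1 + ‖k‖ ^ 2) ^ (s / 2) : ℝ) : ℂ) * (((1 + ‖k‖ ^ 2) ^ (-s / 2) : ℝ) : ℂ) = 1 := by
    rw [← Complex.ofReal_mul, ← Real.rpow_add (by positivity), neg_div, add_neg_cancel,
      Real.rpow_zero, Complex.ofReal_one]
  rw [map_mul, Complex.conj_ofReal]
  linear_combination -(starRingEnd ℂ (X k) * Y k) * hcancel

theorem MemFourierSobolev.integrable_conj_mul {s : ℝ} {X Y : Conf M → ℂ}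
    (hX : MemFourierSobolev s X) (hY : MemFourierSobolev (-s) Y) :
    Integrable fun k => starRingEnd ℂ (X k) * Y k := by
  simp only [conj_mul_eq_weighted s X Y]
  exact hX.memLp.star.integrable_mul hY.memLp

theorem enorm_integral_conj_hat_mul_le {s : ℝ} {Y : Conf M → ℂ} (hY : MemFourierSobolev (-s) Y)
    (u : L2 M) :
    ‖∫ k, starRingEnd ℂ (hat u k) * Y k‖ₑ ≤
      sobolevENorm s u * eLpNorm (fun k => (((1 + ‖k‖ ^ 2) ^ (-s / 2) : ℝ) : ℂ) * Y k) 2 := by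
  have hmeas : Measurable fun k : Conf M =>
      starRingEnd ℂ ((((1 + ‖k‖ ^ 2) ^ (s / 2) : ℝ) : ℂ) * hat u k) :=
    Complex.continuous_conj.measurable.comp (Measurable.mul (by fun_prop) (measurable_hat u))
  have hnorm : eLpNorm (fun k : Conf M =>
      starRingEnd ℂ ((((1 + ‖k‖ ^ 2) ^ (s / 2) : ℝ) : ℂ) * hat u k)) 2 volume =
        sobolevENorm s u :=
    eLpNorm_congr_norm_ae (Eventually.of_forall fun k => Complex.norm_conj _)
  have hholder := eLpNorm_smul_le_mul_eLpNorm (p := 2) (q := 2) (r := 1) hY.memLp.1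
    hmeas.aestronglyMeasurable
  rw [hnorm, eLpNorm_one_eq_lintegral_enorm] at hholder
  simp only [conj_mul_eq_weighted s (hat u) Y]
  exact (enorm_integral_le_lintegral_enorm _).trans hholder

theorem memFourierSobolev_hat_of_sobolevENorm_sub_lt_top {s : ℝ} {u v : L2 M}
    (hv : MemFourierSobolev s (hat v)) (huv : sobolevENorm s (u - v) < ⊤) :
    MemFourierSobolev s (hat u) := by
  have hweight : Measurable fun k : Conf M => (((1 + ‖k‖ ^ 2) ^ (s / 2) : ℝ) : ℂ) := by fun_prop
  have hsub : MemLp (fun k => (((1 + ‖k‖ ^ 2) ^ (s / 2) : ℝ) : ℂ) * hat (u - v) k) 2 :=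
    ⟨(hweight.mul (measurable_hat (u - v))).aestronglyMeasurable, huv⟩
  refine ⟨measurable_hat u, (hsub.add hv.memLp).ae_eq ?_⟩
  filter_upwards [hat_sub u v] with k hk
  rw [Pi.add_apply, hk]
  ring

theorem tendsto_integral_conj_hat_mul {s : ℝ} {u : ℕ → L2 M} {v : L2 M}
    (hv : MemFourierSobolev s (hat v))
    (hu : Tendsto (fun j => sobolevENorm s (u j - v)) atTop (𝓝 0)) {Y : Conf M → ℂ}
    (hY : MemFourierSobolev (-s) Y) :
    Tendsto (fun j => ∫ k, starRingEnd ℂ (hat (u j) k) * Y k) atTop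
      (𝓝 (∫ k, starRingEnd ℂ (hat v k) * Y k)) := by
  rw [← tendsto_sub_nhds_zero_iff, tendsto_zero_iff_enorm_tendsto_zero]
  have hbound : Tendsto (fun j => ‖∫ k, starRingEnd ℂ (hat (u j - v) k) * Y k‖ₑ) atTop (𝓝 0) := by
    have h := ENNReal.Tendsto.mul_const hu (Or.inr hY.memLp.2.ne)
    rw [zero_mul] at h
    exact tendsto_of_tendsto_of_tendsto_of_le_of_le tendsto_const_nhds h (fun _ => zero_le)
      fun j => enorm_integral_conj_hat_mul_le hY (u j - v)
  refine hbound.congr' ?_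
  filter_upwards [hu.eventually (gt_mem_nhds ENNReal.zero_lt_top)] with j hj
  have hint := (memFourierSobolev_hat_of_sobolevENorm_sub_lt_top hv hj).integrable_conj_mul hY
  rw [← integral_sub hint (hv.integrable_conj_mul hY)]
  congr 1
  refine integral_congr_ae ?_
  filter_upwards [hat_sub (u j) v] with k hk
  rw [hk, map_sub, sub_mul]

theorem greenSymbol_one_half (k : Conf M) : greenSymbol 1 (1 / 2) k = 2 * (1 + ‖k‖ ^ 2)⁻¹ := by
  rw [greenSymbol, norm_sq_conf k, ← inv_inv (2 : ℝ), ← mul_inv]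
  ring_nf

theorem MemFourierSobolev.comp_pairMap {X : Conf M → ℂ} (hX : MemFourierSobolev 1 X)
    (i : Fin (M + 1)) : MemFourierSobolev (-2) fun k => X (pairMap i k) := by
  have hmeas : Measurable fun k => X (pairMap i k) :=
    hX.measurable.comp (continuous_pairMap i).measurable
  have hweight : Measurable fun k : Conf (M + 1) =>
      (((1 + ‖k‖ ^ 2) ^ (-2 / 2 : ℝ) : ℝ) : ℂ) := by fun_prop
  refine ⟨hmeas, (memLp_greenSymbol_mul_chargeTerm one_pos one_half_pos hX i).mono
    (hweight.mul hmeas).aestronglyMeasurable (Eventually.of_forall fun k => ?_)⟩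
  have hpos : 0 < (1 + ‖k‖ ^ 2)⁻¹ := by positivity
  rw [norm_mul, norm_mul, norm_chargeTerm, greenSymbol_one_half, neg_div,
    div_self two_ne_zero, Real.rpow_neg_one, Complex.norm_real, Complex.norm_real,
    Real.norm_of_nonneg hpos.le, Real.norm_of_nonneg (by positivity)]
  exact mul_le_mul_of_nonneg_right (by linarith) (norm_nonneg _)

theorem tendsto_toLp_restrictSchwartz {f : ℕ → 𝓢(Conf (M + 1), ℂ)} {g : L2 M}
    (hf : Tendsto (fun j => eLpNorm (fun x : Conf M => f j (coincidence x) - g x) 2 volume) atTop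
      (𝓝 0)) :
    Tendsto (fun j => ((restrictSchwartz (f j)).toLp 2 volume : L2 M)) atTop (𝓝 g) := by
  rw [Lp.tendsto_Lp_iff_tendsto_eLpNorm']
  refine hf.congr fun j => eLpNorm_congr_ae ?_
  filter_upwards [SchwartzMap.coeFn_toLp (restrictSchwartz (f j)) 2 volume] with x hx
  rw [Pi.sub_apply, hx, restrictSchwartz_apply]

theorem IsTrace.inner_eq {φ : L2 (M + 1)} {g ξ : L2 M} (h : IsTrace φ g)
    (hφ : MemFourierSobolev 2 (hat φ)) (hξ : MemFourierSobolev 1 (hat ξ)) :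
    inner ℂ g ξ = ((((2 * Real.pi) ^ (3 / 2 : ℝ))⁻¹ : ℝ) : ℂ) *
      ∫ k, starRingEnd ℂ (hat φ k) * hat ξ (pairMap (Fin.last M) k) := by
  obtain ⟨f, hfφ, hfg⟩ := h
  have hY := hξ.comp_pairMap (Fin.last M)
  have hlim := (tendsto_integral_conj_hat_mul hφ hfφ hY).const_mul
    ((((2 * Real.pi) ^ (3 / 2 : ℝ))⁻¹ : ℝ) : ℂ)
  refine tendsto_nhds_unique
    ((tendsto_toLp_restrictSchwartz hfg).inner tendsto_const_nhds) (hlim.congr' ?_)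
  filter_upwards [hfφ.eventually (gt_mem_nhds ENNReal.zero_lt_top)] with j hj
  exact (inner_restrictSchwartz (f j) ξ
    ((memFourierSobolev_hat_of_sobolevENorm_sub_lt_top hφ hj).integrable_conj_mul hY)).symm

end Trace

section ChargeForm

variable {M n : ℕ} {m μ : ℝ}

/-- The pairing `∫ 𝒢 conj(Xᵢ) Xⱼ` of the `i`-th and `j`-th terms of `chargeSum X`. -/
def chargeOverlap (m μ : ℝ) (X : Conf M → ℂ) (i j : Fin (M + 1)) : ℂ :=
  ∫ k, (greenSymbol m μ k : ℂ) * (starRingEnd ℂ (chargeTerm X i k) * chargeTerm X j k)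

theorem AEAntisymm.chargeOverlap_perm {X : Conf M → ℂ} (hX : AEAntisymm X)
    (τ : Equiv.Perm (Fin (M + 1))) (i j : Fin (M + 1)) :
    chargeOverlap m μ X (τ i) (τ j) = chargeOverlap m μ X i j := by
  rw [chargeOverlap, chargeOverlap, ← (measurePreserving_permConf τ).integral_comp
    (measurableEmbedding_permConf τ) (fun k => (greenSymbol m μ k : ℂ) *
      (starRingEnd ℂ (chargeTerm X i k) * chargeTerm X j k))]
  refine integral_congr_ae ?_
  filter_upwards [hX.chargeTerm_permConf τ i, hX.chargeTerm_permConf τ j] with k hi hj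
  rw [hi, hj, greenSymbol_permConf, map_mul, map_intCast]
  linear_combination -(greenSymbol m μ k : ℂ) * starRingEnd ℂ (chargeTerm X (τ i) k) *
    chargeTerm X (τ j) k * sign_mul_sign τ

theorem AEAntisymm.sum_erase_chargeOverlap {X : Conf M → ℂ} (hX : AEAntisymm X)
    (i : Fin (M + 1)) :
    ∑ j ∈ Finset.univ.erase i, chargeOverlap m μ X i j =
      ∑ j : Fin M, chargeOverlap m μ X 0 j.succ := by
  have hswap (j : Fin (M + 1)) :
      chargeOverlap m μ X 0 j = chargeOverlap m μ X i (Equiv.swap 0 i j) := by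
    rw [← hX.chargeOverlap_perm (Equiv.swap 0 i) 0 j, Equiv.swap_apply_left]
  have hall : ∑ j, chargeOverlap m μ X 0 j = ∑ j, chargeOverlap m μ X i j := by
    simp only [hswap]
    exact Equiv.sum_comp (Equiv.swap 0 i) (chargeOverlap m μ X i)
  rw [Finset.sum_erase_eq_sub (Finset.mem_univ i), ← hall, Fin.sum_univ_succ, hswap 0,
    Equiv.swap_apply_left, add_sub_cancel_left]

theorem sum_conj_chargeTerm_mul (X : Conf M → ℂ) (k : Conf (M + 1)) :
    ∑ i, ∑ j ∈ Finset.univ.erase i, starRingEnd ℂ (chargeTerm X i k) * chargeTerm X j k =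
      (offSum X k : ℂ) := by
  have hdiag (i : Fin (M + 1)) : ∑ j ∈ Finset.univ.erase i,
      starRingEnd ℂ (chargeTerm X i k) * chargeTerm X j k =
        starRingEnd ℂ (chargeTerm X i k) * chargeSum X k - (‖chargeTerm X i k‖ ^ 2 : ℝ) := by
    rw [Finset.sum_erase_eq_sub (Finset.mem_univ i), ← Finset.mul_sum, Complex.conj_mul',
      Complex.ofReal_pow, chargeSum]
  rw [Finset.sum_congr rfl fun i _ => hdiag i, Finset.sum_sub_distrib, ← Finset.sum_mul, ← map_sum,
    ← chargeSum, Complex.conj_mul', ← Complex.ofReal_pow, norm_sq_chargeSum, Complex.ofReal_add,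
    Complex.ofReal_sum, add_sub_cancel_left]

theorem integral_greenSymbol_mul_offSum (hm : 0 < m) (hμ : 0 < μ) {X : Conf M → ℂ}
    (hX : MemFourierSobolev 1 X) (hXa : AEAntisymm X) :
    ((∫ k : Conf (M + 1), greenSymbol m μ k * offSum X k : ℝ) : ℂ) =
      (M + 1) * ∑ j : Fin M, chargeOverlap m μ X 0 j.succ := by
  have h := HasBochnerIntegral.sum Finset.univ fun (i : Fin (M + 1)) _ =>
    HasBochnerIntegral.sum (Finset.univ.erase i) fun j hj => HasBochnerIntegral.of_integrable
      (integrable_greenSymbol_mul_conj_chargeTerm_mul hm hμ hX (Finset.ne_of_mem_erase hj).symm)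
  rw [← integral_complex_ofReal]
  refine (integral_congr_ae (Eventually.of_forall fun k => ?_)).trans (h.2.trans ?_)
  · simp only [Complex.ofReal_mul, ← sum_conj_chargeTerm_mul, Finset.mul_sum]
  · refine (Finset.sum_congr rfl fun i _ => hXa.sum_erase_chargeOverlap i).trans ?_
    rw [Finset.sum_const, Finset.card_univ, Fintype.card_fin, nsmul_eq_mul, Nat.cast_succ]

theorem joinPair_zero (x : E3) (w : Conf M) :
    joinPair 0 x w = pt x (Fin.cons (w 0 - x) (rest w) : Fin (M + 1) → E3) := by
  rw [joinPair, Fin.insertNth_zero']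

theorem integral_joinPair_zero (G : Conf (M + 1) → ℂ) (w : Conf M) :
    ∫ s, G (pt (w 0 - s) (Fin.cons s (rest w) : Fin (M + 1) → E3)) =
      ∫ x, G (joinPair 0 x w) := by
  rw [← integral_sub_left_eq_self _ volume (w 0)]
  simp only [joinPair_zero, sub_sub_cancel]

/-- The off-diagonal part of `gammaHat`. -/
def offGamma (m μ : ℝ) (X : Conf (n + 1) → ℂ) (k : Conf (n + 1)) : ℂ :=
  ∑ j : Fin (n + 1), (-1) ^ (j : ℕ) *
    ∫ s : E3, (greenSymbol m μ (pt (k 0 - s) (Fin.cons s (rest k) : Fin (n + 2) → E3)) : ℂ) *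
      X (pt (k 0 + rest k j - s) (Fin.cons s (j.removeNth (rest k)) : Fin (n + 1) → E3))

theorem gammaHat_eq (ξ : L2 (n + 1)) (k : Conf (n + 1)) :
    gammaHat m μ ξ k = (diagSymbol m μ k : ℂ) * hat ξ k + offGamma m μ (hat ξ) k := rfl

theorem pairMap_succ_cons (w : Conf (n + 1)) (s : E3) (j : Fin (n + 1)) :
    pairMap j.succ (pt (w 0 - s) (Fin.cons s (rest w) : Fin (n + 2) → E3)) =
      pt (w 0 + rest w j - s) (Fin.cons s (j.removeNth (rest w)) : Fin (n + 1) → E3) := by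
  rw [pairMap, pt_zero, rest_pt, Fin.cons_succ, sub_add_eq_add_sub]
  congr 1
  refine funext (Fin.cases ?_ fun l => ?_)
  · simp [Fin.removeNth]
  · simp [Fin.removeNth, Fin.succ_succAbove_succ]

theorem pairMap_zero_cons (w : Conf M) (s : E3) :
    pairMap 0 (pt (w 0 - s) (Fin.cons s (rest w) : Fin (M + 1) → E3)) = w := by
  rw [pairMap, pt_zero, rest_pt, Fin.cons_zero, sub_add_cancel]
  exact pt_rest w

theorem conj_mul_offGamma (X : Conf (n + 1) → ℂ) (w : Conf (n + 1)) :
    starRingEnd ℂ (X w) * offGamma m μ X w = ∑ j : Fin (n + 1), ∫ x : E3,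
      -((greenSymbol m μ (joinPair 0 x w) : ℂ) *
        (starRingEnd ℂ (chargeTerm X 0 (joinPair 0 x w)) *
          chargeTerm X j.succ (joinPair 0 x w))) := by
  rw [offGamma, Finset.mul_sum]
  refine Finset.sum_congr rfl fun j _ => ?_
  rw [← integral_joinPair_zero (fun k => -((greenSymbol m μ k : ℂ) *
    (starRingEnd ℂ (chargeTerm X 0 k) * chargeTerm X j.succ k))), ← mul_assoc,
    ← integral_const_mul]
  refine integral_congr_ae (Eventually.of_forall fun s => ?_)
  simp only [chargeTerm, pairMap_zero_cons, pairMap_succ_cons, Fin.val_succ, Fin.val_zero, pow_zero,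
    one_mul, pow_succ]
  ring

theorem hasBochnerIntegral_conj_mul_offGamma (hm : 0 < m) (hμ : 0 < μ) {X : Conf (n + 1) → ℂ}
    (hX : MemFourierSobolev 1 X) :
    HasBochnerIntegral (fun w => starRingEnd ℂ (X w) * offGamma m μ X w) volume
      (-∑ j : Fin (n + 1), chargeOverlap m μ X 0 j.succ) := by
  simp only [conj_mul_offGamma, chargeOverlap, ← Finset.sum_neg_distrib, ← integral_neg]
  exact HasBochnerIntegral.sum Finset.univ fun j _ => hasBochnerIntegral_integral_joinPair 0
    (integrable_greenSymbol_mul_conj_chargeTerm_mul hm hμ hX (Fin.succ_ne_zero j).symm).neg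

theorem diagSymbol_eq (hm : 0 < m) (w : Conf M) :
    diagSymbol m μ w = 2 * Real.pi ^ 2 * pairWidth m μ w / pairFactor m := by
  have hfactor := pairFactor_pos hm
  have hinv : 2 * m / (m + 1) = (pairFactor m)⁻¹ := by rw [pairFactor, inv_div]
  have hsqrt : √(pairRest m μ w) = √(pairFactor m) * pairWidth m μ w := by
    rw [pairWidth, ← Real.sqrt_mul hfactor.le, mul_div_cancel₀ _ hfactor.ne']
  have hpow : (pairFactor m)⁻¹ ^ (3 / 2 : ℝ) = (pairFactor m)⁻¹ * (√(pairFactor m))⁻¹ := by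
    rw [show (3 / 2 : ℝ) = 1 + 1 / 2 by norm_num, Real.rpow_add (inv_pos.2 hfactor),
      Real.rpow_one, ← Real.sqrt_eq_rpow, Real.sqrt_inv]
  have hdiag : diagSymbol m μ w =
      2 * Real.pi ^ 2 * (2 * m / (m + 1)) ^ (3 / 2 : ℝ) * √(pairRest m μ w) := rfl
  have hne : √(pairFactor m) ≠ 0 := (Real.sqrt_pos.2 hfactor).ne'
  rw [hdiag, hinv, hsqrt, hpow]
  field_simp

theorem integrable_norm_sq_mul_diagSymbol (hm : 0 < m) (hμ : 0 < μ) {X : Conf M → ℂ}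
    (hX : MemFourierSobolev 1 X) : Integrable fun w => ‖X w‖ ^ 2 * diagSymbol m μ w := by
  obtain ⟨C, hC⟩ := exists_pairWidth_le (M := M) hm hμ
  have hfactor := pairFactor_pos hm
  simp only [diagSymbol_eq hm]
  refine (hX.integrable_one_add_norm_sq_mul.const_mul (2 * Real.pi ^ 2 * C / pairFactor m)).mono' ?_
    (Eventually.of_forall fun w => ?_)
  · exact ((hX.measurable.norm.pow_const 2).mul ((continuous_pairWidth.measurable.const_mul
      (2 * Real.pi ^ 2)).div_const _)).aestronglyMeasurable
  · have hwidth := pairWidth_pos hm hμ w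
    rw [Real.norm_of_nonneg (by positivity)]
    calc ‖X w‖ ^ 2 * (2 * Real.pi ^ 2 * pairWidth m μ w / pairFactor m)
        ≤ ‖X w‖ ^ 2 * (2 * Real.pi ^ 2 * (C * (1 + ‖w‖ ^ 2)) / pairFactor m) := by
          gcongr
          exact hC w
      _ = _ := by ring

theorem integral_conj_mul_gammaHat (hm : 0 < m) (hμ : 0 < μ) {ξ : L2 (n + 1)}
    (hξ : MemFourierSobolev 1 (hat ξ)) :
    ∫ w, starRingEnd ℂ (hat ξ w) * gammaHat m μ ξ w =
      (∫ w, ‖hat ξ w‖ ^ 2 * diagSymbol m μ w : ℝ) -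
        ∑ j : Fin (n + 1), chargeOverlap m μ (hat ξ) 0 j.succ := by
  have hdiag : HasBochnerIntegral (fun w => ((‖hat ξ w‖ ^ 2 * diagSymbol m μ w : ℝ) : ℂ)) volume
      ((∫ w, ‖hat ξ w‖ ^ 2 * diagSymbol m μ w : ℝ) : ℂ) :=
    ⟨(integrable_norm_sq_mul_diagSymbol hm hμ hξ).ofReal, integral_complex_ofReal⟩
  rw [sub_eq_add_neg, ← (hdiag.add (hasBochnerIntegral_conj_mul_offGamma hm hμ hξ)).2]
  refine integral_congr_ae (Eventually.of_forall fun w => ?_)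
  simp only [gammaHat_eq]
  rw [Complex.ofReal_mul, Complex.ofReal_pow, ← Complex.conj_mul']
  ring

theorem integral_conj_gammaHat_mul (hm : 0 < m) (hμ : 0 < μ) {ξ : L2 (n + 1)}
    (hξ : MemFourierSobolev 1 (hat ξ)) (hξa : AEAntisymm (hat ξ)) :
    ((n : ℂ) + 2) * ∫ w, starRingEnd ℂ (gammaHat m μ ξ w) * hat ξ w =
      (((n + 2) * (∫ w, ‖hat ξ w‖ ^ 2 * diagSymbol m μ w) -
        ∫ k : Conf (n + 2), greenSymbol m μ k * offSum (hat ξ) k : ℝ) : ℂ) := by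
  have hconj : starRingEnd ℂ (∫ w, starRingEnd ℂ (gammaHat m μ ξ w) * hat ξ w) =
      ∫ w, starRingEnd ℂ (hat ξ w) * gammaHat m μ ξ w := by
    rw [← integral_conj]
    simp only [map_mul, Complex.conj_conj, mul_comm]
  apply (starRingEnd ℂ).injective
  rw [map_mul, hconj, integral_conj_mul_gammaHat hm hμ hξ, Complex.conj_ofReal, map_add,
    Complex.conj_natCast, Complex.conj_ofNat, Complex.ofReal_sub,
    integral_greenSymbol_mul_offSum hm hμ hξ hξa]
  push_cast
  ring

end ChargeForm

section Energy

variable {M : ℕ} {m μ : ℝ} {X : Conf M → ℂ} {Φ Ψ : Conf (M + 1) → ℂ}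

theorem norm_sq_add_greenSymbol_mul_chargeSum (X : Conf M → ℂ) (Φ : Conf (M + 1) → ℂ)
    (k : Conf (M + 1)) :
    ‖Φ k + (greenSymbol m μ k : ℂ) * chargeSum X k‖ ^ 2 =
      ‖Φ k‖ ^ 2 + 2 * (greenSymbol m μ k * (starRingEnd ℂ (Φ k) * chargeSum X k).re) +
        greenSymbol m μ k ^ 2 * (∑ i, ‖chargeTerm X i k‖ ^ 2 + offSum X k) := by
  rw [← norm_sq_chargeSum, ← Complex.normSq_eq_norm_sq, ← Complex.normSq_eq_norm_sq,
    ← Complex.normSq_eq_norm_sq, Complex.normSq_apply, Complex.normSq_apply, Complex.normSq_apply]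
  simp only [Complex.add_re, Complex.add_im, Complex.mul_re, Complex.mul_im, Complex.ofReal_re,
    Complex.ofReal_im, Complex.conj_re, Complex.conj_im]
  ring

theorem greenSymbol_mul_kinetic_add (hm : 0 < m) (hμ : 0 < μ) (k : Conf M) :
    greenSymbol m μ k * (kinetic m k + μ) = 1 := by
  rw [greenSymbol_eq_kinetic]
  exact inv_mul_cancel₀ (add_pos_of_nonneg_of_pos (kinetic_nonneg hm k) hμ).ne'

theorem MemFourierSobolev.memLp_mul_of_abs_le_kinetic (hm : 0 < m) (hμ : 0 < μ) {Φ : Conf M → ℂ}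
    (hΦ : MemFourierSobolev 2 Φ) {v : Conf M → ℝ} (hv : Measurable v) {C : ℝ}
    (hC : ∀ k, |v k| ≤ C * (kinetic m k + μ)) : MemLp (fun k => (v k : ℂ) * Φ k) 2 := by
  have hC₀ : 0 ≤ C := nonneg_of_mul_nonneg_left ((abs_nonneg _).trans (hC 0))
    (add_pos_of_nonneg_of_pos (kinetic_nonneg hm 0) hμ)
  refine hΦ.memLp_mul hv (C := C * (1 / (2 * m) + 1 / 2 + μ)) fun k => (hC k).trans ?_
  rw [div_self two_ne_zero, Real.rpow_one, mul_assoc]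
  exact mul_le_mul_of_nonneg_left (kinetic_add_le hm hμ k) hC₀

theorem integrable_mul_re_conj_mul {α : Type*} [MeasurableSpace α] {ν : Measure α} {v : α → ℝ}
    {f g : α → ℂ} (hf : MemLp (fun x => (v x : ℂ) * f x) 2 ν) (hg : MemLp g 2 ν) :
    Integrable (fun x => v x * (starRingEnd ℂ (f x) * g x).re) ν := by
  refine (hf.star.integrable_mul hg).re.congr (Eventually.of_forall fun x => ?_)
  simp [mul_assoc]

theorem MemFourierSobolev.integrable_mul_norm_sq_of_abs_le_kinetic (hm : 0 < m) (hμ : 0 < μ)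
    {Φ : Conf M → ℂ} (hΦ : MemFourierSobolev 2 Φ) {v : Conf M → ℝ} (hv : Measurable v) {C : ℝ}
    (hC : ∀ k, |v k| ≤ C * (kinetic m k + μ)) : Integrable fun k => v k * ‖Φ k‖ ^ 2 := by
  have hΦ₂ : MemLp Φ 2 := (memLp_two_iff_integrable_sq_norm hΦ.measurable.aestronglyMeasurable).2
    (hΦ.integrable_norm_sq zero_le_two)
  have h := integrable_mul_re_conj_mul (hΦ.memLp_mul_of_abs_le_kinetic hm hμ hv hC) hΦ₂
  simpa only [Complex.conj_mul', ← Complex.ofReal_pow, Complex.ofReal_re] using h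

theorem integrable_mul_norm_sq_sub_diagonal (hm : 0 < m) (hμ : 0 < μ) (hX : MemFourierSobolev 1 X)
    (hΦ : MemFourierSobolev 2 Φ)
    (hΨ : Ψ =ᵐ[volume] fun k => Φ k + (greenSymbol m μ k : ℂ) * chargeSum X k)
    {v : Conf (M + 1) → ℝ} (hv : Measurable v) {C : ℝ}
    (hC : ∀ k, |v k| ≤ C * (kinetic m k + μ)) :
    Integrable fun k => v k * (‖Ψ k‖ ^ 2 -
      ∑ i, greenSymbol m μ k ^ 2 * ‖chargeTerm X i k‖ ^ 2) := by
  have hregular := hΦ.integrable_mul_norm_sq_of_abs_le_kinetic hm hμ hv hC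
  have hcross := (integrable_mul_re_conj_mul (hΦ.memLp_mul_of_abs_le_kinetic hm hμ hv hC)
    (memLp_greenSymbol_mul_chargeSum hm hμ hX)).const_mul 2
  have hoff : Integrable fun k => (v k * greenSymbol m μ k) * (greenSymbol m μ k * offSum X k) := by
    refine (integrable_greenSymbol_mul_offSum hm hμ hX).bdd_mul
      (hv.mul measurable_greenSymbol).aestronglyMeasurable (c := C)
      (Eventually.of_forall fun k => ?_)
    rw [norm_mul, Real.norm_of_nonneg (greenSymbol_pos hm hμ k).le, Real.norm_eq_abs,
      greenSymbol_eq_kinetic, ← div_eq_mul_inv,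
      div_le_iff₀ (add_pos_of_nonneg_of_pos (kinetic_nonneg hm k) hμ)]
    exact hC k
  refine ((hregular.add hcross).add hoff).congr ?_
  filter_upwards [hΨ] with k hk
  rw [hk, norm_sq_add_greenSymbol_mul_chargeSum, ← Finset.mul_sum, Pi.add_apply, Pi.add_apply,
    mul_left_comm (starRingEnd ℂ (Φ k)), Complex.re_ofReal_mul]
  ring

theorem norm_zero_sq_le_kinetic (hm : 0 < m) (hμ : 0 < μ) (k : Conf M) :
    ‖k 0‖ ^ 2 ≤ 2 * m * (kinetic m k + μ) := by
  have hrest : 0 ≤ 2 * m * (1 / 2 * ∑ i, ‖rest k i‖ ^ 2 + μ) := by positivity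
  calc ‖k 0‖ ^ 2 = 2 * m * (1 / (2 * m) * ‖k 0‖ ^ 2) := by field_simp
    _ ≤ 2 * m * (1 / (2 * m) * ‖k 0‖ ^ 2) + 2 * m * (1 / 2 * ∑ i, ‖rest k i‖ ^ 2 + μ) :=
        le_add_of_nonneg_right hrest
    _ = 2 * m * (kinetic m k + μ) := by rw [kinetic]; ring

theorem norm_rest_sq_le_kinetic (hm : 0 < m) (hμ : 0 < μ) (k : Conf M) (l : Fin M) :
    ‖rest k l‖ ^ 2 ≤ 2 * (kinetic m k + μ) := by
  have hsum : ‖rest k l‖ ^ 2 ≤ ∑ i, ‖rest k i‖ ^ 2 :=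
    Finset.single_le_sum (fun i _ => sq_nonneg ‖rest k i‖) (Finset.mem_univ l)
  have hzero : 0 ≤ 1 / (2 * m) * ‖k 0‖ ^ 2 := by positivity
  rw [kinetic]
  linarith

theorem integrable_regularUp (hm : 0 < m) (hμ : 0 < μ) (hX : MemFourierSobolev 1 X)
    (hΦ : MemFourierSobolev 2 Φ)
    (hΨ : Ψ =ᵐ[volume] fun k => Φ k + (greenSymbol m μ k : ℂ) * chargeSum X k) :
    Integrable (regularUp m μ X Ψ) :=
  integrable_mul_norm_sq_sub_diagonal hm hμ hX hΦ hΨ (v := fun k => ‖k 0‖ ^ 2) (by fun_prop)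
    fun k => (abs_of_nonneg (sq_nonneg _)).trans_le (norm_zero_sq_le_kinetic hm hμ k)

theorem integrable_regularDown (hm : 0 < m) (hμ : 0 < μ) (hX : MemFourierSobolev 1 X)
    (hΦ : MemFourierSobolev 2 Φ)
    (hΨ : Ψ =ᵐ[volume] fun k => Φ k + (greenSymbol m μ k : ℂ) * chargeSum X k)
    (l : Fin (M + 1)) : Integrable (regularDown m μ X Ψ l) := by
  have hall := integrable_mul_norm_sq_sub_diagonal hm hμ hX hΦ hΨ (v := fun k => ‖rest k l‖ ^ 2)
    (by unfold rest; fun_prop)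
    fun k => (abs_of_nonneg (sq_nonneg _)).trans_le (norm_rest_sq_le_kinetic hm hμ k l)
  have hother := integrable_finsetSum (Finset.univ.erase l) fun i hi =>
    integrable_norm_rest_sq_mul_greenSymbol_sq_mul_norm_sq_chargeTerm hm hμ hX
      (Finset.ne_of_mem_erase hi).symm
  refine (hall.add hother).congr (Eventually.of_forall fun k => ?_)
  simp only [Pi.add_apply, regularDown, mul_assoc, ← Finset.mul_sum]
  rw [← Finset.add_sum_erase Finset.univ (fun i => ‖chargeTerm X i k‖ ^ 2) (Finset.mem_univ l)]
  ring

theorem integrable_energy (hm : 0 < m) (hμ : 0 < μ) {Φ Ψ : Conf M → ℂ}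
    (hΦ : MemFourierSobolev 2 Φ) (hΨ : MemLp Ψ 2) :
    Integrable fun k => (kinetic m k + μ) * ‖Φ k‖ ^ 2 - μ * ‖Ψ k‖ ^ 2 :=
  (hΦ.integrable_mul_norm_sq_of_abs_le_kinetic hm hμ (by unfold kinetic rest; fun_prop) (C := 1)
    fun k => by
      rw [one_mul, abs_of_pos (add_pos_of_nonneg_of_pos (kinetic_nonneg hm k) hμ)]).sub
    (((memLp_two_iff_integrable_sq_norm hΨ.1).1 hΨ).const_mul μ)

/-- The kinetic energy of the fermions that do not belong to the pair, shifted by `μ`. -/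
def spectatorEnergy (μ : ℝ) (w : Conf M) : ℝ := 1 / 2 * ∑ j, ‖rest w j‖ ^ 2 + μ

theorem spectatorEnergy_pairMap (i : Fin (M + 1)) (k : Conf (M + 1)) :
    spectatorEnergy μ (pairMap i k) =
      1 / 2 * ∑ l, ‖rest k l‖ ^ 2 + μ - 1 / 2 * ‖rest k i‖ ^ 2 := by
  rw [spectatorEnergy, Fin.sum_univ_succAbove (fun l => ‖rest k l‖ ^ 2) i]
  simp only [rest_pairMap]
  ring

theorem sum_spectatorEnergy_pairMap_mul (k : Conf (M + 1)) (a : Fin (M + 1) → ℝ) :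
    ∑ i, spectatorEnergy μ (pairMap i k) * a i =
      (1 / 2 * ∑ l, ‖rest k l‖ ^ 2 + μ) * ∑ i, a i - 1 / 2 * ∑ i, ‖rest k i‖ ^ 2 * a i := by
  simp only [spectatorEnergy_pairMap, sub_mul, Finset.sum_sub_distrib, ← Finset.mul_sum, mul_assoc]

theorem sum_regularDown (X : Conf M → ℂ) (Ψ : Conf (M + 1) → ℂ) (k : Conf (M + 1)) :
    ∑ l, regularDown m μ X Ψ l k = (∑ l, ‖rest k l‖ ^ 2) * ‖Ψ k‖ ^ 2 -
      ∑ l, ‖rest k l‖ ^ 2 * (greenSymbol m μ k ^ 2 * ‖chargeTerm X l k‖ ^ 2) := by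
  simp only [regularDown, mul_sub, Finset.sum_sub_distrib, Finset.sum_mul]

theorem regularUp_add_sum_regularDown (hm : 0 < m) (hμ : 0 < μ) {k : Conf (M + 1)}
    (hΨ : Ψ k = Φ k + (greenSymbol m μ k : ℂ) * chargeSum X k) :
    1 / (2 * m) * regularUp m μ X Ψ k + 1 / 2 * ∑ l, regularDown m μ X Ψ l k =
      (kinetic m k + μ) * ‖Φ k‖ ^ 2 - μ * ‖Ψ k‖ ^ 2 +
        2 * (starRingEnd ℂ (Φ k) * chargeSum X k).re + greenSymbol m μ k * offSum X k +
        ∑ i, spectatorEnergy μ (pairMap i k) * greenSymbol m μ k ^ 2 * ‖chargeTerm X i k‖ ^ 2 := by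
  have hnorm := norm_sq_add_greenSymbol_mul_chargeSum (m := m) (μ := μ) X Φ k
  have hgreen := greenSymbol_mul_kinetic_add hm hμ k
  rw [← hΨ] at hnorm
  simp only [mul_assoc (spectatorEnergy _ _)]
  rw [sum_spectatorEnergy_pairMap_mul, sum_regularDown, regularUp]
  simp only [← Finset.mul_sum] at hnorm ⊢
  rw [kinetic] at hgreen ⊢
  generalize (1 / (2 * m)) = c at *
  linear_combination (c * ‖k 0‖ ^ 2 + 1 / 2 * ∑ i, ‖rest k i‖ ^ 2 + μ) * hnorm +
    (2 * (starRingEnd ℂ (Φ k) * chargeSum X k).re + greenSymbol m μ k * offSum X k) * hgreen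

theorem integral_conj_mul_chargeTerm (hX : AEAntisymm X) (hΦ : AEAntisymm Φ) (i : Fin (M + 1)) :
    ∫ k, starRingEnd ℂ (Φ k) * chargeTerm X i k =
      (-1) ^ M * ∫ k, starRingEnd ℂ (Φ k) * X (pairMap (Fin.last M) k) := by
  let τ := Equiv.swap i (Fin.last M)
  calc ∫ k, starRingEnd ℂ (Φ k) * chargeTerm X i k
      = ∫ k, starRingEnd ℂ (Φ (permConf τ k)) * chargeTerm X (Fin.last M) (permConf τ k) := by
        refine integral_congr_ae ?_
        filter_upwards [hX.chargeTerm_permConf τ (Fin.last M), hΦ τ] with k hXk hΦk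
        rw [hXk, hΦk, Equiv.swap_apply_right, map_mul, map_intCast]
        linear_combination -starRingEnd ℂ (Φ k) * chargeTerm X i k * sign_mul_sign τ
    _ = ∫ k, starRingEnd ℂ (Φ k) * chargeTerm X (Fin.last M) k :=
        (measurePreserving_permConf τ).integral_comp (measurableEmbedding_permConf τ)
          fun k => starRingEnd ℂ (Φ k) * chargeTerm X (Fin.last M) k
    _ = (-1) ^ M * ∫ k, starRingEnd ℂ (Φ k) * X (pairMap (Fin.last M) k) := by
        rw [← integral_const_mul]
        simp only [chargeTerm, Fin.val_last, mul_left_comm]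

theorem integrable_conj_mul_chargeTerm (hX : MemFourierSobolev 1 X) (hΦ : MemFourierSobolev 2 Φ)
    (i : Fin (M + 1)) : Integrable fun k => starRingEnd ℂ (Φ k) * chargeTerm X i k := by
  have h := (hΦ.integrable_conj_mul (hX.comp_pairMap i)).const_mul ((-1) ^ (i : ℕ))
  simpa only [chargeTerm, mul_left_comm, Function.comp_apply] using h

theorem integrable_conj_mul_chargeSum (hX : MemFourierSobolev 1 X) (hΦ : MemFourierSobolev 2 Φ) :
    Integrable fun k => starRingEnd ℂ (Φ k) * chargeSum X k := by
  simp only [chargeSum, Finset.mul_sum]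
  exact integrable_finsetSum _ fun i _ => integrable_conj_mul_chargeTerm hX hΦ i

theorem integral_conj_mul_chargeSum (hX : MemFourierSobolev 1 X) (hXa : AEAntisymm X)
    (hΦ : MemFourierSobolev 2 Φ) (hΦa : AEAntisymm Φ) :
    ∫ k, starRingEnd ℂ (Φ k) * chargeSum X k =
      (M + 1) * ((-1) ^ M * ∫ k, starRingEnd ℂ (Φ k) * X (pairMap (Fin.last M) k)) := by
  simp only [chargeSum, Finset.mul_sum]
  rw [integral_finsetSum _ fun i _ => integrable_conj_mul_chargeTerm hX hΦ i]
  simp only [integral_conj_mul_chargeTerm hXa hΦa, Finset.sum_const, Finset.card_univ,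
    Fintype.card_fin, nsmul_eq_mul, Nat.cast_add_one]

theorem hasBochnerIntegral_spectatorEnergy (hm : 0 < m) (hμ : 0 < μ) (hX : MemFourierSobolev 1 X)
    (i : Fin (M + 1)) :
    HasBochnerIntegral (fun k : Conf (M + 1) =>
      spectatorEnergy μ (pairMap i k) * greenSymbol m μ k ^ 2 * ‖chargeTerm X i k‖ ^ 2) volume
      (∫ w, ‖X w‖ ^ 2 *
        (spectatorEnergy μ w * ((pairFactor m ^ 2)⁻¹ * (Real.pi ^ 2 / pairWidth m μ w)))) := by
  refine hasBochnerIntegral_greenSymbol_sq_mul_norm_sq_chargeTerm hm hμ hX (V := spectatorEnergy μ)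
    (by unfold spectatorEnergy rest; fun_prop) (C := 1 + μ) (fun w => ?_) i
  have hrest : 0 ≤ ∑ j, ‖rest w j‖ ^ 2 := Finset.sum_nonneg fun j _ => sq_nonneg _
  rw [spectatorEnergy, abs_of_nonneg (by linarith), norm_sq_conf]
  nlinarith [sq_nonneg ‖w 0‖, mul_nonneg hμ.le hrest, mul_nonneg hμ.le (sq_nonneg ‖w 0‖)]

theorem integral_regularUp_add_integral_regularDown (hm : 0 < m) (hμ : 0 < μ)
    (hX : MemFourierSobolev 1 X) (hXa : AEAntisymm X) (hΦ : MemFourierSobolev 2 Φ)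
    (hΨ₂ : MemLp Ψ 2) (hΨa : AEAntisymm Ψ)
    (hΨ : Ψ =ᵐ[volume] fun k => Φ k + (greenSymbol m μ k : ℂ) * chargeSum X k) :
    1 / (2 * m) * (∫ k, regularUp m μ X Ψ k) +
        1 / 2 * ((M + 1) * ∫ k, regularDown m μ X Ψ 0 k) =
      (∫ k, ((kinetic m k + μ) * ‖Φ k‖ ^ 2 - μ * ‖Ψ k‖ ^ 2)) +
        2 * (∫ k, starRingEnd ℂ (Φ k) * chargeSum X k).re +
        (∫ k, greenSymbol m μ k * offSum X k) +
        (M + 1) * ∫ w, ‖X w‖ ^ 2 *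
          (spectatorEnergy μ w * ((pairFactor m ^ 2)⁻¹ * (Real.pi ^ 2 / pairWidth m μ w))) := by
  have hregular := ((HasBochnerIntegral.of_integrable
      (integrable_regularUp hm hμ hX hΦ hΨ)).const_mul (1 / (2 * m))).add
    ((HasBochnerIntegral.sum Finset.univ fun l _ => HasBochnerIntegral.of_integrable
      (integrable_regularDown hm hμ hX hΦ hΨ l)).const_mul (1 / 2))
  have hcross := integrable_conj_mul_chargeSum hX hΦ
  have henergy := (((HasBochnerIntegral.of_integrable
      (integrable_energy hm hμ hΦ hΨ₂)).add
      ((HasBochnerIntegral.of_integrable hcross.re).const_mul 2)).add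
      (HasBochnerIntegral.of_integrable (integrable_greenSymbol_mul_offSum hm hμ hX))).add
    (HasBochnerIntegral.sum Finset.univ fun i _ => hasBochnerIntegral_spectatorEnergy hm hμ hX i)
  have htotal := (hregular.congr (hΨ.mono fun k hk =>
    regularUp_add_sum_regularDown hm hμ hk)).2.symm.trans henergy.2
  rw [integral_re hcross] at htotal
  simpa only [integral_regularDown_eq hXa hΨa, Finset.sum_const, Finset.card_univ,
    Fintype.card_fin, nsmul_eq_mul, Nat.cast_add_one, RCLike.re_eq_complex_re] using htotal

end Energy

section MomentumTails

variable {M : ℕ} {m μ : ℝ} {X : Conf M → ℂ} {Φ Ψ : Conf (M + 1) → ℂ} {ψ : L2 (M + 1)} {ξ : L2 M}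

theorem contact_eq (m : ℝ) (ξ : L2 M) :
    contact m ξ = (M + 1) * ((pairFactor m ^ 2)⁻¹ * ∫ w, ‖hat ξ w‖ ^ 2) := by
  rw [contact, integral_norm_sq_hat, pairFactor, ← inv_pow, inv_div]
  ring

theorem smul_integral_norm_sq_smul_eq_momentumUp (m : ℝ) (ξ : L2 M) :
    (2 * (m / (m + 1))) • ∫ w, ‖hat ξ w‖ ^ 2 • w 0 =
      (∫ w, ‖hat ξ w‖ ^ 2) • momentumUp m ξ := by
  rw [integral_norm_sq_hat]
  rcases eq_or_ne ξ 0 with rfl | hξ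
  · have hhat : hat (0 : L2 M) =ᵐ[volume] fun _ => 0 := by
      simpa only [zero_smul, zero_mul] using hat_smul (0 : ℂ) (0 : L2 M)
    have hmoment : ∫ w : Conf M, ‖hat (0 : L2 M) w‖ ^ 2 • w 0 = 0 :=
      integral_eq_zero_of_ae (hhat.mono fun w hw => by simp [hw])
    rw [hmoment, norm_zero, smul_zero, zero_pow two_ne_zero, zero_smul]
  · have hnorm : ‖ξ‖ ^ 2 ≠ 0 := pow_ne_zero 2 (norm_ne_zero_iff.2 hξ)
    rw [momentumUp, smul_smul, mul_left_comm, mul_inv_cancel₀ hnorm, mul_one, mul_div_assoc]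

theorem smul_integral_norm_sq_smul_eq_momentumDown (hm : 0 < m) (ξ : L2 M) :
    (2 * (1 / (m + 1))) • ∫ w, ‖hat ξ w‖ ^ 2 • w 0 =
      (∫ w, ‖hat ξ w‖ ^ 2) • momentumDown m ξ := by
  rw [momentumDown, smul_comm, ← smul_integral_norm_sq_smul_eq_momentumUp, smul_smul]
  congr 1
  field_simp

theorem hasBochnerIntegral_tailUp (hm : 0 < m) (hμ : 0 < μ) (hξ : MemFourierSobolev 1 (hat ξ))
    (hψ : Integrable (regularUp m μ (hat ξ) (hat ψ))) :
    HasBochnerIntegral (tailUp m ψ ξ) volume ((∫ k, regularUp m μ (hat ξ) (hat ψ) k) +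
      (M + 1) * ((pairFactor m ^ 2)⁻¹ *
        ∫ w, ‖hat ξ w‖ ^ 2 * tailWeight m μ (m / (m + 1)) w)) := by
  have hregular := ((HasBochnerIntegral.of_integrable hψ).comp measurePreserving_pt
    measurableEmbedding_pt).marginal
  have hdiagonal := ((hasBochnerIntegral_diagonal_tail hm hμ hξ
    (smul_integral_norm_sq_smul_eq_momentumUp m ξ)).const_mul (pairFactor m ^ 2)⁻¹).const_mul
      ((M : ℝ) + 1)
  refine (hregular.add hdiagonal).congr ?_
  filter_upwards [norm_sq_mul_integral_norm_sq_pt_eq hm hμ hξ hψ] with x hx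
  rw [tailUp, densityUp, hx, contact_eq, div_eq_mul_inv]
  ring

theorem hasBochnerIntegral_tailDown (hm : 0 < m) (hμ : 0 < μ) (hξ : MemFourierSobolev 1 (hat ξ))
    (hψ : Integrable (regularDown m μ (hat ξ) (hat ψ) 0)) :
    HasBochnerIntegral (tailDown m ψ ξ) volume
      ((M + 1) * ((∫ k, regularDown m μ (hat ξ) (hat ψ) 0 k) + (pairFactor m ^ 2)⁻¹ *
        ∫ w, ‖hat ξ w‖ ^ 2 * tailWeight m μ (1 / (m + 1)) w)) := by
  have hregular := ((HasBochnerIntegral.of_integrable hψ).comp measurePreserving_downPt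
    measurableEmbedding_downPt).marginal
  have hdiagonal := (hasBochnerIntegral_diagonal_tail hm hμ hξ
    (smul_integral_norm_sq_smul_eq_momentumDown hm ξ)).const_mul (pairFactor m ^ 2)⁻¹
  refine ((hregular.add hdiagonal).const_mul ((M : ℝ) + 1)).congr ?_
  filter_upwards [norm_sq_mul_integral_norm_sq_downPt_eq hm hμ hξ hψ] with x hx
  have hdensity : densityDown ψ x = (M + 1) * ∫ q, ‖hat ψ (downPt x q)‖ ^ 2 := rfl
  rw [tailDown, hdensity, mul_left_comm, hx, contact_eq, div_eq_mul_inv]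
  ring

theorem tailWeight_add_spectatorEnergy (hm : 0 < m) (hμ : 0 < μ) (w : Conf M) :
    (pairFactor m ^ 2)⁻¹ * (1 / (2 * m) * tailWeight m μ (m / (m + 1)) w +
        1 / 2 * tailWeight m μ (1 / (m + 1)) w) +
      spectatorEnergy μ w * ((pairFactor m ^ 2)⁻¹ * (Real.pi ^ 2 / pairWidth m μ w)) =
      -diagSymbol m μ w := by
  have hwidth := pairWidth_pos hm hμ w
  have hspectator : spectatorEnergy μ w =
      pairFactor m * pairWidth m μ w ^ 2 - ‖w 0‖ ^ 2 / (2 * (m + 1)) := by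
    rw [pairFactor_mul_pairWidth_sq hm hμ, pairRest, spectatorEnergy]
    ring
  rw [diagSymbol_eq hm, hspectator, tailWeight, tailWeight, norm_smul, norm_smul, mul_pow, mul_pow,
    Real.norm_eq_abs, Real.norm_eq_abs, sq_abs, sq_abs, pairFactor]
  field_simp
  ring

theorem integral_tailWeight_add_spectatorEnergy (hm : 0 < m) (hμ : 0 < μ)
    (hX : MemFourierSobolev 1 X) :
    (pairFactor m ^ 2)⁻¹ * (1 / (2 * m) * (∫ w, ‖X w‖ ^ 2 * tailWeight m μ (m / (m + 1)) w) +
        1 / 2 * ∫ w, ‖X w‖ ^ 2 * tailWeight m μ (1 / (m + 1)) w) +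
      (∫ w, ‖X w‖ ^ 2 *
        (spectatorEnergy μ w * ((pairFactor m ^ 2)⁻¹ * (Real.pi ^ 2 / pairWidth m μ w)))) =
      -∫ w, ‖X w‖ ^ 2 * diagSymbol m μ w := by
  have hup := HasBochnerIntegral.of_integrable
    (integrable_norm_sq_mul_tailWeight hm hμ hX (m / (m + 1)))
  have hdown := HasBochnerIntegral.of_integrable
    (integrable_norm_sq_mul_tailWeight hm hμ hX (1 / (m + 1)))
  have hdiag := HasBochnerIntegral.of_integrable (integrable_norm_sq_mul_diagSymbol hm hμ hX)
  have hpair := ((hup.const_mul (1 / (2 * m))).add (hdown.const_mul (1 / 2))).const_mul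
    (pairFactor m ^ 2)⁻¹
  have hspectator := ((hdiag.const_mul (-1)).sub hpair).congr (g := fun w => ‖X w‖ ^ 2 *
      (spectatorEnergy μ w * ((pairFactor m ^ 2)⁻¹ * (Real.pi ^ 2 / pairWidth m μ w))))
    (Eventually.of_forall fun w => by
      linear_combination (-‖X w‖ ^ 2) * tailWeight_add_spectatorEnergy hm hμ w)
  rw [hspectator.2]
  ring

theorem AEAntisymm.add_greenSymbol_mul_chargeSum (hX : AEAntisymm X) (hΦ : AEAntisymm Φ)
    (hΨ : Ψ =ᵐ[volume] fun k => Φ k + (greenSymbol m μ k : ℂ) * PointInteraction.chargeSum X k) :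
    AEAntisymm Ψ := by
  intro σ
  filter_upwards [hΨ, (measurePreserving_permConf σ).quasiMeasurePreserving.ae hΨ, hΦ σ,
    hX.chargeSum σ] with k hk hσk hΦk hXk
  rw [hσk, hk, hΦk, hXk, greenSymbol_permConf]
  ring

end MomentumTails

section Domain

variable {n : ℕ} {m α μ : ℝ} {ψ φ : L2 (n + 2)} {ξ : L2 (n + 1)}

theorem IsDomainDecomposition.tails (hm : 0 < m) (hμ : 0 < μ)
    (hψ : IsDomainDecomposition m α μ ψ φ ξ) (hξ : InSobolev 1 ξ) :
    Integrable (tailUp m ψ ξ) ∧ Integrable (tailDown m ψ ξ) ∧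
      ∫ x, (1 / (2 * m) * tailUp m ψ ξ x + 1 / 2 * tailDown m ψ ξ x) =
        (∫ k, ((kinetic m k + μ) * ‖hat φ k‖ ^ 2 - μ * ‖hat ψ k‖ ^ 2)) +
          2 * (∫ k, starRingEnd ℂ (hat φ k) * chargeSum (hat ξ) k).re +
          (∫ k : Conf (n + 2), greenSymbol m μ k * offSum (hat ξ) k) -
          (n + 2) * ∫ w, ‖hat ξ w‖ ^ 2 * diagSymbol m μ w := by
  have hX := hξ.memFourierSobolev_hat zero_le_one
  have hXa := hψ.charge_antisymm.aeAntisymm_hat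
  have hΦ := hψ.regular_sobolev.memFourierSobolev_hat zero_le_two
  have hΨ : hat ψ =ᵐ[volume] fun k => hat φ k + (greenSymbol m μ k : ℂ) * chargeSum (hat ξ) k :=
    hψ.decomposition
  have hΨa := hXa.add_greenSymbol_mul_chargeSum hψ.regular_antisymm.aeAntisymm_hat hΨ
  have hup := hasBochnerIntegral_tailUp hm hμ hX (integrable_regularUp hm hμ hX hΦ hΨ)
  have hdown := hasBochnerIntegral_tailDown hm hμ hX (integrable_regularDown hm hμ hX hΦ hΨ 0)
  refine ⟨hup.1, hdown.1, ?_⟩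
  rw [((hup.const_mul (1 / (2 * m))).add (hdown.const_mul (1 / 2))).2]
  have hregular :=
    integral_regularUp_add_integral_regularDown hm hμ hX hXa hΦ (memLp_hat ψ) hΨa hΨ
  have hdiagonal := integral_tailWeight_add_spectatorEnergy hm hμ hX
  push_cast at hregular ⊢
  linear_combination hregular + ((n : ℝ) + 2) * hdiagonal

theorem IsDomainDecomposition.integral_conj_hat_mul_pairMap
    (hψ : IsDomainDecomposition m α μ ψ φ ξ) (hξ : InSobolev 1 ξ) :
    ∫ k, starRingEnd ℂ (hat φ k) * hat ξ (pairMap (Fin.last (n + 1)) k) =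
      (-1) ^ (n + 2 + 1) * ((2 * m * α / (m + 1) * ‖ξ‖ ^ 2 : ℝ) +
        ∫ w, starRingEnd ℂ (gammaHat m μ ξ w) * hat ξ w) := by
  obtain ⟨η, hη, htrace⟩ := hψ.boundary
  have hinner := htrace.inner_eq (hψ.regular_sobolev.memFourierSobolev_hat zero_le_two)
    (hξ.memFourierSobolev_hat zero_le_one)
  have hgamma : inner ℂ η ξ = ∫ w, starRingEnd ℂ (gammaHat m μ ξ w) * hat ξ w := by
    rw [inner_eq_integral_conj_hat_mul_hat]
    exact integral_congr_ae (hη.mono fun w hw => by simp only [hw])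
  have hπ : (((2 * Real.pi) ^ (3 / 2 : ℝ) : ℝ) : ℂ) ≠ 0 :=
    Complex.ofReal_ne_zero.2 (by positivity)
  rw [inner_smul_left, inner_add_left, inner_smul_left, inner_self_eq_norm_sq_to_K, hgamma,
    Complex.ofReal_inv, map_div₀, Complex.conj_ofReal, map_pow, map_neg, map_one,
    Complex.conj_ofReal, div_mul_eq_mul_div, div_eq_inv_mul] at hinner
  rw [← mul_left_cancel₀ (inv_ne_zero hπ) hinner, Complex.ofReal_mul, Complex.ofReal_pow]
  rfl

theorem IsDomainDecomposition.integral_conj_hat_mul_chargeSum (hm : 0 < m) (hμ : 0 < μ)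
    (hψ : IsDomainDecomposition m α μ ψ φ ξ) (hξ : InSobolev 1 ξ) :
    ∫ k, starRingEnd ℂ (hat φ k) * chargeSum (hat ξ) k =
      ((m + 1) / (2 * m) * contact m ξ * α +
        ((n + 2) * (∫ w, ‖hat ξ w‖ ^ 2 * diagSymbol m μ w) -
          ∫ k : Conf (n + 2), greenSymbol m μ k * offSum (hat ξ) k) : ℝ) := by
  have hX := hξ.memFourierSobolev_hat zero_le_one
  have hXa := hψ.charge_antisymm.aeAntisymm_hat
  have hsign : (-1 : ℂ) ^ (n + 1) * (-1) ^ (n + 2 + 1) = 1 := by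
    rw [← pow_add]
    exact Even.neg_one_pow ⟨n + 2, by ring⟩
  have hcontact : (m + 1) / (2 * m) * contact m ξ * α =
      (n + 2) * (2 * m * α / (m + 1) * ‖ξ‖ ^ 2) := by
    rw [contact]
    push_cast
    field_simp
    ring
  rw [integral_conj_mul_chargeSum hX hXa
    (hψ.regular_sobolev.memFourierSobolev_hat zero_le_two) hψ.regular_antisymm.aeAntisymm_hat,
    hψ.integral_conj_hat_mul_pairMap hξ, ← mul_assoc ((-1) ^ (n + 1)), hsign, one_mul, hcontact,
    Complex.ofReal_add, ← integral_conj_gammaHat_mul hm hμ hX hXa]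
  push_cast
  ring

theorem IsDomainDecomposition.inner_hamiltonian (hm : 0 < m) (hμ : 0 < μ)
    (hψ : IsDomainDecomposition m α μ ψ φ ξ) (hξ : InSobolev 1 ξ) :
    inner ℂ ψ (hamiltonian hψ) =
      ((∫ k, ((kinetic m k + μ) * ‖hat φ k‖ ^ 2 - μ * ‖hat ψ k‖ ^ 2) : ℝ) : ℂ) +
        starRingEnd ℂ (∫ k, starRingEnd ℂ (hat φ k) * chargeSum (hat ξ) k) := by
  have hΦ := hψ.regular_sobolev.memFourierSobolev_hat zero_le_two
  have henergy : Integrable fun k =>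
      (((kinetic m k + μ) * ‖hat φ k‖ ^ 2 - μ * ‖hat ψ k‖ ^ 2 : ℝ) : ℂ) :=
    (integrable_energy hm hμ hΦ (memLp_hat ψ)).ofReal
  have hcross := integrable_conj_mul_chargeSum (hξ.memFourierSobolev_hat zero_le_one) hΦ
  have hconj : Integrable fun k => starRingEnd ℂ (starRingEnd ℂ (hat φ k) * chargeSum (hat ξ) k) :=
    Complex.conjLIE.integrable_comp_iff.2 hcross
  rw [inner_eq_integral_conj_hat_mul_hat, ← integral_conj, ← integral_complex_ofReal,
    ← integral_add henergy hconj]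
  refine integral_congr_ae ?_
  filter_upwards [hψ.decomposition, hat_freeHamiltonianL2 m φ hψ.regular_sobolev,
    hat_add (freeHamiltonianL2 m φ hψ.regular_sobolev) ((μ : ℂ) • φ), hat_smul (μ : ℂ) φ,
    hat_smul (μ : ℂ) ψ, hat_sub (freeHamiltonianL2 m φ hψ.regular_sobolev + (μ : ℂ) • φ)
      ((μ : ℂ) • ψ)] with k hk hfree hadd hφ hψ' hsub
  have hgreen : (greenSymbol m μ k : ℂ) * (kinetic m k + μ) = 1 := by
    exact_mod_cast greenSymbol_mul_kinetic_add hm hμ k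
  have hψk : hat ψ k = hat φ k + (greenSymbol m μ k : ℂ) * chargeSum (hat ξ) k := hk
  rw [hamiltonian, hsub, hadd, hfree, hφ, hψ']
  push_cast
  rw [← Complex.conj_mul', ← Complex.conj_mul', hψk]
  simp only [map_add, map_mul, Complex.conj_ofReal, Complex.conj_conj]
  linear_combination (starRingEnd ℂ (chargeSum (hat ξ) k) * hat φ k) * hgreen

end Domain

end PointInteraction

end

theorem theorem3 (n : ℕ) (m α μ : ℝ) (hm : 0 < m) (hμ : 0 < μ)
    (ψ φ : PointInteraction.L2 (n + 2)) (ξ : PointInteraction.L2 (n + 1))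
    (hψ : PointInteraction.IsDomainDecomposition m α μ ψ φ ξ)
    (hξ : PointInteraction.InSobolev 1 ξ) :
    Integrable (PointInteraction.tailUp m ψ ξ) volume ∧
    Integrable (PointInteraction.tailDown m ψ ξ) volume ∧
    inner ℂ ψ (PointInteraction.hamiltonian hψ) =
      (((∫ k : PointInteraction.E3,
          (1 / (2 * m) * PointInteraction.tailUp m ψ ξ k
            + 1 / 2 * PointInteraction.tailDown m ψ ξ k))
        - (m + 1) / (2 * m) * PointInteraction.contact m ξ * α : ℝ) : ℂ) := by
  obtain ⟨hup, hdown, htails⟩ := hψ.tails hm hμ hξ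
  refine ⟨hup, hdown, ?_⟩
  rw [hψ.inner_hamiltonian hm hμ hξ, htails, hψ.integral_conj_hat_mul_chargeSum hm hμ hξ,
    Complex.conj_ofReal, Complex.ofReal_re, ← Complex.ofReal_add]
  congr 1
  ring
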